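/- Let $G$ be a (finite-dimensional, real) Lie group with Lie algebra $\mathfrak g$, let $K\subset G$ be a closed, connected subgroup with Lie algebra $\mathfrak k$, and let $\pi:G\to G/K$ be the projection, where $G/K$ carries its smooth structure as a homogeneous space (the one for which $\pi$ is a smooth submersion). Write $\mathfrak g_{\mathbb C}=\mathfrak g\otimes\mathbb C$, $\mathfrak k_{\mathbb C}=\mathfrak k\otimes\mathbb C$, and let bars denote complex conjugation. A generalized complex structure on a manifold $M$ is a smooth bundle endomorphism $\mathcal J$ of $TM\oplus T^*M$ that is orthogonal for the pairing $\langle X+\xi,Y+\eta\rangle=\eta(X)+\xi(Y)$, satisfies $\mathcal J^2=-1$, and whose $i$-eigenbundle $D\subset (TM\oplus T^*M)\otimes\mathbb C$ is closed under the ($\mathbb C$-bilinearly extended) Courant bracket $[X+\xi,Y+\eta]=[X,Y]+\iota_Xd\eta+\tfrac12 d(\iota_X\eta)-\iota_Yd\xi-\tfrac12 d(\iota_Y\xi)$. There is a bijection between the $G$-invariant generalized complex structures $\mathcal J$ on $G/K$ and the pairs $(E,\varepsilon)$ ("GC-pairs"), where $E$ is a complex Lie subalgebra of $\mathfrak g_{\mathbb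 C}$ and $\varepsilon\in\wedge^2E^*$, such that 1. $\mathfrak k_{\mathbb C}\subset E$; 2. $E+\overline E=\mathfrak g_{\mathbb C}$; 3. $d_E\varepsilon=0$, where $d_E\varepsilon(X,Y,Z)=\varepsilon(X,[Y,Z])+\varepsilon(Y,[Z,X])+\varepsilon(Z,[X,Y])$ for $X,Y,Z\in E$; 4. $\varepsilon(X,Y)=0$ for all $X\in\mathfrak k$, $Y\in E$; 5. if $X\in E\cap\overline E$ and $\varepsilon(X,Y)-\overline{\varepsilon(\overline X,\overline Y)}=0$ for all $Y\in E\cap\overline E$, then $X\in\mathfrak k_{\mathbb C}$. Under this bijection, $\mathcal J$ corresponds to the pair $(E,\varepsilon)$ with $$\{X+(d\pi_e)^*\xi : d\pi_e X+\xi\in D_{\pi(e)}\}=\{X+\xi\in\mathfrak g_{\mathbb C}\oplus\mathfrak g_{\mathbb C}^* : X\in E,\ \xi|_E=\varepsilon(X,\cdot)\},$$ where $D$ is the $i$-eigenbundle of $\mathcal J$. -/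

import Mathlib

open scoped Manifold ContDiff TensorProduct

noncomputable section

namespace GenCplx

/-! ## Generalized geometry on a smooth manifold modelled on a real normed space -/

section Manifold

variable (F : Type*) [NormedAddCommGroup F] [NormedSpace ℝ F]
  {M : Type*} [TopologicalSpace M] [ChartedSpace F M]

/-- The cotangent space of `M` at `x`. -/
abbrev CotangentSpace (x : M) : Type _ := TangentSpace 𝓘(ℝ, F) x →L[ℝ] ℝ

/-- The fibre at `x` of the generalized tangent bundle `TM ⊕ T*M`. -/
abbrev GenTangent (x : M) : Type _ := TangentSpace 𝓘(ℝ, F) x × CotangentSpace F x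

variable {F}

/-- The symmetric pairing `⟨X + ξ, Y + η⟩ = η(X) + ξ(Y)` on `T_xM ⊕ T*_xM`. -/
def pairing {x : M} (u v : GenTangent F x) : ℝ := v.2 u.1 + u.2 v.1

/-- A section of `TM ⊕ T*M` is smooth on `U`: its vector part is a smooth section of the tangent
bundle on `U`, and its covector part is a smooth section of the cotangent bundle on `U`. -/
def IsSmoothOn [IsManifold 𝓘(ℝ, F) ∞ M] (s : ∀ x : M, GenTangent F x) (U : Set M) : Prop :=
  ContMDiffOn 𝓘(ℝ, F) (𝓘(ℝ, F).tangent) ∞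
    (fun x => (⟨x, (s x).1⟩ : TangentBundle 𝓘(ℝ, F) M)) U ∧
  ContMDiffOn 𝓘(ℝ, F) (𝓘(ℝ, F).prod 𝓘(ℝ, F →L[ℝ] ℝ)) ∞
    (fun x => (Bundle.TotalSpace.mk' (F →L[ℝ] ℝ) x (s x).2 :
      Bundle.TotalSpace (F →L[ℝ] ℝ)
        (fun x : M => TangentSpace 𝓘(ℝ, F) x →L[ℝ] Bundle.Trivial M ℝ x))) U

/-- The one-form `η` written in the preferred chart `φ` at `x₀`, that is, the pullback of `η`
under `φ⁻¹`. -/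
def formInChart (η : ∀ x : M, CotangentSpace F x) (x₀ : M) (y : F) : F →L[ℝ] ℝ :=
  (η ((extChartAt 𝓘(ℝ, F) x₀).symm y)).comp
    (mfderiv 𝓘(ℝ, F) 𝓘(ℝ, F) (extChartAt 𝓘(ℝ, F) x₀).symm y)

/-- The contraction `ι_X dη = dη(X, ·)` at the point `x₀`, computed in the preferred chart `φ`
at `x₀`: in a chart, `dη(v, w) = (D_v η)(w) - (D_w η)(v)`. -/
def contractD (η : ∀ x : M, CotangentSpace F x) (x₀ : M) (X : TangentSpace 𝓘(ℝ, F) x₀) :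
    CotangentSpace F x₀ :=
  let A : F →L[ℝ] F →L[ℝ] ℝ := fderiv ℝ (formInChart η x₀) (extChartAt 𝓘(ℝ, F) x₀ x₀)
  let dφ : TangentSpace 𝓘(ℝ, F) x₀ →L[ℝ] F :=
    mfderiv 𝓘(ℝ, F) 𝓘(ℝ, F) (extChartAt 𝓘(ℝ, F) x₀) x₀
  ((A - A.flip) (dφ X)).comp dφ

/-- The Courant bracket of real sections,
`[X + ξ, Y + η] = [X, Y] + ι_X dη + ½ d(ι_X η) - ι_Y dξ - ½ d(ι_Y ξ)`. -/
def courant (s t : ∀ x : M, GenTangent F x) (x : M) : GenTangent F x :=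
  (VectorField.mlieBracket 𝓘(ℝ, F) (fun y => (s y).1) (fun y => (t y).1) x,
    contractD (fun y => (t y).2) x (s x).1
      + (1 / 2 : ℝ) • mvfderiv 𝓘(ℝ, F) (fun y => (t y).2 (s y).1) x
      - contractD (fun y => (s y).2) x (t x).1
      - (1 / 2 : ℝ) • mvfderiv 𝓘(ℝ, F) (fun y => (s y).2 (t y).1) x)

/-- The section `s + i t` of the complexification `(TM ⊕ T*M) ⊗ ℂ`. -/
def complexSection (s t : ∀ x : M, GenTangent F x) (x : M) : ℂ ⊗[ℝ] GenTangent F x :=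
  (1 : ℂ) ⊗ₜ[ℝ] s x + Complex.I ⊗ₜ[ℝ] t x

/-- The `ℂ`-bilinear extension of the Courant bracket, `[s + i t, s' + i t']`. -/
def complexCourant (s t s' t' : ∀ x : M, GenTangent F x) (x : M) : ℂ ⊗[ℝ] GenTangent F x :=
  complexSection (fun y => courant s s' y - courant t t' y)
    (fun y => courant s t' y + courant t s' y) x

/-- The `i`-eigenspace in `V ⊗ ℂ` of the complex-linear extension of a real endomorphism of `V`. -/
def iEigenspace {V : Type*} [AddCommGroup V] [Module ℝ V] (J : V →ₗ[ℝ] V) :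
    Submodule ℂ (ℂ ⊗[ℝ] V) :=
  Module.End.eigenspace (J.baseChange ℂ) Complex.I

variable (F M) in
/-- A generalized complex structure on `M`: a smooth bundle endomorphism `J` of `TM ⊕ T*M`
which is orthogonal for the pairing, satisfies `J² = -1`, and whose `i`-eigenbundle is closed under
the Courant bracket. -/
structure GenComplexStructure [IsManifold 𝓘(ℝ, F) ∞ M] where
  /-- the endomorphism of the fibre at `x` -/
  J : ∀ x : M, GenTangent F x →ₗ[ℝ] GenTangent F x
  smooth : ∀ U : Set M, IsOpen U → ∀ s : ∀ x : M, GenTangent F x,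
    IsSmoothOn s U → IsSmoothOn (fun x => J x (s x)) U
  orthogonal : ∀ (x : M) (u v : GenTangent F x), pairing (J x u) (J x v) = pairing u v
  sq_eq_neg : ∀ (x : M) (u : GenTangent F x), J x (J x u) = -u
  integrable : ∀ U : Set M, IsOpen U → ∀ s t s' t' : ∀ x : M, GenTangent F x,
    IsSmoothOn s U → IsSmoothOn t U → IsSmoothOn s' U → IsSmoothOn t' U →
    (∀ x ∈ U, complexSection s t x ∈ iEigenspace (J x)) →
    (∀ x ∈ U, complexSection s' t' x ∈ iEigenspace (J x)) →
    ∀ x ∈ U, complexCourant s t s' t' x ∈ iEigenspace (J x)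

/-- The action of `g` on the generalized tangent bundle,
`X + ξ ↦ dl_g X + ξ ∘ (dl_g)⁻¹`, where `l_g x = g • x`. -/
def translate {G : Type*} [SMul G M] (g : G) (x : M) (u : GenTangent F x) :
    GenTangent F (g • x) :=
  (mfderiv 𝓘(ℝ, F) 𝓘(ℝ, F) (fun y : M => g • y) x u.1,
    u.2.comp (mfderiv 𝓘(ℝ, F) 𝓘(ℝ, F) (fun y : M => g • y) x).inverse)

/-- A generalized complex structure is `G`-invariant if it commutes with the action of `G` on
`TM ⊕ T*M`. -/
def GenComplexStructure.IsInvariant [IsManifold 𝓘(ℝ, F) ∞ M] (𝒥 : GenComplexStructure F M)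
    (G : Type*) [SMul G M] : Prop :=
  ∀ (g : G) (x : M) (u : GenTangent F x), 𝒥.J (g • x) (translate g x u) = translate g x (𝒥.J x u)

end Manifold

/-! ## Linear algebra of Dirac structures -/

section Linear

variable {V W : Type*} [AddCommGroup V] [Module ℝ V] [TopologicalSpace V]
  [IsTopologicalAddGroup V] [ContinuousSMul ℝ V]
  [AddCommGroup W] [Module ℝ W] [TopologicalSpace W]
  [IsTopologicalAddGroup W] [ContinuousSMul ℝ W]

/-- The pullback `A^⋆ D = {X + A^*ξ | A X + ξ ∈ D}` of a subspace `D` of `(W ⊕ W*) ⊗ ℂ` under the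
complexification of a real linear map `A : V → W`. -/
def diracPullback (A : V →L[ℝ] W) (D : Submodule ℂ (ℂ ⊗[ℝ] (W × (W →L[ℝ] ℝ)))) :
    Submodule ℂ (ℂ ⊗[ℝ] (V × (V →L[ℝ] ℝ))) :=
  let push : V × (W →L[ℝ] ℝ) →ₗ[ℝ] W × (W →L[ℝ] ℝ) :=
    LinearMap.prodMap A.toLinearMap LinearMap.id
  let pull : V × (W →L[ℝ] ℝ) →ₗ[ℝ] V × (V →L[ℝ] ℝ) :=
    LinearMap.prodMap LinearMap.id
      { toFun := fun ξ => ξ.comp A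
        map_add' := fun _ _ => rfl
        map_smul' := fun _ _ => rfl }
  (D.comap (push.baseChange ℂ)).map (pull.baseChange ℂ)

/-- The component in `V ⊗ ℂ` of an element of `(V ⊕ V*) ⊗ ℂ`. -/
def vecPart : ℂ ⊗[ℝ] (V × (V →L[ℝ] ℝ)) →ₗ[ℂ] ℂ ⊗[ℝ] V :=
  (LinearMap.fst ℝ V (V →L[ℝ] ℝ)).baseChange ℂ

/-- The component in `V* ⊗ ℂ = (V ⊗ ℂ)*` of an element of `(V ⊕ V*) ⊗ ℂ`. -/
def covecPart : ℂ ⊗[ℝ] (V × (V →L[ℝ] ℝ)) →ₗ[ℂ] Module.Dual ℂ (ℂ ⊗[ℝ] V) :=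
  LinearMap.liftBaseChange ℂ
    (Module.Dual.baseChange (R := ℝ) (V := V) ℂ ∘ₗ ContinuousLinearMap.coeLM ℝ ∘ₗ
      LinearMap.snd ℝ V (V →L[ℝ] ℝ))

/-- `L(E, ε) = {X + ξ | X ∈ E, ξ|_E = ι_X ε}`, a subset of `(V ⊕ V*) ⊗ ℂ`. -/
def diracSpace (E : Submodule ℂ (ℂ ⊗[ℝ] V)) (ε : E [⋀^Fin 2]→ₗ[ℂ] ℂ) :
    Set (ℂ ⊗[ℝ] (V × (V →L[ℝ] ℝ))) :=
  {w | ∃ h : vecPart w ∈ E, ∀ Y : E, covecPart w Y = ε ![⟨vecPart w, h⟩, Y]}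

/-- Complex conjugation on the complexification `V ⊗ ℂ`. -/
def conj : (ℂ ⊗[ℝ] V) →ₛₗ[starRingEnd ℂ] (ℂ ⊗[ℝ] V) where
  toFun := TensorProduct.map Complex.conjAe.toLinearMap (LinearMap.id : V →ₗ[ℝ] V)
  map_add' := map_add _
  map_smul' c z := by
    induction z using TensorProduct.induction_on with
    | zero => simp
    | tmul a v => simp [TensorProduct.smul_tmul']
    | add a b ha hb => simp only [smul_add, map_add, ha, hb]

end Linear

/-! ## GC-pairs -/

section Lie

variable (V : Type*) [NormedAddCommGroup V] [NormedSpace ℝ V]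
  {G : Type*} [Group G] [TopologicalSpace G] [ChartedSpace V G]

/-- The Lie algebra `𝔨 = {X | exp(tX) ∈ K for all t}` of a closed subgroup `K` of `G`; the curve
`γ(t) = exp(tX)` is the integral curve through `1` of the left-invariant vector field of `X`. -/
def subgroupLieAlgebra (K : Subgroup G) : Set (GroupLieAlgebra 𝓘(ℝ, V) G) :=
  {X | ∃ γ : ℝ → G, γ 0 = 1 ∧
    IsMIntegralCurve (I := 𝓘(ℝ, V)) γ (mulInvariantVectorField X) ∧ ∀ t, γ t ∈ K}

/-- The complexification `𝔨 ⊗ ℂ`, as a subspace of `𝔤 ⊗ ℂ`. -/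
def subgroupLieAlgebraC (K : Subgroup G) : Submodule ℂ (ℂ ⊗[ℝ] GroupLieAlgebra 𝓘(ℝ, V) G) :=
  Submodule.span ℂ ((fun X => (1 : ℂ) ⊗ₜ[ℝ] X) '' subgroupLieAlgebra V K)

/-- A smooth real Lie group is smooth enough for the Lie bracket on its tangent space at `1`. -/
instance : ENat.LEInfty (minSmoothness ℝ 3) := ⟨by
  rw [minSmoothness_of_isRCLikeNormedField]; exact ENat.LEInfty.out⟩

variable [CompleteSpace V] [LieGroup 𝓘(ℝ, V) ∞ G]

variable {V} in
/-- The Lie algebra differential `d_E : ⋀² E* → ⋀³ E*`, evaluated on three elements of `E`. -/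
def dE (E : LieSubalgebra ℂ (ℂ ⊗[ℝ] GroupLieAlgebra 𝓘(ℝ, V) G))
    (ε : E.toSubmodule [⋀^Fin 2]→ₗ[ℂ] ℂ) (X Y Z : E) : ℂ :=
  ε ![X, ⁅Y, Z⁆] + ε ![Y, ⁅Z, X⁆] + ε ![Z, ⁅X, Y⁆]

/-- GC-pairs `(E, ε)` for the homogeneous space `G/K`. -/
structure GCPair (K : Subgroup G) where
  /-- the complex subalgebra of `𝔤 ⊗ ℂ` -/
  E : LieSubalgebra ℂ (ℂ ⊗[ℝ] GroupLieAlgebra 𝓘(ℝ, V) G)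
  /-- the alternating two-form on `E` -/
  ε : E.toSubmodule [⋀^Fin 2]→ₗ[ℂ] ℂ
  le_E : subgroupLieAlgebraC V K ≤ E.toSubmodule
  sup_conj : E.toSubmodule ⊔ E.toSubmodule.map conj = ⊤
  closed : ∀ X Y Z : E, dE E ε X Y Z = 0
  vanish : ∀ X ∈ subgroupLieAlgebra V K, ∀ (hX : (1 : ℂ) ⊗ₜ[ℝ] X ∈ E.toSubmodule)
    (Y : E.toSubmodule), ε ![⟨(1 : ℂ) ⊗ₜ[ℝ] X, hX⟩, Y] = 0
  -- `conj X ∈ E` says that `X` lies in the conjugate of `E`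
  nondegenerate : ∀ (X : E.toSubmodule) (hX : conj X.1 ∈ E.toSubmodule),
    (∀ (Y : E.toSubmodule) (hY : conj Y.1 ∈ E.toSubmodule),
      ε ![X, Y] - starRingEnd ℂ (ε ![⟨conj X.1, hX⟩, ⟨conj Y.1, hY⟩]) = 0) →
    X.1 ∈ subgroupLieAlgebraC V K

end Lie

end GenCplx

end

/-! An invariant structure is the transport of a single linear structure J₀ on W ⊕ W*, where W is
the tangent space at the base point, and J₀ can be transported exactly when it commutes with the
isotropy action of K (`GenComplexStructure.IsInvariant.isTransport`,
`HomogProj.exists_isTransport`). Giving J₀ is the same as giving its i-eigenspace D, a Lagrangian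
subspace of the complexified double with D ∩ D̄ = 0. Pulling D back along the surjection P = dπ_e
produces a Lagrangian L in (𝔤 ⊕ 𝔤*) ⊗ ℂ, from which D can be recovered, and every Lagrangian is L(E,
ε) for a unique pair (`IsLagrangian.exists_eq_diracSpace`, `diracSpace_injective`). It remains to
match the conditions.

Linear conditions: 𝔨 is the kernel of P, and a Lagrangian is a pullback along P when it contains the
vectors (X, 0) with X in 𝔨. These are conditions 1 and 4. Given them, D ∩ D̄ = 0 becomes conditions
2 and 5 (`linearGCPair_of_iEigenspace`, `LinearGCPair.exists_complexStructure`).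

Integrability: a Lagrangian subbundle is involutive when ⟨[s, t], u⟩ = 0 for all its sections.
Sections lift to functions G → 𝔤 ⊕ 𝔤* by left trivialization, and `pairing_courant` expresses the
pairing as an algebraic term, built from the bracket of 𝔤, plus pairings that each contain one
derivative of a lift. The complexified lifts have values in the constant space L, so their
derivatives do too, and the derivative terms cancel because L is isotropic (`courant_im`). What is
left is a trilinear form on L; its vanishing says that E is a subalgebra and d_E ε = 0
(`lieGCPair_iff`).

Isotropy: conversely, the J₀ built from a pair must commute with K. For X in 𝔨, the subalgebra E is
stable under ad X because it contains X, and conditions 3 and 4 together say that ε is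
infinitesimally invariant under ad X. A linear differential equation along paths in the fibre of π
integrates this to Ad(k)-invariance for k near 1, and connectedness of K does the rest
(`LieGCPair.preserves_of_curve`, `LieGCPair.preserves`). Smoothness of the transported structure
comes from smooth local sections of π. -/

open scoped Topology
open Set Filter VectorField

noncomputable section

namespace GenCplx

/-! ### Vector fields as derivations, in charts. -/

section Calculus
variable {E : Type*} [NormedAddCommGroup E] [NormedSpace ℝ E]
  {M : Type*} [TopologicalSpace M] [ChartedSpace E M]
  {F : Type*} [NormedAddCommGroup F] [NormedSpace ℝ F]

/-- The derivative of a vector-valued function along a tangent vector. -/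
def along (h : M → F) (x : M) (v : TangentSpace 𝓘(ℝ, E) x) : F := mvfderiv 𝓘(ℝ, E) h x v

/-- The vector field `X` in the chart at `x`. -/
def fieldInChart (X : ∀ x : M, TangentSpace 𝓘(ℝ, E) x) (x : M) (u : E) : E :=
  (mfderiv 𝓘(ℝ, E) 𝓘(ℝ, E) (extChartAt 𝓘(ℝ, E) x) ((extChartAt 𝓘(ℝ, E) x).symm u)
    (X ((extChartAt 𝓘(ℝ, E) x).symm u)))

lemma along_congr {f g : M → F} {x : M} (h : f =ᶠ[𝓝 x] g) (v : TangentSpace 𝓘(ℝ, E) x) :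
    along f x v = along g x v := by
  simp only [along, mvfderiv, h.mfderiv_eq]
  rw [h.self_of_nhds]

lemma one_le_infty : (1 : WithTop ℕ∞) ≤ ∞ := ENat.LEInfty.out

lemma two_le_infty : (2 : WithTop ℕ∞) ≤ ∞ := ENat.LEInfty.out

variable [IsManifold 𝓘(ℝ, E) ∞ M]

/-- differentiability of a vector field -/
abbrev DiffFieldAt (X : ∀ x : M, TangentSpace 𝓘(ℝ, E) x) (x : M) : Prop :=
  MDifferentiableAt 𝓘(ℝ, E) (𝓘(ℝ, E).tangent) (fun y => (⟨y, X y⟩ : TangentBundle 𝓘(ℝ, E) M)) x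

lemma mpullback_symm_eventuallyEq (X : ∀ x : M, TangentSpace 𝓘(ℝ, E) x) (x : M) :
    (mpullbackWithin 𝓘(ℝ, E) 𝓘(ℝ, E) (extChartAt 𝓘(ℝ, E) x).symm X (range 𝓘(ℝ, E)))
      =ᶠ[𝓝 (extChartAt 𝓘(ℝ, E) x x)] fieldInChart X x := by
  filter_upwards [extChartAt_target_mem_nhds (I := 𝓘(ℝ, E)) x] with u hu
  have h1 := mfderivWithin_extChartAt_symm_comp_mfderiv_extChartAt (I := 𝓘(ℝ, E)) (x := x) hu
  have h2 := mfderiv_extChartAt_comp_mfderivWithin_extChartAt_symm (I := 𝓘(ℝ, E)) (x := x) hu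
  have := ContinuousLinearMap.inverse_eq h1 h2
  simp only [mpullbackWithin_apply, fieldInChart]
  exact congrArg (fun L => L (X ((extChartAt 𝓘(ℝ, E) x).symm u))) this

lemma DiffFieldAt.fieldInChart [CompleteSpace E] {X : ∀ x : M, TangentSpace 𝓘(ℝ, E) x} {x : M}
    (hX : DiffFieldAt X x) :
    DifferentiableAt ℝ (fieldInChart X x) (extChartAt 𝓘(ℝ, E) x x) := by
  have h1 := (mdifferentiableWithinAt_univ.2 hX).differentiableWithinAt_mpullbackWithin_vectorField
  have h2 : ((extChartAt 𝓘(ℝ, E) x).symm ⁻¹' univ ∩ range 𝓘(ℝ, E) : Set E) = univ := by simp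
  rw [h2] at h1
  exact (differentiableWithinAt_univ.1 h1).congr_of_eventuallyEq
    (mpullback_symm_eventuallyEq X x).symm

/-- The bracket on a manifold is by definition a pullback from the chart, and the differential of
the chart undoes that pullback. Hence no differentiability of the fields is needed. -/
lemma mfderiv_extChartAt_mlieBracket (X Y : ∀ x : M, TangentSpace 𝓘(ℝ, E) x) (x : M) :
    (mfderiv 𝓘(ℝ, E) 𝓘(ℝ, E) (extChartAt 𝓘(ℝ, E) x) x (mlieBracket 𝓘(ℝ, E) X Y x) : E) =
      lieBracket ℝ (fieldInChart X x) (fieldInChart Y x) (extChartAt 𝓘(ℝ, E) x x) := by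
  have h2 : ((extChartAt 𝓘(ℝ, E) x).symm ⁻¹' univ ∩ range 𝓘(ℝ, E) : Set E) = univ := by simp
  have h3 := mlieBracketWithin_apply (I := 𝓘(ℝ, E)) (V := X) (W := Y) (s := univ) (x₀ := x)
  rw [h2, mlieBracketWithin_univ] at h3
  obtain ⟨e, he⟩ := isInvertible_mfderiv_extChartAt (I := 𝓘(ℝ, E))
    (mem_extChartAt_source (I := 𝓘(ℝ, E)) x)
  rw [← he, ContinuousLinearMap.inverse_equiv] at h3
  rw [h3, ← he, ← (mpullback_symm_eventuallyEq X x).lieBracket_vectorField_eq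
    (mpullback_symm_eventuallyEq Y x)]
  refine (e.apply_symm_apply _).trans ?_
  exact congrFun (lieBracketWithin_univ (𝕜 := ℝ)
    (V := mpullbackWithin 𝓘(ℝ, E) 𝓘(ℝ, E) (extChartAt 𝓘(ℝ, E) x).symm X (range 𝓘(ℝ, E)))
    (W := mpullbackWithin 𝓘(ℝ, E) 𝓘(ℝ, E) (extChartAt 𝓘(ℝ, E) x).symm Y (range 𝓘(ℝ, E)))) _

lemma along_eq_fderiv {h : M → F} {x y : M} (hy : y ∈ (extChartAt 𝓘(ℝ, E) x).source)
    (hh : MDifferentiableAt 𝓘(ℝ, E) 𝓘(ℝ, F) h y) (v : TangentSpace 𝓘(ℝ, E) y) :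
    along h y v = fderiv ℝ (h ∘ (extChartAt 𝓘(ℝ, E) x).symm) (extChartAt 𝓘(ℝ, E) x y)
      (mfderiv 𝓘(ℝ, E) 𝓘(ℝ, E) (extChartAt 𝓘(ℝ, E) x) y v) := by
  have h0 : h =ᶠ[𝓝 y] (h ∘ (extChartAt 𝓘(ℝ, E) x).symm) ∘ (extChartAt 𝓘(ℝ, E) x) := by
    filter_upwards [extChartAt_source_mem_nhds' (I := 𝓘(ℝ, E)) hy] with z hz
    simp only [Function.comp]
    rw [(extChartAt 𝓘(ℝ, E) x).left_inv hz]
  have hs : MDifferentiableAt 𝓘(ℝ, E) 𝓘(ℝ, E) (extChartAt 𝓘(ℝ, E) x).symm (extChartAt 𝓘(ℝ, E) x y) := by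
    have := mdifferentiableWithinAt_extChartAt_symm (I := 𝓘(ℝ, E))
      ((extChartAt 𝓘(ℝ, E) x).map_source hy)
    rw [ModelWithCorners.range_eq_univ] at this
    exact mdifferentiableWithinAt_univ.1 this
  have hh' : MDifferentiableAt 𝓘(ℝ, E) 𝓘(ℝ, F) h ((extChartAt 𝓘(ℝ, E) x).symm (extChartAt 𝓘(ℝ, E) x y)) := by
    rwa [(extChartAt 𝓘(ℝ, E) x).left_inv hy]
  have hc := hh'.comp _ hs
  rw [along_congr h0]
  have hy' : y ∈ (chartAt E x).source := by simpa using hy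
  have := mfderiv_comp y hc (mdifferentiableAt_extChartAt (I := 𝓘(ℝ, E)) hy')
  rw [mfderiv_eq_fderiv] at this
  exact congrArg (fun L => L v) this

omit [IsManifold 𝓘(ℝ, E) ∞ M] in
lemma differentiableAt_comp_extChartAt_symm {h : M → F} {x : M}
    (hh : MDifferentiableAt 𝓘(ℝ, E) 𝓘(ℝ, F) h x) : DifferentiableAt ℝ (h ∘ (extChartAt 𝓘(ℝ, E) x).symm) (extChartAt 𝓘(ℝ, E) x x) := by
  have := hh.differentiableWithinAt_writtenInExtChartAt
  rw [ModelWithCorners.range_eq_univ] at this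
  exact differentiableWithinAt_univ.1 this

omit [IsManifold 𝓘(ℝ, E) ∞ M] in
lemma contDiffAt_comp_symm {h : M → F} {x : M} (hh : ContMDiffAt 𝓘(ℝ, E) 𝓘(ℝ, F) ∞ h x) :
    ContDiffAt ℝ ∞ (h ∘ (extChartAt 𝓘(ℝ, E) x).symm) (extChartAt 𝓘(ℝ, E) x x) := by
  have := (contMDiffAt_iff.1 hh).2
  rw [ModelWithCorners.range_eq_univ] at this
  exact contDiffWithinAt_univ.1 this

/-- The derivative of a smooth function along a differentiable field, and its chart expression. -/
lemma along_field_aux [CompleteSpace E] {h : M → F} {Z : ∀ x : M, TangentSpace 𝓘(ℝ, E) x}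
    {x : M} (hh : ContMDiffAt 𝓘(ℝ, E) 𝓘(ℝ, F) ∞ h x) (hZ : DiffFieldAt Z x) :
      MDifferentiableAt 𝓘(ℝ, E) 𝓘(ℝ, F) (fun y => along h y (Z y)) x ∧
      (fun y => along h y (Z y)) ∘ (extChartAt 𝓘(ℝ, E) x).symm =ᶠ[𝓝 (extChartAt 𝓘(ℝ, E) x x)]
        fun u => fderiv ℝ (h ∘ (extChartAt 𝓘(ℝ, E) x).symm) u (fieldInChart Z x u) := by
  set φ := extChartAt 𝓘(ℝ, E) x with hφ
  have hC := contDiffAt_comp_symm hh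
  have e1 : (fun y => along h y (Z y)) =ᶠ[𝓝 x]
      (fun u => fderiv ℝ (h ∘ φ.symm) u (fieldInChart Z x u)) ∘ φ := by
    -- Order ∞ at a point does not give order ∞ on one neighbourhood, since the neighbourhood may
    -- shrink with the order. Order 1 does spread to nearby points, and that is enough here.
    have h1 : ContMDiffAt 𝓘(ℝ, E) 𝓘(ℝ, F) 1 h x := ContMDiffAt.of_le hh one_le_infty
    filter_upwards [extChartAt_source_mem_nhds (I := 𝓘(ℝ, E)) x,
      (contMDiffAt_iff_contMDiffAt_nhds (by simp)).1 h1] with y hy hy2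
    rw [along_eq_fderiv hy (hy2.mdifferentiableAt one_ne_zero)]
    simp only [fieldInChart, Function.comp]
    rw [← hφ, φ.left_inv hy]
  have hd : DifferentiableAt ℝ (fun u => fderiv ℝ (h ∘ φ.symm) u (fieldInChart Z x u)) (φ x) :=
    ((hC.fderiv_right (m := 1) two_le_infty).differentiableAt one_ne_zero).clm_apply
      hZ.fieldInChart
  refine ⟨(hd.mdifferentiableAt.comp x (mdifferentiableAt_extChartAt
    (mem_chart_source E x))).congr_of_eventuallyEq e1, ?_⟩
  have h2 : Tendsto φ.symm (𝓝 (φ x)) (𝓝 x) := by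
    have := continuousAt_extChartAt_symm (I := 𝓘(ℝ, E)) x
    rwa [ContinuousAt, extChartAt_to_inv] at this
  filter_upwards [h2.eventually e1, extChartAt_target_mem_nhds (I := 𝓘(ℝ, E)) x] with u hu hu2
  simp only [Function.comp] at hu ⊢
  rw [hu, φ.right_inv hu2]

lemma mdifferentiableAt_along [CompleteSpace E] {h : M → F} {Z : ∀ x : M, TangentSpace 𝓘(ℝ, E) x}
    {x : M} (hh : ContMDiffAt 𝓘(ℝ, E) 𝓘(ℝ, F) ∞ h x) (hZ : DiffFieldAt Z x) :
    MDifferentiableAt 𝓘(ℝ, E) 𝓘(ℝ, F) (fun y => along h y (Z y)) x :=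
  (along_field_aux hh hZ).1

/-- `dh([X, Y]) = X(Yh) - Y(Xh)`. -/
lemma along_mlieBracket [CompleteSpace E] {h : M → F} {X Y : ∀ x : M, TangentSpace 𝓘(ℝ, E) x}
    {x : M} (hh : ContMDiffAt 𝓘(ℝ, E) 𝓘(ℝ, F) ∞ h x) (hX : DiffFieldAt X x)
    (hY : DiffFieldAt Y x) :
    along h x (mlieBracket 𝓘(ℝ, E) X Y x) =
      along (fun y => along h y (Y y)) x (X x) - along (fun y => along h y (X y)) x (Y x) := by
  set φ := extChartAt 𝓘(ℝ, E) x with hφ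
  have hC : ContDiffAt ℝ ∞ (h ∘ φ.symm) (φ x) := contDiffAt_comp_symm hh
  have hsrc := mem_extChartAt_source (I := 𝓘(ℝ, E)) x
  rw [along_eq_fderiv hsrc (hh.mdifferentiableAt (by simp)),
    along_eq_fderiv hsrc (along_field_aux hh hX).1, along_eq_fderiv hsrc (along_field_aux hh hY).1,
    (along_field_aux hh hX).2.fderiv_eq, (along_field_aux hh hY).2.fderiv_eq, mfderiv_extChartAt_mlieBracket,
    fderiv_apply_lieBracket hC (by simpa using two_le_infty) hY.fieldInChart hX.fieldInChart]
  simp only [fieldInChart]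
  rw [hφ, extChartAt_to_inv]

end Calculus

/-! ### One-forms, the contraction of `dη`, and related vector fields. -/

section Forms
variable {E : Type*} [NormedAddCommGroup E] [NormedSpace ℝ E]
  {M : Type*} [TopologicalSpace M] [ChartedSpace E M] [IsManifold 𝓘(ℝ, E) ∞ M]
  {F : Type*} [NormedAddCommGroup F] [NormedSpace ℝ F]
  {E' : Type*} [NormedAddCommGroup E'] [NormedSpace ℝ E']
  {N : Type*} [TopologicalSpace N] [ChartedSpace E' N] [IsManifold 𝓘(ℝ, E') ∞ N]

/-- A vector field is smooth at a point. -/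
abbrev SmoothFieldAt (X : ∀ x : M, TangentSpace 𝓘(ℝ, E) x) (x : M) : Prop :=
  ContMDiffAt 𝓘(ℝ, E) (𝓘(ℝ, E).tangent) ∞ (fun y => (⟨y, X y⟩ : TangentBundle 𝓘(ℝ, E) M)) x

/-- A one-form is smooth at a point. -/
abbrev SmoothFormAt (η : ∀ x : M, CotangentSpace E x) (x : M) : Prop :=
  ContMDiffAt 𝓘(ℝ, E) (𝓘(ℝ, E).prod 𝓘(ℝ, E →L[ℝ] ℝ)) ∞
    (fun x => (Bundle.TotalSpace.mk' (E →L[ℝ] ℝ) x (η x) :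
      Bundle.TotalSpace (E →L[ℝ] ℝ)
        (fun x : M => TangentSpace 𝓘(ℝ, E) x →L[ℝ] Bundle.Trivial M ℝ x))) x

lemma trivializationAt_snd {x y : M} (hy : y ∈ (chartAt E x).source) (v : TangentSpace 𝓘(ℝ, E) y) :
    (trivializationAt E (TangentSpace 𝓘(ℝ, E)) x ⟨y, v⟩).2 =
      mfderiv 𝓘(ℝ, E) 𝓘(ℝ, E) (extChartAt 𝓘(ℝ, E) x) y v := by
  rw [← TangentBundle.continuousLinearMapAt_trivializationAt hy]
  exact (Bundle.Trivialization.continuousLinearMapAt_apply_of_mem ℝ _ (by simpa using hy) v).symm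

lemma smoothFieldAt_iff {X : ∀ x : M, TangentSpace 𝓘(ℝ, E) x} {x : M} :
    SmoothFieldAt X x ↔ ContMDiffAt 𝓘(ℝ, E) 𝓘(ℝ, E) ∞
      (fun y => (mfderiv 𝓘(ℝ, E) 𝓘(ℝ, E) (extChartAt 𝓘(ℝ, E) x) y (X y) : E)) x := by
  rw [SmoothFieldAt, Bundle.contMDiffAt_section]
  apply Filter.EventuallyEq.contMDiffAt_iff
  filter_upwards [chart_source_mem_nhds E x] with y hy
  exact trivializationAt_snd hy _

/-- Bundle smoothness of a one-form is phrased through trivializations, whereas `contractD`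
differentiates its chart expression; this identifies the two. -/
lemma inCoordinates_eq_formInChart (η : ∀ x : M, CotangentSpace E x) {x y : M}
    (hy : y ∈ (chartAt E x).source) :
    ContinuousLinearMap.inCoordinates E (TangentSpace 𝓘(ℝ, E)) ℝ (Bundle.Trivial M ℝ) x y x y (η y)
      = formInChart η x (extChartAt 𝓘(ℝ, E) x y) := by
  have hy' : y ∈ (extChartAt 𝓘(ℝ, E) x).source := by simpa using hy
  rw [ContinuousLinearMap.inCoordinates, TangentBundle.symmL_trivializationAt hy,
    ModelWithCorners.range_eq_univ, mfderivWithin_univ]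
  ext v
  simp only [formInChart]
  rw [(extChartAt 𝓘(ℝ, E) x).left_inv hy']
  have := Bundle.Trivial.continuousLinearMapAt_trivialization ℝ M ℝ y
  exact congrArg (fun L => L (η y (mfderiv 𝓘(ℝ, E) 𝓘(ℝ, E) (extChartAt 𝓘(ℝ, E) x).symm
    (extChartAt 𝓘(ℝ, E) x y) v))) this

lemma smoothFormAt_iff {η : ∀ x : M, CotangentSpace E x} {x : M} :
    SmoothFormAt η x ↔ ContMDiffAt 𝓘(ℝ, E) 𝓘(ℝ, E →L[ℝ] ℝ) ∞
      (fun y => formInChart η x (extChartAt 𝓘(ℝ, E) x y)) x := by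
  rw [SmoothFormAt, contMDiffAt_hom_bundle]
  have : ContMDiffAt 𝓘(ℝ, E) 𝓘(ℝ, E) ∞ (fun y : M => y) x := contMDiffAt_id
  have h2 : (fun y => formInChart η x (extChartAt 𝓘(ℝ, E) x y)) =ᶠ[𝓝 x]
      fun y => ContinuousLinearMap.inCoordinates E (TangentSpace 𝓘(ℝ, E)) ℝ (Bundle.Trivial M ℝ)
        x y x y (η y) := by
    filter_upwards [chart_source_mem_nhds E x] with y hy
    exact (inCoordinates_eq_formInChart η hy).symm
  exact ⟨fun h => h.2.congr_of_eventuallyEq h2, fun h => ⟨this, h.congr_of_eventuallyEq h2.symm⟩⟩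

lemma mfderiv_symm_mfderiv {x y : M} (hy : y ∈ (chartAt E x).source)
    (v : TangentSpace 𝓘(ℝ, E) y) :
    mfderiv 𝓘(ℝ, E) 𝓘(ℝ, E) (extChartAt 𝓘(ℝ, E) x).symm (extChartAt 𝓘(ℝ, E) x y)
      (mfderiv 𝓘(ℝ, E) 𝓘(ℝ, E) (extChartAt 𝓘(ℝ, E) x) y v) = v := by
  have := mfderivWithin_extChartAt_symm_comp_mfderiv_extChartAt' (I := 𝓘(ℝ, E))
    (x := x) (y := y) (by simpa using hy)
  rw [ModelWithCorners.range_eq_univ, mfderivWithin_univ] at this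
  exact congrArg (fun L => L v) this

lemma mfderiv_mfderiv_symm {x y : M} (hy : y ∈ (chartAt E x).source) (v : E) :
    (mfderiv 𝓘(ℝ, E) 𝓘(ℝ, E) (extChartAt 𝓘(ℝ, E) x) y
      (mfderiv 𝓘(ℝ, E) 𝓘(ℝ, E) (extChartAt 𝓘(ℝ, E) x).symm (extChartAt 𝓘(ℝ, E) x y) v) : E) = v := by
  have := mfderiv_extChartAt_comp_mfderivWithin_extChartAt_symm' (I := 𝓘(ℝ, E))
    (x := x) (y := y) (by simpa using hy)
  rw [ModelWithCorners.range_eq_univ, mfderivWithin_univ] at this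
  exact congrArg (fun L => L v) this

/-- Evaluation of a form at a field, through a chart. -/
lemma form_apply_eq (η : ∀ x : M, CotangentSpace E x) {x y : M}
    (hy : y ∈ (chartAt E x).source) (v : TangentSpace 𝓘(ℝ, E) y) :
    η y v = formInChart η x (extChartAt 𝓘(ℝ, E) x y)
      (mfderiv 𝓘(ℝ, E) 𝓘(ℝ, E) (extChartAt 𝓘(ℝ, E) x) y v) := by
  have hy' : y ∈ (extChartAt 𝓘(ℝ, E) x).source := by simpa using hy
  simp only [formInChart]
  rw [(extChartAt 𝓘(ℝ, E) x).left_inv hy']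
  exact congrArg (η y) (mfderiv_symm_mfderiv hy v).symm

lemma SmoothFormAt.apply {η : ∀ x : M, CotangentSpace E x} {X : ∀ x : M, TangentSpace 𝓘(ℝ, E) x}
    {x : M} (hη : SmoothFormAt η x) (hX : SmoothFieldAt X x) :
    ContMDiffAt 𝓘(ℝ, E) 𝓘(ℝ, ℝ) ∞ (fun y => η y (X y)) x := by
  refine ((smoothFormAt_iff.1 hη).clm_apply (smoothFieldAt_iff.1 hX)).congr_of_eventuallyEq ?_
  filter_upwards [chart_source_mem_nhds E x] with y hy
  exact form_apply_eq η hy _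

/-- In finite dimensions a form is smooth as soon as its values on smooth fields are. -/
lemma smoothFormAt_of_apply [FiniteDimensional ℝ E] {η : ∀ x : M, CotangentSpace E x} {x : M}
    (h : ∀ X : ∀ x : M, TangentSpace 𝓘(ℝ, E) x, SmoothFieldAt X x →
      ContMDiffAt 𝓘(ℝ, E) 𝓘(ℝ, ℝ) ∞ (fun y => η y (X y)) x) :
    SmoothFormAt η x := by
  rw [smoothFormAt_iff]
  have h1 : ∀ v : E, ContMDiffAt 𝓘(ℝ, E) 𝓘(ℝ, ℝ) ∞
      (fun y => formInChart η x (extChartAt 𝓘(ℝ, E) x y) v) x := by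
    intro v
    -- The field that is constantly `v` in the chart: evaluating `η` on it gives the `v`-component
    -- of the chart expression of `η`.
    let X : ∀ y : M, TangentSpace 𝓘(ℝ, E) y := fun y =>
      mfderiv 𝓘(ℝ, E) 𝓘(ℝ, E) (extChartAt 𝓘(ℝ, E) x).symm (extChartAt 𝓘(ℝ, E) x y) v
    have hX : SmoothFieldAt X x := by
      rw [smoothFieldAt_iff]
      refine (contMDiffAt_const (c := v)).congr_of_eventuallyEq ?_
      filter_upwards [chart_source_mem_nhds E x] with y hy
      exact mfderiv_mfderiv_symm hy v
    refine (h X hX).congr_of_eventuallyEq ?_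
    filter_upwards [chart_source_mem_nhds E x] with y hy
    exact ((form_apply_eq η hy _).trans
      (congrArg (formInChart η x (extChartAt 𝓘(ℝ, E) x y)) (mfderiv_mfderiv_symm hy v))).symm
  let b := Module.finBasis ℝ E
  have h2 : ContMDiffAt 𝓘(ℝ, E) 𝓘(ℝ, E →L[ℝ] ℝ) ∞ (fun y => ∑ i,
      (formInChart η x (extChartAt 𝓘(ℝ, E) x y) (b i)) • LinearMap.toContinuousLinearMap (b.coord i)) x :=
    ContMDiffAt.sum fun i _ => (h1 (b i)).smul contMDiffAt_const
  refine h2.congr_of_eventuallyEq (Eventually.of_forall fun y => ?_)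
  ext v
  conv_lhs => rw [← b.sum_repr v, map_sum]
  simp only [map_smul, _root_.sum_apply, smul_eq_mul, mul_comm]
  rfl

omit [IsManifold 𝓘(ℝ, E) ∞ M] [IsManifold 𝓘(ℝ, E') ∞ N] in
lemma along_comp {h : N → F} {f : M → N} {x : M} (hh : MDifferentiableAt 𝓘(ℝ, E') 𝓘(ℝ, F) h (f x))
    (hf : MDifferentiableAt 𝓘(ℝ, E) 𝓘(ℝ, E') f x) (v : TangentSpace 𝓘(ℝ, E) x) :
    along (fun y => h (f y)) x v = along h (f x) (mfderiv 𝓘(ℝ, E) 𝓘(ℝ, E') f x v) :=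
  mfderiv_comp_apply x hh hf v

lemma along_eq_fderiv_self {h : M → F} {x : M}
    (hh : MDifferentiableAt 𝓘(ℝ, E) 𝓘(ℝ, F) h x) (v : TangentSpace 𝓘(ℝ, E) x) :
    along h x v = fderiv ℝ (h ∘ (extChartAt 𝓘(ℝ, E) x).symm) (extChartAt 𝓘(ℝ, E) x x)
      (mfderiv 𝓘(ℝ, E) 𝓘(ℝ, E) (extChartAt 𝓘(ℝ, E) x) x v) :=
  along_eq_fderiv (mem_extChartAt_source (I := 𝓘(ℝ, E)) x) hh v

lemma along_clm_apply {F' : Type*} [NormedAddCommGroup F'] [NormedSpace ℝ F']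
    {g : M → F →L[ℝ] F'} {z : M → F} {x : M}
    (hg : MDifferentiableAt 𝓘(ℝ, E) 𝓘(ℝ, F →L[ℝ] F') g x)
    (hz : MDifferentiableAt 𝓘(ℝ, E) 𝓘(ℝ, F) z x) (v : TangentSpace 𝓘(ℝ, E) x) :
    along (fun y => g y (z y)) x v = (along g x v) (z x) + g x (along z x v) := by
  rw [along_eq_fderiv_self hg, along_eq_fderiv_self hz, along_eq_fderiv_self (hg.clm_apply hz)]
  have h1 := differentiableAt_comp_extChartAt_symm hg
  have h2 := differentiableAt_comp_extChartAt_symm hz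
  have h3 := fderiv_clm_apply h1 h2
  have h4 : (fun y => g y (z y)) ∘ (extChartAt 𝓘(ℝ, E) x).symm = fun u =>
    (g ∘ (extChartAt 𝓘(ℝ, E) x).symm) u ((z ∘ (extChartAt 𝓘(ℝ, E) x).symm) u) := rfl
  rw [h4, h3]
  simp only [Function.comp, extChartAt_to_inv]
  exact add_comm _ _

lemma SmoothFieldAt.diff {X : ∀ x : M, TangentSpace 𝓘(ℝ, E) x} {x : M} (h : SmoothFieldAt X x) :
    DiffFieldAt X x := ContMDiffAt.mdifferentiableAt h (by simp)

/-- `(ι_X dη)(Z) = X(η(Z)) - Z(η(X)) - η([X, Z])`. -/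
lemma contractD_apply [CompleteSpace E] {η : ∀ x : M, CotangentSpace E x}
    {X Z : ∀ x : M, TangentSpace 𝓘(ℝ, E) x} {x : M} (hη : SmoothFormAt η x)
    (hX : SmoothFieldAt X x) (hZ : SmoothFieldAt Z x) :
    contractD η x (X x) (Z x) = along (fun y => η y (Z y)) x (X x)
      - along (fun y => η y (X y)) x (Z x) - η x (mlieBracket 𝓘(ℝ, E) X Z x) := by
  set φ := extChartAt 𝓘(ℝ, E) x with hφ
  have hφs : ContMDiffAt 𝓘(ℝ, E) 𝓘(ℝ, E) ∞ φ x := contMDiffAt_extChartAt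
  have hg := (smoothFormAt_iff.1 hη).mdifferentiableAt (by simp)
  have hg' : ∀ v : TangentSpace 𝓘(ℝ, E) x,
      along (fun y => formInChart η x (φ y)) x v = fderiv ℝ (formInChart η x) (φ x) (along φ x v) := by
    intro v
    rw [along_eq_fderiv_self hg]
    congr 1
    apply Filter.EventuallyEq.fderiv_eq
    filter_upwards [extChartAt_target_mem_nhds (I := 𝓘(ℝ, E)) x] with u hu
    simp only [Function.comp]
    rw [φ.right_inv hu]
  -- The product rule in the chart: the part differentiating the coefficients of `η` antisymmetrizes
  -- to `dη`, the part differentiating the field antisymmetrizes to `η` of the bracket.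
  have key : ∀ {Y : ∀ x : M, TangentSpace 𝓘(ℝ, E) x}, SmoothFieldAt Y x →
      ∀ v : TangentSpace 𝓘(ℝ, E) x, along (fun y => η y (Y y)) x v =
        fderiv ℝ (formInChart η x) (φ x) (along φ x v) (along φ x (Y x)) +
          formInChart η x (φ x) (along (fun y => along φ y (Y y)) x v) := by
    intro Y hY v
    rw [← hg']
    refine Eq.trans (along_congr ?_ v)
      (along_clm_apply hg ((smoothFieldAt_iff.1 hY).mdifferentiableAt (by simp)) v)
    filter_upwards [chart_source_mem_nhds E x] with y hy
    exact form_apply_eq η hy _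
  rw [key hX, key hZ, form_apply_eq η (mem_chart_source E x)]
  have h3 : (mfderiv 𝓘(ℝ, E) 𝓘(ℝ, E) (extChartAt 𝓘(ℝ, E) x) x (mlieBracket 𝓘(ℝ, E) X Z x) : E) =
    along φ x (mlieBracket 𝓘(ℝ, E) X Z x) := rfl
  rw [h3, along_mlieBracket hφs hX.diff hZ.diff, map_sub]
  have h4 : contractD η x (X x) (Z x) =
    fderiv ℝ (formInChart η x) (φ x) (along φ x (X x)) (along φ x (Z x)) -
    fderiv ℝ (formInChart η x) (φ x) (along φ x (Z x)) (along φ x (X x)) := rfl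
  rw [h4]
  ring

/-- Test both sides against a chart `ψ` at `f x`. Relatedness gives `Y(ψ ∘ f) = (Y'ψ) ∘ f`, so the
two commutators of derivations agree. The map need not be a diffeomorphism, so this applies to the
projection `π`. -/
lemma mfderiv_mlieBracket_of_related [CompleteSpace E] [CompleteSpace E'] {f : M → N} {x : M}
    (hf : ContMDiffAt 𝓘(ℝ, E) 𝓘(ℝ, E') ∞ f x)
    {X Y : ∀ x : M, TangentSpace 𝓘(ℝ, E) x} {X' Y' : ∀ x : N, TangentSpace 𝓘(ℝ, E') x}
    (hX : DiffFieldAt X x) (hY : DiffFieldAt Y x)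
    (hX' : DiffFieldAt X' (f x)) (hY' : DiffFieldAt Y' (f x))
    (hXX' : ∀ᶠ y in 𝓝 x, mfderiv 𝓘(ℝ, E) 𝓘(ℝ, E') f y (X y) = X' (f y))
    (hYY' : ∀ᶠ y in 𝓝 x, mfderiv 𝓘(ℝ, E) 𝓘(ℝ, E') f y (Y y) = Y' (f y)) :
    mfderiv 𝓘(ℝ, E) 𝓘(ℝ, E') f x (mlieBracket 𝓘(ℝ, E) X Y x) =
      mlieBracket 𝓘(ℝ, E') X' Y' (f x) := by
  set ψ := extChartAt 𝓘(ℝ, E') (f x) with hψ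
  have hψs : ContMDiffAt 𝓘(ℝ, E') 𝓘(ℝ, E') ∞ ψ (f x) := contMDiffAt_extChartAt
  have h1 := along_mlieBracket (h := fun y => ψ (f y)) (hψs.comp x hf) hX hY
  have key : ∀ {Z : ∀ x : M, TangentSpace 𝓘(ℝ, E) x} {Z' : ∀ x : N, TangentSpace 𝓘(ℝ, E') x},
      DiffFieldAt Z' (f x) →
      (∀ᶠ y in 𝓝 x, mfderiv 𝓘(ℝ, E) 𝓘(ℝ, E') f y (Z y) = Z' (f y)) →
      ∀ v : TangentSpace 𝓘(ℝ, E) x, along (fun y => along (fun y => ψ (f y)) y (Z y)) x v =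
        along (fun w => along ψ w (Z' w)) (f x) (mfderiv 𝓘(ℝ, E) 𝓘(ℝ, E') f x v) := by
    intro Z Z' hZ' hZZ' v
    rw [← along_comp (mdifferentiableAt_along hψs hZ') (hf.mdifferentiableAt (by simp))]
    apply along_congr
    have hf1 : ContMDiffAt 𝓘(ℝ, E) 𝓘(ℝ, E') 1 f x := ContMDiffAt.of_le hf one_le_infty
    filter_upwards [hZZ', (contMDiffAt_iff_contMDiffAt_nhds (by simp)).1 hf1,
      hf.continuousAt (chart_source_mem_nhds E' (f x))] with y hy hy1 hy2
    rw [along_comp (mdifferentiableAt_extChartAt hy2) (hy1.mdifferentiableAt one_ne_zero), hy]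
  rw [key hX' hXX', key hY' hYY', along_comp (hψs.mdifferentiableAt (by simp))
    (hf.mdifferentiableAt (by simp)), hXX'.self_of_nhds, hYY'.self_of_nhds,
    ← along_mlieBracket hψs hX' hY'] at h1
  obtain ⟨e, he⟩ := isInvertible_mfderiv_extChartAt (I := 𝓘(ℝ, E'))
    (mem_extChartAt_source (I := 𝓘(ℝ, E')) (f x))
  apply e.injective
  rw [← ContinuousLinearEquiv.coe_coe, he]
  exact h1
end Forms

/-! ### Smooth actions and transport of tangent vectors. -/

section Action
variable {V : Type*} [NormedAddCommGroup V] [NormedSpace ℝ V]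
  {W : Type*} [NormedAddCommGroup W] [NormedSpace ℝ W]
  {G : Type*} [Group G] [TopologicalSpace G] [ChartedSpace V G] [LieGroup 𝓘(ℝ, V) ∞ G]
  {M : Type*} [TopologicalSpace M] [ChartedSpace W M] [IsManifold 𝓘(ℝ, W) ∞ M] [MulAction G M]
  {E : Type*} [NormedAddCommGroup E] [NormedSpace ℝ E]
  {N : Type*} [TopologicalSpace N] [ChartedSpace E N]

variable (V W G M) in
/-- The action of `G` on `M` is smooth. -/
def SmoothAction : Prop :=
  ContMDiff (𝓘(ℝ, V).prod 𝓘(ℝ, W)) 𝓘(ℝ, W) ∞ (fun p : G × M => p.1 • p.2)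

variable (W) in
/-- The differential of the action of a group element. -/
def dsmul (g : G) (x : M) : W →L[ℝ] W := mfderiv 𝓘(ℝ, W) 𝓘(ℝ, W) (fun y : M => g • y) x

omit [LieGroup 𝓘(ℝ, V) ∞ G] [IsManifold 𝓘(ℝ, W) ∞ M] in
lemma SmoothAction.smul_left (h : SmoothAction V W G M) (g : G) :
    ContMDiff 𝓘(ℝ, W) 𝓘(ℝ, W) ∞ (fun y : M => g • y) :=
  h.comp (contMDiff_const.prodMk contMDiff_id)

omit [LieGroup 𝓘(ℝ, V) ∞ G] [IsManifold 𝓘(ℝ, W) ∞ M] in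
lemma dsmul_mul (h : SmoothAction V W G M) (g k : G) (x : M) (v : W) :
    dsmul W (g * k) x v = dsmul W g (k • x) (dsmul W k x v) := by
  have h1 : (fun y : M => (g * k) • y) = (fun y : M => g • y) ∘ (fun y : M => k • y) := by
    ext y; simp [mul_smul]
  rw [dsmul, h1]
  exact mfderiv_comp_apply x ((h.smul_left g).mdifferentiableAt (by simp))
    ((h.smul_left k).mdifferentiableAt (by simp)) v

omit [Group G] [TopologicalSpace G] [ChartedSpace V G] [LieGroup 𝓘(ℝ, V) ∞ G] [MulAction G M] [IsManifold 𝓘(ℝ, W) ∞ M] in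
lemma dsmul_one [Group G] [MulAction G M] (x : M) (v : W) : dsmul W (1 : G) x v = v := by
  have h1 : (fun y : M => (1 : G) • y) = id := by ext y; simp
  rw [dsmul, h1, mfderiv_id]
  rfl

omit [LieGroup 𝓘(ℝ, V) ∞ G] [IsManifold 𝓘(ℝ, W) ∞ M] in
lemma dsmul_inv_dsmul (h : SmoothAction V W G M) (g : G) (x : M) (v : W) :
    dsmul W g⁻¹ (g • x) (dsmul W g x v) = v := by
  rw [← dsmul_mul h, inv_mul_cancel, dsmul_one]

omit [LieGroup 𝓘(ℝ, V) ∞ G] [IsManifold 𝓘(ℝ, W) ∞ M] in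
lemma dsmul_dsmul_inv (h : SmoothAction V W G M) (g : G) (x : M) (v : W) :
    dsmul W g x (dsmul W g⁻¹ (g • x) v) = v := by
  have := dsmul_mul h g g⁻¹ (g • x) v
  rw [mul_inv_cancel, dsmul_one, inv_smul_smul] at this
  exact this.symm

/-- This is the full tangent map of `a` evaluated on vectors whose first component is zero, which
gives joint smoothness in the parameter and the tangent vector. -/
lemma contMDiffAt_partial_tangent
    {V' : Type*} [NormedAddCommGroup V'] [NormedSpace ℝ V']
    {A : Type*} [TopologicalSpace A] [ChartedSpace V' A] [IsManifold 𝓘(ℝ, V') ∞ A]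
    {W' : Type*} [NormedAddCommGroup W'] [NormedSpace ℝ W']
    {C : Type*} [TopologicalSpace C] [ChartedSpace W' C] [IsManifold 𝓘(ℝ, W') ∞ C]
    {a : A × M → C} (h : ContMDiff (𝓘(ℝ, V').prod 𝓘(ℝ, W)) 𝓘(ℝ, W') ∞ a)
    {γ : N → A} {β : N → TangentBundle 𝓘(ℝ, W) M} {n : N}
    (hγ : ContMDiffAt 𝓘(ℝ, E) 𝓘(ℝ, V') ∞ γ n) (hβ : ContMDiffAt 𝓘(ℝ, E) 𝓘(ℝ, W).tangent ∞ β n) :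
    ContMDiffAt 𝓘(ℝ, E) 𝓘(ℝ, W').tangent ∞
      (fun m => (⟨a (γ m, (β m).1), mfderiv 𝓘(ℝ, W) 𝓘(ℝ, W') (fun y => a (γ m, y)) (β m).1 (β m).2⟩ :
        TangentBundle 𝓘(ℝ, W') C)) n := by
  let f₀ : A → TangentBundle 𝓘(ℝ, V') A := fun g ↦ Bundle.TotalSpace.mk' V' g 0
  have s₀ : ContMDiff 𝓘(ℝ, V') 𝓘(ℝ, V').tangent ∞ f₀ := Bundle.contMDiff_zeroSection _ _
  have S₁ : ContMDiffAt 𝓘(ℝ, E) (𝓘(ℝ, V').tangent.prod 𝓘(ℝ, W).tangent) ∞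
    (fun m => (f₀ (γ m), β m)) n := (s₀.contMDiffAt.comp n hγ).prodMk hβ
  let F₂ : (TangentBundle 𝓘(ℝ, V') A × TangentBundle 𝓘(ℝ, W) M) →
    TangentBundle (𝓘(ℝ, V').prod 𝓘(ℝ, W)) (A × M) :=
    (equivTangentBundleProd 𝓘(ℝ, V') A 𝓘(ℝ, W) M).symm
  have S₂ : ContMDiff (𝓘(ℝ, V').tangent.prod 𝓘(ℝ, W).tangent)
      (𝓘(ℝ, V').prod 𝓘(ℝ, W)).tangent ∞ F₂ :=
    contMDiff_equivTangentBundleProd_symm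
  let F₃ : TangentBundle (𝓘(ℝ, V').prod 𝓘(ℝ, W)) (A × M) → TangentBundle 𝓘(ℝ, W') C :=
    tangentMap (𝓘(ℝ, V').prod 𝓘(ℝ, W)) 𝓘(ℝ, W') a
  have S₃ : ContMDiff (𝓘(ℝ, V').prod 𝓘(ℝ, W)).tangent 𝓘(ℝ, W').tangent ∞ F₃ :=
    ContMDiff.contMDiff_tangentMap h (m := ∞) (by simp)
  have S := (S₃.comp S₂).contMDiffAt.comp n S₁
  refine S.congr_of_eventuallyEq (Eventually.of_forall fun m => ?_)
  have hm : MDifferentiableAt (𝓘(ℝ, V').prod 𝓘(ℝ, W)) 𝓘(ℝ, W') a (γ m, (β m).1) :=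
    h.mdifferentiableAt (by simp)
  simp only [Function.comp_apply, tangentMap, F₃, F₂, f₀]
  refine congrArg (Bundle.TotalSpace.mk _) ?_
  have := mfderiv_prod_eq_add_apply hm
    (v := (show V' × W from ((0 : V'), ((β m).2 : TangentSpace 𝓘(ℝ, W) (β m).1))))
  refine Eq.trans ?_ this.symm
  have h0 : mfderiv 𝓘(ℝ, V') 𝓘(ℝ, W') (fun z => a (z, (β m).1)) (γ m) (0 : V') = 0 := map_zero _
  exact (((congrArg (· + _) h0).trans (zero_add _)).symm :)

lemma tangent_mk_congr {a b : M} (h : a = b) (v : W) :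
    (⟨a, v⟩ : TangentBundle 𝓘(ℝ, W) M) = ⟨b, v⟩ := by subst h; rfl

/-- A curve of tangent vectors over a constant base point is smooth iff it is so as a
vector-valued map. -/
lemma contMDiffAt_tangent_const_iff {o : M} {f : N → W} {n : N} :
    ContMDiffAt 𝓘(ℝ, E) 𝓘(ℝ, W).tangent ∞ (fun m => (⟨o, f m⟩ : TangentBundle 𝓘(ℝ, W) M)) n ↔
      ContMDiffAt 𝓘(ℝ, E) 𝓘(ℝ, W) ∞ f n := by
  rw [Bundle.contMDiffAt_totalSpace]
  let L : W →L[ℝ] W := mfderiv 𝓘(ℝ, W) 𝓘(ℝ, W) (extChartAt 𝓘(ℝ, W) o) o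
  let L' : W →L[ℝ] W :=
    mfderiv 𝓘(ℝ, W) 𝓘(ℝ, W) (extChartAt 𝓘(ℝ, W) o).symm (extChartAt 𝓘(ℝ, W) o o)
  have h1 : (fun m => (trivializationAt W (TangentSpace 𝓘(ℝ, W)) o
      (⟨o, f m⟩ : TangentBundle 𝓘(ℝ, W) M)).2) = fun m => L (f m) :=
    funext fun m => trivializationAt_snd (mem_chart_source W o) (f m)
  have h2 : f = fun m => L' (L (f m)) :=
    funext fun m => (mfderiv_symm_mfderiv (mem_chart_source W o) (f m)).symm
  constructor
  · intro h
    have h3 := h.2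
    rw [h1] at h3
    rw [h2]
    exact L'.contMDiff.contMDiffAt.comp n h3
  · intro h
    refine ⟨contMDiffAt_const, ?_⟩
    rw [h1]
    exact L.contMDiff.contMDiffAt.comp n h

/-- The value at `g` of a field on `M`, moved back to the base point by `g⁻¹`. -/
def hat (π : G → M) (Z : ∀ x : M, TangentSpace 𝓘(ℝ, W) x) (g : G) : W :=
  dsmul W g⁻¹ (π g) (Z (π g))

/-- Equivariance puts every value in the one tangent space at `π 1`, so smoothness into the tangent
bundle reduces to that of a vector-valued function. -/
lemma contMDiffAt_hat (h : SmoothAction V W G M) {π : G → M}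
    (hπ : ContMDiff 𝓘(ℝ, V) 𝓘(ℝ, W) ∞ π) (heq : ∀ g k, π (g * k) = g • π k)
    {Z : ∀ x : M, TangentSpace 𝓘(ℝ, W) x} {g : G} (hZ : SmoothFieldAt Z (π g)) :
    ContMDiffAt 𝓘(ℝ, V) 𝓘(ℝ, W) ∞ (hat π Z) g := by
  have hi : ContMDiffAt 𝓘(ℝ, V) 𝓘(ℝ, V) ∞ (fun g : G => g⁻¹) g := (contMDiff_inv 𝓘(ℝ, V) ∞).contMDiffAt
  have h1 := contMDiffAt_partial_tangent h (γ := fun g : G => g⁻¹)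
    (β := fun g => (⟨π g, Z (π g)⟩ : TangentBundle 𝓘(ℝ, W) M)) hi
    (ContMDiffAt.comp g hZ hπ.contMDiffAt)
  refine (contMDiffAt_tangent_const_iff (o := π 1)).1
    (h1.congr_of_eventuallyEq (Eventually.of_forall fun k => ?_))
  exact tangent_mk_congr (by rw [← heq, inv_mul_cancel]) _

lemma contMDiffAt_dsmul (h : SmoothAction V W G M) {γ : N → G} {f : N → W} (o : M) {n : N}
    (hγ : ContMDiffAt 𝓘(ℝ, E) 𝓘(ℝ, V) ∞ γ n) (hf : ContMDiffAt 𝓘(ℝ, E) 𝓘(ℝ, W) ∞ f n) :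
    ContMDiffAt 𝓘(ℝ, E) 𝓘(ℝ, W).tangent ∞
      (fun m => (⟨γ m • o, dsmul W (γ m) o (f m)⟩ : TangentBundle 𝓘(ℝ, W) M)) n :=
  contMDiffAt_partial_tangent h (β := fun m => (⟨o, f m⟩ : TangentBundle 𝓘(ℝ, W) M)) hγ
    (contMDiffAt_tangent_const_iff.2 hf)

end Action

/-! ### Left trivialization and brackets of left-invariant fields with varying coefficients. -/

section LieGroup
variable {V : Type*} [NormedAddCommGroup V] [NormedSpace ℝ V]
  {W : Type*} [NormedAddCommGroup W] [NormedSpace ℝ W]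
  {G : Type*} [Group G] [TopologicalSpace G] [ChartedSpace V G] [LieGroup 𝓘(ℝ, V) ∞ G]
  {M : Type*} [TopologicalSpace M] [ChartedSpace W M] [IsManifold 𝓘(ℝ, W) ∞ M] [MulAction G M]
  {F : Type*} [NormedAddCommGroup F] [NormedSpace ℝ F]

variable (V G) in
lemma smoothAction_self : SmoothAction V V G G := contMDiff_mul 𝓘(ℝ, V) ∞

/-- The left-invariant field with varying coefficient `f`. -/
def leftField (f : G → V) (g : G) : TangentSpace 𝓘(ℝ, V) g := dsmul V g (1 : G) (f g)

omit [LieGroup 𝓘(ℝ, V) ∞ G] in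
lemma leftField_const (v : V) :
    leftField (fun _ : G => v) = mulInvariantVectorField (I := 𝓘(ℝ, V)) (G := G) v := rfl

lemma smoothFieldAt_leftField {f : G → V} {g : G} (hf : ContMDiffAt 𝓘(ℝ, V) 𝓘(ℝ, V) ∞ f g) :
    SmoothFieldAt (leftField f) g := by
  have := contMDiffAt_dsmul (smoothAction_self V G) (1 : G) (contMDiffAt_id (x := g)) hf
  exact this.congr_of_eventuallyEq (Eventually.of_forall fun k =>
    (tangent_mk_congr (mul_one k) _).symm)

omit [LieGroup 𝓘(ℝ, V) ∞ G] [IsManifold 𝓘(ℝ, W) ∞ M] in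
/-- An equivariant map intertwines left translations. -/
lemma mfderiv_dsmul (h : SmoothAction V W G M) {π : G → M}
    (hπ : ContMDiff 𝓘(ℝ, V) 𝓘(ℝ, W) ∞ π) (hs : SmoothAction V V G G)
    (heq : ∀ g k, π (g * k) = g • π k) (g k : G) (v : V) :
    mfderiv 𝓘(ℝ, V) 𝓘(ℝ, W) π (g * k) (dsmul V g k v) =
      dsmul W g (π k) (mfderiv 𝓘(ℝ, V) 𝓘(ℝ, W) π k v) := by
  have h1 : π ∘ (fun y : G => g • y) = (fun y : M => g • y) ∘ π := funext fun k => heq g k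
  have h2 : mfderiv 𝓘(ℝ, V) 𝓘(ℝ, W) (π ∘ (fun y : G => g • y)) k v = _ :=
    mfderiv_comp_apply k (hπ.mdifferentiableAt (x := g * k) (by simp))
    ((hs.smul_left g).mdifferentiableAt (x := k) (by simp)) v
  have h3 := mfderiv_comp_apply k ((h.smul_left g).mdifferentiableAt (x := π k) (by simp))
    (hπ.mdifferentiableAt (x := k) (by simp)) v
  rw [h1] at h2
  exact h2.symm.trans h3

lemma mfderiv_leftField (h : SmoothAction V W G M) {π : G → M}
    (hπ : ContMDiff 𝓘(ℝ, V) 𝓘(ℝ, W) ∞ π)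
    (heq : ∀ g k, π (g * k) = g • π k) (f : G → V) (g : G) :
    mfderiv 𝓘(ℝ, V) 𝓘(ℝ, W) π g (leftField f g) =
      dsmul W g (π 1) (mfderiv 𝓘(ℝ, V) 𝓘(ℝ, W) π 1 (f g)) := by
  have := mfderiv_dsmul h hπ (smoothAction_self V G) heq g 1 (f g)
  rw [mul_one] at this
  exact this

lemma mdifferentiableAt_sum_clm {E E' : Type*} [NormedAddCommGroup E] [NormedSpace ℝ E]
    [NormedAddCommGroup E'] [NormedSpace ℝ E']
    {ι : Type*} [Fintype ι] (c : ι → E →L[ℝ] E') (f : ι → M → E) {x : M}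
    (h : ∀ i, MDifferentiableAt 𝓘(ℝ, W) 𝓘(ℝ, E) (f i) x) :
    MDifferentiableAt 𝓘(ℝ, W) 𝓘(ℝ, E') (fun y => ∑ i, c i (f i y)) x := by
  have : ∀ i, MDifferentiableAt 𝓘(ℝ, W) 𝓘(ℝ, E') (fun y => c i (f i y)) x := fun i =>
    (c i).mdifferentiableAt.comp x (h i)
  classical
  have key : ∀ t : Finset ι, MDifferentiableAt 𝓘(ℝ, W) 𝓘(ℝ, E') (fun y => ∑ i ∈ t, c i (f i y)) x := by
    intro t
    induction t using Finset.induction_on with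
    | empty => simpa using mdifferentiableAt_const
    | insert a t ha ih =>
      simp only [Finset.sum_insert ha]
      exact (this a).add ih
  exact key _

lemma mdifferentiableAt_clm_of_apply {E : Type*} [NormedAddCommGroup E] [NormedSpace ℝ E]
    [FiniteDimensional ℝ E] {T : M → E →L[ℝ] F} {x : M}
    (h : ∀ v, MDifferentiableAt 𝓘(ℝ, W) 𝓘(ℝ, F) (fun y => T y v) x) :
    MDifferentiableAt 𝓘(ℝ, W) 𝓘(ℝ, E →L[ℝ] F) T x := by
  let b := Module.finBasis ℝ E
  let c : Fin (Module.finrank ℝ E) → F →L[ℝ] E →L[ℝ] F := fun i =>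
    ContinuousLinearMap.smulRightL ℝ E F (LinearMap.toContinuousLinearMap (b.coord i))
  have h2 : T = fun y => ∑ i, c i (T y (b i)) := by
    funext y
    ext v
    conv_lhs => rw [← b.sum_repr v, map_sum]
    simp only [map_smul, _root_.sum_apply]
    rfl
  rw [h2]
  exact (mdifferentiableAt_sum_clm (fun i => c i) (fun i y => T y (b i)) fun i => h (b i))

/-- The bracket of the Lie algebra, as an operation on the model space. -/
def lieB (X Y : V) : V :=
  (Bracket.bracket (show GroupLieAlgebra 𝓘(ℝ, V) G from X) (show GroupLieAlgebra 𝓘(ℝ, V) G from Y) :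
    GroupLieAlgebra 𝓘(ℝ, V) G)

/-- The bracket of left-invariant fields with varying coefficients. -/
lemma mlieBracket_leftField [CompleteSpace V] [FiniteDimensional ℝ V] {f₁ f₂ : G → V} {g : G}
    (h₁ : ContMDiffAt 𝓘(ℝ, V) 𝓘(ℝ, V) ∞ f₁ g) (h₂ : ContMDiffAt 𝓘(ℝ, V) 𝓘(ℝ, V) ∞ f₂ g) :
    (mlieBracket 𝓘(ℝ, V) (leftField f₁) (leftField f₂) g : V) =
      dsmul V g (1 : G) (lieB (G := G) (f₁ g) (f₂ g)
        + along f₂ g (leftField f₁ g) - along f₁ g (leftField f₂ g)) := by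
  set φ := extChartAt 𝓘(ℝ, V) g with hφ
  have hφs : ContMDiffAt 𝓘(ℝ, V) 𝓘(ℝ, V) ∞ φ g := contMDiffAt_extChartAt
  -- `T` is the left-invariant frame seen in the chart, so a field with coefficient `f` becomes `T
  -- f`. The product rule separates derivatives of `T` from derivatives of `f`; the former are the
  -- same as for constant coefficients, where they add up to the Lie algebra bracket.
  let T : G → V →L[ℝ] V := fun k => (mfderiv 𝓘(ℝ, V) 𝓘(ℝ, V) φ k).comp (dsmul V k (1 : G))
  have hT1 : ∀ k v, T k v = along φ k (leftField (fun _ : G => v) k) := fun _ _ => rfl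
  have hT2 : ∀ (f : G → V) k, along φ k (leftField f k) = T k (f k) := fun _ _ => rfl
  have hL : ∀ v : V, DiffFieldAt (leftField (fun _ : G => v)) g := fun v =>
    (smoothFieldAt_leftField contMDiffAt_const).diff
  have hT : MDifferentiableAt 𝓘(ℝ, V) 𝓘(ℝ, V →L[ℝ] V) T g :=
    mdifferentiableAt_clm_of_apply fun v => mdifferentiableAt_along hφs (hL v)
  have hf1 := h₁.mdifferentiableAt (by simp : (∞ : WithTop ℕ∞) ≠ 0)
  have hf2 := h₂.mdifferentiableAt (by simp : (∞ : WithTop ℕ∞) ≠ 0)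
  have key : ∀ {f : G → V}, MDifferentiableAt 𝓘(ℝ, V) 𝓘(ℝ, V) f g → ∀ v : V,
      along (fun y => along φ y (leftField f y)) g v = (along T g v) (f g) + T g (along f g v) :=
    fun hf v => along_clm_apply hT hf v
  have e1 := along_mlieBracket hφs (smoothFieldAt_leftField h₁).diff (smoothFieldAt_leftField h₂).diff
  have e2 := along_mlieBracket hφs (hL (f₁ g)) (hL (f₂ g))
  have e3 : mlieBracket 𝓘(ℝ, V) (leftField (fun _ : G => f₁ g)) (leftField (fun _ : G => f₂ g)) g =
      leftField (fun _ : G => lieB (G := G) (f₁ g) (f₂ g)) g := by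
    rw [leftField_const, leftField_const, leftField_const]
    exact (congrFun (mulInvariantVector_mlieBracket (I := 𝓘(ℝ, V)) (G := G) (f₁ g) (f₂ g)) g).symm
  have e4 : ∀ v w : V, along (fun y => along φ y (leftField (fun _ : G => v) y)) g w =
      (along T g w) v := by
    intro v w
    have := key (f := fun _ => v) mdifferentiableAt_const w
    rw [this]
    have h0 : along (fun _ : G => v) g w = 0 := by
      simp [along, mvfderiv, mfderiv_const]
      rfl
    rw [h0, map_zero, add_zero]
  rw [e3, hT2] at e2
  have e2' := e2.trans (congrArg₂ (fun a b : V => a - b) (e4 (f₂ g) (leftField (fun _ => f₁ g) g))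
    (e4 (f₁ g) (leftField (fun _ => f₂ g) g)))
  have e1' := e1.trans (congrArg₂ (fun a b : V => a - b) (key hf2 (leftField f₁ g))
    (key hf1 (leftField f₂ g)))
  obtain ⟨e, he⟩ := isInvertible_mfderiv_extChartAt (I := 𝓘(ℝ, V))
    (mem_extChartAt_source (I := 𝓘(ℝ, V)) g)
  apply e.injective
  rw [← ContinuousLinearEquiv.coe_coe, he]
  refine e1'.trans ?_
  have e5 : ∀ v : V, mfderiv 𝓘(ℝ, V) 𝓘(ℝ, V) φ g (dsmul V g (1 : G) v) = T g v := fun _ => rfl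
  rw [e5, map_sub, map_add, e2']
  have e6 : ∀ f : G → V, leftField f g = leftField (fun _ : G => f g) g := fun _ => rfl
  rw [e6 f₁, e6 f₂]
  abel

end LieGroup

/-! ### Right-invariant fields and the derivative of the adjoint representation. -/

section Adjoint
variable {V : Type*} [NormedAddCommGroup V] [NormedSpace ℝ V]
  {W : Type*} [NormedAddCommGroup W] [NormedSpace ℝ W]
  {G : Type*} [Group G] [TopologicalSpace G] [ChartedSpace V G] [LieGroup 𝓘(ℝ, V) ∞ G]
  {M : Type*} [TopologicalSpace M] [ChartedSpace W M]
  {E : Type*} [NormedAddCommGroup E] [NormedSpace ℝ E]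
  {N : Type*} [TopologicalSpace N] [ChartedSpace E N]
  {F : Type*} [NormedAddCommGroup F] [NormedSpace ℝ F]

omit [LieGroup 𝓘(ℝ, V) ∞ G] in
/-- The chain rule with the base point of the outer map given up to equality. -/
lemma mfderiv_comp_flat {C : Type*} [TopologicalSpace C] [ChartedSpace F C]
    {f : N → M} {h : M → C} {x : N} {y : M} (hxy : f x = y)
    (hh : MDifferentiableAt 𝓘(ℝ, W) 𝓘(ℝ, F) h y) (hf : MDifferentiableAt 𝓘(ℝ, E) 𝓘(ℝ, W) f x)
    (v : E) :
    (mfderiv 𝓘(ℝ, E) 𝓘(ℝ, F) (fun n => h (f n)) x v : F) =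
      mfderiv 𝓘(ℝ, W) 𝓘(ℝ, F) h y (mfderiv 𝓘(ℝ, E) 𝓘(ℝ, W) f x v : W) := by
  subst hxy
  exact mfderiv_comp_apply x hh hf v

lemma along_comp_flat {f : N → M} {h : M → F} {x : N} {y : M} (hxy : f x = y)
    (hh : MDifferentiableAt 𝓘(ℝ, W) 𝓘(ℝ, F) h y) (hf : MDifferentiableAt 𝓘(ℝ, E) 𝓘(ℝ, W) f x)
    (v : E) :
    along (fun n => h (f n)) x v = along h y (mfderiv 𝓘(ℝ, E) 𝓘(ℝ, W) f x v : W) := by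
  subst hxy
  exact mfderiv_comp_apply x hh hf v

lemma along_eq_fderiv_vec (h : E → F) (x v : E) : along h x v = fderiv ℝ h x v := by
  have := mfderiv_eq_fderiv (𝕜 := ℝ) (f := h) (x := x)
  exact congrArg (fun L => L v) this

lemma smooth_mul_left (g : G) : ContMDiff 𝓘(ℝ, V) 𝓘(ℝ, V) ∞ (fun x : G => g * x) :=
  contMDiff_mul_left
lemma smooth_mul_right (g : G) : ContMDiff 𝓘(ℝ, V) 𝓘(ℝ, V) ∞ (fun x : G => x * g) :=
  contMDiff_mul_right

/-- The right-invariant field. -/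
def rightField (Y : V) (g : G) : TangentSpace 𝓘(ℝ, V) g :=
  (mfderiv 𝓘(ℝ, V) 𝓘(ℝ, V) (fun x : G => x * g) 1 Y : V)

lemma smoothFieldAt_rightField (Y : V) (g : G) : SmoothFieldAt (rightField (G := G) Y) g := by
  have h : ContMDiff (𝓘(ℝ, V).prod 𝓘(ℝ, V)) 𝓘(ℝ, V) ∞ (fun p : G × G => p.2 * p.1) :=
    contMDiff_snd.mul contMDiff_fst
  have := contMDiffAt_partial_tangent h (γ := fun g : G => g)
    (β := fun _ => (⟨1, Y⟩ : TangentBundle 𝓘(ℝ, V) G)) (n := g) contMDiffAt_id contMDiffAt_const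
  exact this.congr_of_eventuallyEq (Eventually.of_forall fun k =>
    (tangent_mk_congr (one_mul k) _).symm)

variable (V G) in
/-- A smooth parametrization near the identity. -/
def paramOne (u : V) : G := (extChartAt 𝓘(ℝ, V) (1 : G)).symm (extChartAt 𝓘(ℝ, V) (1 : G) 1 + u)

omit [LieGroup 𝓘(ℝ, V) ∞ G] in
lemma paramOne_zero : paramOne V G 0 = 1 := by simp [paramOne]

lemma contMDiffAt_paramOne : ContMDiffAt 𝓘(ℝ, V) 𝓘(ℝ, V) ∞ (paramOne V G) 0 := by
  have h1 : ContMDiffAt 𝓘(ℝ, V) 𝓘(ℝ, V) ∞ (fun u : V => extChartAt 𝓘(ℝ, V) (1 : G) 1 + u) 0 :=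
    contMDiffAt_const.add contMDiffAt_id
  have h2 : ContMDiffAt 𝓘(ℝ, V) 𝓘(ℝ, V) ∞ (extChartAt 𝓘(ℝ, V) (1 : G)).symm
      (extChartAt 𝓘(ℝ, V) (1 : G) 1 + 0) := by
    rw [add_zero]
    exact (contMDiffOn_extChartAt_symm (1 : G)).contMDiffAt (extChartAt_target_mem_nhds (1 : G))
  exact h2.comp (0 : V) h1

lemma mfderiv_paramOne_surj (v : V) : ∃ v' : V,
    (mfderiv 𝓘(ℝ, V) 𝓘(ℝ, V) (paramOne V G) 0 v' : V) = v := by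
  refine ⟨mfderiv 𝓘(ℝ, V) 𝓘(ℝ, V) (extChartAt 𝓘(ℝ, V) (1 : G)) 1 v, ?_⟩
  have h2 : ContMDiffAt 𝓘(ℝ, V) 𝓘(ℝ, V) ∞ (extChartAt 𝓘(ℝ, V) (1 : G)).symm
      (extChartAt 𝓘(ℝ, V) (1 : G) 1) :=
    (contMDiffOn_extChartAt_symm (1 : G)).contMDiffAt (extChartAt_target_mem_nhds (1 : G))
  have h1 : HasMFDerivAt 𝓘(ℝ, V) 𝓘(ℝ, V) (fun u : V => extChartAt 𝓘(ℝ, V) (1 : G) 1 + u) 0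
      (ContinuousLinearMap.id ℝ V) :=
    ((hasFDerivAt_id (0 : V)).const_add _).hasMFDerivAt
  have h3 := mfderiv_comp_flat (y := extChartAt 𝓘(ℝ, V) (1 : G) 1) (x := (0 : V)) (add_zero _)
    (h2.mdifferentiableAt (by simp)) h1.mdifferentiableAt
    (mfderiv 𝓘(ℝ, V) 𝓘(ℝ, V) (extChartAt 𝓘(ℝ, V) (1 : G)) 1 v)
  refine Eq.trans h3 ?_
  rw [h1.mfderiv]
  exact mfderiv_symm_mfderiv (mem_chart_source V (1 : G)) v

/-- Left-invariant and right-invariant fields commute. -/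
lemma mlieBracket_left_right [CompleteSpace V] (X Y : V) (g : G) :
    mlieBracket 𝓘(ℝ, V) (leftField (fun _ : G => X)) (rightField Y) g = 0 := by
  set ψ := extChartAt 𝓘(ℝ, V) g with hψ
  have hψs : ContMDiffAt 𝓘(ℝ, V) 𝓘(ℝ, V) ∞ ψ g := contMDiffAt_extChartAt
  set c := paramOne V G
  have hc0 : c 0 = 1 := paramOne_zero
  have hc : ContMDiffAt 𝓘(ℝ, V) 𝓘(ℝ, V) ∞ c 0 := contMDiffAt_paramOne
  have hcd := hc.mdifferentiableAt (by simp : (∞ : WithTop ℕ∞) ≠ 0)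
  obtain ⟨X', hX'⟩ := mfderiv_paramOne_surj (G := G) X
  obtain ⟨Y', hY'⟩ := mfderiv_paramOne_surj (G := G) Y
  -- Moving the second variable of `c(u) g c(v)` follows left-invariant fields, moving the first
  -- follows right-invariant ones. The two iterated derivatives are therefore mixed second
  -- derivatives of `Φ` at the origin, and their symmetry makes the bracket vanish.
  let Φ : V × V → V := fun p => ψ (c p.1 * g * c p.2)
  have hm : ContMDiffAt 𝓘(ℝ, V × V) 𝓘(ℝ, V) ∞ (fun p : V × V => c p.1 * g * c p.2) (0, 0) := by
    have h1 : ContMDiffAt 𝓘(ℝ, V × V) 𝓘(ℝ, V) ∞ (fun p : V × V => c p.1) (0, 0) :=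
      ContMDiffAt.comp (0, 0) (g := c) (f := Prod.fst) hc (contDiff_fst.contMDiff.contMDiffAt)
    have h2 : ContMDiffAt 𝓘(ℝ, V × V) 𝓘(ℝ, V) ∞ (fun p : V × V => c p.2) (0, 0) :=
      ContMDiffAt.comp (0, 0) (g := c) (f := Prod.snd) hc (contDiff_snd.contMDiff.contMDiffAt)
    exact (h1.mul contMDiffAt_const).mul h2
  have hΦm : ContMDiffAt 𝓘(ℝ, V × V) 𝓘(ℝ, V) ∞ Φ (0, 0) := by
    refine ContMDiffAt.comp (0, 0) (g := ψ) ?_ hm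
    simpa [hc0] using hψs
  have hΦ : ContDiffAt ℝ ∞ Φ (0, 0) := hΦm.contDiffAt
  have hsym : IsSymmSndFDerivAt ℝ Φ (0, 0) := hΦ.isSymmSndFDerivAt (by
    rw [minSmoothness_of_isRCLikeNormedField]; exact two_le_infty)
  have hd2 : DifferentiableAt ℝ (fderiv ℝ Φ) (0, 0) :=
    (hΦ.fderiv_right (m := 1) (by exact two_le_infty)).differentiableAt one_ne_zero
  have hd1 : ∀ᶠ p in 𝓝 ((0 : V), (0 : V)), DifferentiableAt ℝ Φ p := by
    have := (hΦ.of_le one_le_infty).eventually (by simp)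
    filter_upwards [this] with p hp using hp.differentiableAt one_ne_zero
  have hsrc : ∀ᶠ p in 𝓝 ((0 : V), (0 : V)), c p.1 * g * c p.2 ∈ (chartAt V g).source := by
    refine hm.continuousAt ((chartAt V g).open_source.mem_nhds ?_)
    simp [hc0]
  have hu : Tendsto (fun u : V => (u, (0 : V))) (𝓝 0) (𝓝 (0, 0)) :=
    (by fun_prop : Continuous fun u : V => (u, (0 : V))).tendsto 0
  have hv : Tendsto (fun u : V => ((0 : V), u)) (𝓝 0) (𝓝 (0, 0)) :=
    (by fun_prop : Continuous fun u : V => ((0 : V), u)).tendsto 0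
  have hLe : ∀ᶠ u in 𝓝 (0 : V), along ψ (c u * g) (leftField (fun _ : G => X) (c u * g)) =
      fderiv ℝ Φ (u, 0) (0, X') := by
    filter_upwards [hu.eventually hd1, hu.eventually hsrc] with u h1 h2
    have h2' : c u * g ∈ (chartAt V g).source := by simpa [hc0] using h2
    have h3 : fderiv ℝ Φ (u, 0) (0, X') = fderiv ℝ (fun v : V => Φ (u, v)) 0 X' := by
      have := fderiv_comp (𝕜 := ℝ) (f := fun v : V => (u, v)) (g := Φ) (0 : V) h1 (by fun_prop)
      have h4 : fderiv ℝ (fun v : V => (u, v)) 0 = ContinuousLinearMap.inr ℝ V V :=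
        (hasFDerivAt_prodMk_right u 0).fderiv
      have h5 := congrArg (fun L => L X') this
      rw [h4] at h5
      exact h5.symm
    rw [h3, ← along_eq_fderiv_vec]
    refine Eq.symm ((along_comp_flat (f := fun v : V => c u * g * c v) (h := ψ) (x := 0)
      (y := c u * g) (by simp [hc0]) (mdifferentiableAt_extChartAt h2') ?_ X').trans ?_)
    · exact ((smooth_mul_left (c u * g)).mdifferentiableAt (by simp)).comp 0 hcd
    · have := mfderiv_comp_flat (h := fun x : G => c u * g * x) (f := c) (x := 0) hc0
        ((smooth_mul_left (c u * g)).mdifferentiableAt (by simp)) hcd X'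
      rw [hX'] at this
      exact congrArg (along ψ (c u * g)) this
  have hRe : ∀ᶠ u in 𝓝 (0 : V), along ψ (g * c u) (rightField Y (g * c u)) =
      fderiv ℝ Φ (0, u) (Y', 0) := by
    filter_upwards [hv.eventually hd1, hv.eventually hsrc] with u h1 h2
    have h2' : g * c u ∈ (chartAt V g).source := by simpa [hc0] using h2
    have h3 : fderiv ℝ Φ (0, u) (Y', 0) = fderiv ℝ (fun v : V => Φ (v, u)) 0 Y' := by
      have := fderiv_comp (𝕜 := ℝ) (f := fun v : V => (v, u)) (g := Φ) (0 : V) h1 (by fun_prop)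
      have h4 : fderiv ℝ (fun v : V => (v, u)) 0 = ContinuousLinearMap.inl ℝ V V :=
        (hasFDerivAt_prodMk_left 0 u).fderiv
      have h5 := congrArg (fun L => L Y') this
      rw [h4] at h5
      exact h5.symm
    have h6 : (fun v : V => Φ (v, u)) = fun v => ψ (c v * (g * c u)) := by
      funext v; simp [Φ, mul_assoc]
    rw [h3, h6, ← along_eq_fderiv_vec]
    refine Eq.symm ((along_comp_flat (f := fun v : V => c v * (g * c u)) (h := ψ) (x := 0)
      (y := g * c u) (by simp [hc0]) (mdifferentiableAt_extChartAt h2') ?_ Y').trans ?_)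
    · exact ((smooth_mul_right (g * c u)).mdifferentiableAt (by simp)).comp 0 hcd
    · have := mfderiv_comp_flat (h := fun x : G => x * (g * c u)) (f := c) (x := 0) hc0
        ((smooth_mul_right (g * c u)).mdifferentiableAt (by simp)) hcd Y'
      rw [hY'] at this
      exact congrArg (along ψ (g * c u)) this
  have hLs := (smoothFieldAt_leftField (G := G) (g := g) (contMDiffAt_const (c := X))).diff
  have hRs := (smoothFieldAt_rightField (G := G) Y g).diff
  have hA : along (fun y => along ψ y (leftField (fun _ : G => X) y)) g (rightField Y g) =
      fderiv ℝ (fderiv ℝ Φ) (0, 0) (Y', 0) (0, X') := by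
    have h1 := along_comp_flat (f := fun u : V => c u * g) (x := 0) (y := g) (by simp [hc0])
      (mdifferentiableAt_along hψs hLs)
      (((smooth_mul_right g).mdifferentiableAt (by simp)).comp 0 hcd) Y'
    have h2 := mfderiv_comp_flat (h := fun x : G => x * g) (f := c) (x := 0) hc0
        ((smooth_mul_right g).mdifferentiableAt (by simp)) hcd Y'
    rw [hY'] at h2
    refine (congrArg (along _ g) h2).symm.trans (h1.symm.trans ?_)
    refine (along_congr hLe Y').trans ?_
    rw [along_eq_fderiv_vec]
    have h3 := (HasFDerivAt.comp (0 : V) (f := fun u : V => (u, (0 : V))) hd2.hasFDerivAt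
      (hasFDerivAt_prodMk_left (𝕜 := ℝ) (0 : V) (0 : V))).clm_apply
      (hasFDerivAt_const ((0 : V), X') (0 : V))
    refine (congrArg (fun L => L Y') h3.fderiv).trans ?_
    simp
  have hB : along (fun y => along ψ y (rightField Y y)) g (leftField (fun _ : G => X) g) =
      fderiv ℝ (fderiv ℝ Φ) (0, 0) (0, X') (Y', 0) := by
    have h1 := along_comp_flat (f := fun u : V => g * c u) (x := 0) (y := g) (by simp [hc0])
      (mdifferentiableAt_along hψs hRs)
      (((smooth_mul_left g).mdifferentiableAt (by simp)).comp 0 hcd) X'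
    have h2 := mfderiv_comp_flat (h := fun x : G => g * x) (f := c) (x := 0) hc0
        ((smooth_mul_left g).mdifferentiableAt (by simp)) hcd X'
    rw [hX'] at h2
    refine (congrArg (along _ g) h2).symm.trans (h1.symm.trans ?_)
    refine (along_congr hRe X').trans ?_
    rw [along_eq_fderiv_vec]
    have h3 := (HasFDerivAt.comp (0 : V) (f := fun u : V => ((0 : V), u)) hd2.hasFDerivAt
      (hasFDerivAt_prodMk_right (𝕜 := ℝ) (0 : V) (0 : V))).clm_apply
      (hasFDerivAt_const (Y', (0 : V)) (0 : V))
    refine (congrArg (fun L => L X') h3.fderiv).trans ?_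
    simp
  have h1 := along_mlieBracket hψs hLs hRs
  have h2 := h1.trans (congrArg₂ (fun a b : V => a - b) hB hA)
  rw [hsym.eq, sub_self] at h2
  obtain ⟨e, he⟩ := isInvertible_mfderiv_extChartAt (I := 𝓘(ℝ, V))
    (mem_extChartAt_source (I := 𝓘(ℝ, V)) g)
  apply e.injective
  rw [← ContinuousLinearEquiv.coe_coe, he, map_zero]
  exact h2

/-- `Ad(g⁻¹)`. -/
def adInv (g : G) : V →L[ℝ] V := mfderiv 𝓘(ℝ, V) 𝓘(ℝ, V) (fun x : G => g⁻¹ * (x * g)) 1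

lemma adInv_eq (g : G) (v : V) : adInv g v = dsmul V g⁻¹ g (rightField v g) :=
  mfderiv_comp_flat (h := fun x : G => g⁻¹ * x) (f := fun x : G => x * g) (one_mul g)
    ((smooth_mul_left _).mdifferentiableAt (by simp)) ((smooth_mul_right _).mdifferentiableAt (by simp)) v

lemma adInv_eq_hat (v : V) : (fun g : G => adInv g v) = hat (fun g : G => g) (rightField v) :=
  funext fun g => adInv_eq g v

lemma contMDiffAt_adInv (v : V) (g : G) :
    ContMDiffAt 𝓘(ℝ, V) 𝓘(ℝ, V) ∞ (fun g : G => adInv g v) g := by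
  rw [adInv_eq_hat]
  exact contMDiffAt_hat (smoothAction_self V G) contMDiff_id (fun _ _ => rfl)
    (smoothFieldAt_rightField v g)

/-- Seen in the left-invariant frame, the right-invariant field of `v` has coefficient `Ad(g⁻¹) v`;
this turns the vanishing bracket of left and right fields into a differential equation for `Ad`. -/
lemma leftField_adInv (v : V) : leftField (fun g : G => adInv g v) = rightField v := by
  funext g
  have := dsmul_dsmul_inv (smoothAction_self V G) g (1 : G) (rightField v g)
  rw [smul_eq_mul, mul_one] at this
  exact (congrArg (dsmul V g (1 : G)) (adInv_eq g v)).trans this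

lemma adInv_one (v : V) : adInv (1 : G) v = v := by
  have h1 : (fun x : G => (1 : G)⁻¹ * (x * 1)) = id := by ext y; simp
  rw [adInv, h1, mfderiv_id]
  rfl

lemma adInv_mul (g k : G) (v : V) : adInv (g * k) v = adInv k (adInv g v) := by
  have h1 : (fun x : G => (g * k)⁻¹ * (x * (g * k))) = fun x => k⁻¹ * (g⁻¹ * (x * g) * k) := by
    ext y; simp [mul_assoc]
  rw [adInv, h1]
  have hs : ∀ g : G, MDifferentiableAt 𝓘(ℝ, V) 𝓘(ℝ, V) (fun x : G => g⁻¹ * (x * g)) 1 := fun g =>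
    ((smooth_mul_left _).comp (smooth_mul_right _)).mdifferentiableAt (by simp)
  exact mfderiv_comp_flat (h := fun x : G => k⁻¹ * (x * k)) (f := fun x : G => g⁻¹ * (x * g))
    (by simp) (hs k) (hs g) v

/-- The derivative of `Ad(g⁻¹) v` along a left-invariant direction. -/
lemma along_adInv [FiniteDimensional ℝ V] [CompleteSpace V] (X v : V) (g : G) :
    along (fun g : G => adInv g v) g (leftField (fun _ : G => X) g) =
      - lieB (G := G) X (adInv g v) := by
  -- The bracket vanishes, while the coefficient formula gives `[X, Ad(g⁻¹) v]` plus the required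
  -- derivative; `dl_{g⁻¹}` strips off the frame.
  have h1 := mlieBracket_leftField (contMDiffAt_const (c := X) (x := g)) (contMDiffAt_adInv v g)
  rw [leftField_adInv, mlieBracket_left_right] at h1
  have h0 : ∀ w : V, along (fun _ : G => X) g w = 0 := by
    intro w
    simp [along, mvfderiv, mfderiv_const]
    rfl
  have h2 := congrArg (dsmul V g⁻¹ (g * 1)) h1
  have h3 := dsmul_inv_dsmul (smoothAction_self V G) g (1 : G) (lieB (G := G) X (adInv g v)
        + along (fun g : G => adInv g v) g (leftField (fun _ : G => X) g)
        - along (fun _ : G => X) g (rightField v g))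
  have h4 := (h2.trans h3).trans (congrArg (fun w : V => lieB (G := G) X (adInv g v)
        + along (fun g : G => adInv g v) g (leftField (fun _ : G => X) g) - w) (h0 (rightField v g)))
  simp only [sub_zero] at h4
  have h5 : (0 : V) = lieB (G := G) X (adInv g v)
        + along (fun g : G => adInv g v) g (leftField (fun _ : G => X) g) :=
    (map_zero (dsmul V g⁻¹ (g * 1))).symm.trans h4
  exact (neg_eq_of_add_eq_zero_right h5.symm).symm

end Adjoint

/-! ### Smooth homogeneous spaces and the Lie algebra of the stabilizer. -/

section Homogeneous
variable {V : Type*} [NormedAddCommGroup V] [NormedSpace ℝ V]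
  {W : Type*} [NormedAddCommGroup W] [NormedSpace ℝ W]
  {G : Type*} [Group G] [TopologicalSpace G] [ChartedSpace V G] [LieGroup 𝓘(ℝ, V) ∞ G]
  {M : Type*} [TopologicalSpace M] [ChartedSpace W M] [IsManifold 𝓘(ℝ, W) ∞ M] [MulAction G M]

variable (V W) in
/-- `π : G → M` exhibits `M` as a smooth homogeneous space of `G`. -/
structure HomogProj (π : G → M) : Prop where
  act : SmoothAction V W G M
  smooth : ContMDiff 𝓘(ℝ, V) 𝓘(ℝ, W) ∞ π
  equivariant : ∀ g k, π (g * k) = g • π k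
  surjective : Function.Surjective π
  exists_section : ∀ g, ∃ σ : M → G, ContMDiffAt 𝓘(ℝ, W) 𝓘(ℝ, V) ∞ σ (π g) ∧ σ (π g) = g ∧
    ∀ᶠ y in 𝓝 (π g), ContMDiffAt 𝓘(ℝ, W) 𝓘(ℝ, V) ∞ σ y ∧ π (σ y) = y
  exists_path : ∀ᶠ k in 𝓝 (1 : G), π k = π 1 → ∃ c : ℝ → G, c 0 = 1 ∧ c 1 = k ∧
    ContMDiff 𝓘(ℝ, ℝ) 𝓘(ℝ, V) ∞ c ∧ ∀ t, π (c t) = π 1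

variable (V W) in
/-- The differential at the identity of the projection. -/
def dproj (π : G → M) : V →L[ℝ] W := mfderiv 𝓘(ℝ, V) 𝓘(ℝ, W) π 1

lemma mfderiv_const_flat {E : Type*} [NormedAddCommGroup E] [NormedSpace ℝ E]
    {N : Type*} [TopologicalSpace N] [ChartedSpace E N] {f : N → M} {x : N} {c : M}
    (h : ∀ᶠ y in 𝓝 x, f y = c) (v : E) : (mfderiv 𝓘(ℝ, E) 𝓘(ℝ, W) f x v : W) = 0 := by
  have h1 : f =ᶠ[𝓝 x] fun _ => c := h
  have h2 := h1.mfderiv_eq (I := 𝓘(ℝ, E)) (I' := 𝓘(ℝ, W))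
  have h3 := mfderiv_const (I := 𝓘(ℝ, E)) (I' := 𝓘(ℝ, W)) (c := c) (x := x)
  exact (congrArg (fun L : E →L[ℝ] W => L v) h2).trans (congrArg (fun L : E →L[ℝ] W => L v) h3)

namespace HomogProj
variable {π : G → M} (hp : HomogProj V W π)
include hp

/-- The differential of a local section through the identity is a right inverse. -/
lemma dproj_surjective : Function.Surjective (dproj V W π) := by
  intro w
  obtain ⟨σ, h1, h2, h3⟩ := hp.exists_section 1
  refine ⟨(mfderiv 𝓘(ℝ, W) 𝓘(ℝ, V) σ (π 1) w : V), ?_⟩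
  have h4 : mfderiv 𝓘(ℝ, W) 𝓘(ℝ, W) (fun y => π (σ y)) (π 1) = ContinuousLinearMap.id ℝ W := by
    have h5 : (fun y => π (σ y)) =ᶠ[𝓝 (π 1)] id := h3.mono fun _ h => h.2
    exact h5.mfderiv_eq.trans mfderiv_id
  have h5 := mfderiv_comp_flat (f := σ) (h := π) h2 (hp.smooth.mdifferentiableAt (by simp))
    (h1.mdifferentiableAt (by simp)) w
  exact h5.symm.trans (congrArg (fun L : W →L[ℝ] W => L w) h4)

lemma mfderiv_dsmul_one (g : G) (v : V) :
    (mfderiv 𝓘(ℝ, V) 𝓘(ℝ, W) π g (dsmul V g (1 : G) v : V) : W) =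
      dsmul W g (π 1) (dproj V W π v) :=
  mfderiv_leftField hp.act hp.smooth hp.equivariant (fun _ => v) g

/-- `π ∘ γ` has derivative `dl_{γ(t)} (dπ X)` if `γ' = dl_γ X`. -/
lemma eq_const_of_integralCurve [CompleteSpace V] {X : V} (hX : dproj V W π X = 0) {γ : ℝ → G}
    (hγ : IsMIntegralCurve (I := 𝓘(ℝ, V)) γ (mulInvariantVectorField (I := 𝓘(ℝ, V)) (G := G) X)) (t : ℝ) :
    π (γ t) = π (γ 0) := by
  -- The derivative of the projected curve is zero at every time. In a chart this gives constancy on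
  -- a ball, and connectedness of the line makes it global.
  have hloc : IsLocallyConstant fun t => π (γ t) := by
    rw [IsLocallyConstant.iff_eventually_eq]
    intro t
    have hder : ∀ s, HasMFDerivAt 𝓘(ℝ, ℝ) 𝓘(ℝ, W) (fun t => π (γ t)) s (0 : ℝ →L[ℝ] W) := by
      intro s
      have h1 := HasMFDerivAt.comp s
        (hp.smooth.mdifferentiableAt (x := γ s) (by simp)).hasMFDerivAt (hγ s)
      refine h1.congr_mfderiv ?_
      refine ContinuousLinearMap.ext_ring ?_
      refine (congrArg (mfderiv 𝓘(ℝ, V) 𝓘(ℝ, W) π (γ s)) (one_smul ℝ _)).trans ?_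
      refine (hp.mfderiv_dsmul_one (γ s) X).trans ?_
      rw [hX]
      exact map_zero _
    set ψ := extChartAt 𝓘(ℝ, W) (π (γ t)) with hψ
    have hc : ContinuousAt (fun t => π (γ t)) t := (hder t).1
    have hsrc : ∀ᶠ s in 𝓝 t, π (γ s) ∈ (chartAt W (π (γ t))).source :=
      hc (chart_source_mem_nhds W _)
    obtain ⟨r, hr, hball⟩ := Metric.eventually_nhds_iff_ball.1 hsrc
    have hz : ∀ s ∈ Metric.ball t r, HasDerivAt (fun s => ψ (π (γ s))) 0 s := by
      intro s hs
      have h1 := HasMFDerivAt.comp s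
        (mdifferentiableAt_extChartAt (I := 𝓘(ℝ, W)) (hball s hs)).hasMFDerivAt (hder s)
      have h2 : HasMFDerivAt 𝓘(ℝ, ℝ) 𝓘(ℝ, W) (fun s => ψ (π (γ s))) s (0 : ℝ →L[ℝ] W) := by
        refine h1.congr_mfderiv ?_
        exact ContinuousLinearMap.ext fun v =>
          map_zero (mfderiv 𝓘(ℝ, W) 𝓘(ℝ, W) ψ (π (γ s)))
      have h3 : HasFDerivAt (fun s => ψ (π (γ s))) (0 : ℝ →L[ℝ] W) s := h2.hasFDerivAt
      simpa using h3.hasDerivAt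
    have hconst : ∀ s ∈ Metric.ball t r, ψ (π (γ s)) = ψ (π (γ t)) := by
      intro s hs
      refine (convex_ball t r).is_const_of_fderivWithin_eq_zero (𝕜 := ℝ)
        (fun u hu => (hz u hu).differentiableAt.differentiableWithinAt) ?_ hs
        (Metric.mem_ball_self hr)
      intro u hu
      rw [fderivWithin_of_isOpen Metric.isOpen_ball hu]
      exact ContinuousLinearMap.ext_ring (by simpa using (hz u hu).deriv)
    filter_upwards [Metric.ball_mem_nhds t hr] with s hs
    refine ψ.injOn ?_ ?_ (hconst s hs)
    · simpa [hψ] using hball s hs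
    · simp [hψ]
  exact hloc.apply_eq_of_isPreconnected isPreconnected_univ (mem_univ _) (mem_univ _)

end HomogProj

/-- Left translates of one local integral curve through the identity give integral curves through
every point, all defined for the same length of time. Such a uniform bound forces a curve defined
for all time. -/
lemma exists_integralCurve [CompleteSpace V] (X : V) :
    ∃ γ : ℝ → G, γ 0 = 1 ∧
      IsMIntegralCurve (I := 𝓘(ℝ, V)) γ (mulInvariantVectorField (I := 𝓘(ℝ, V)) (G := G) X) := by
  -- A T1 topological group is Hausdorff, which gluing integral curves requires.
  have : IsTopologicalGroup G := topologicalGroup_of_lieGroup 𝓘(ℝ, V) ∞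
  have : T1Space G := ChartedSpace.t1Space V G
  have : IsManifold 𝓘(ℝ, V) 1 G := IsManifold.of_le (n := ∞) one_le_infty
  let v : ∀ g : G, TangentSpace 𝓘(ℝ, V) g := mulInvariantVectorField (I := 𝓘(ℝ, V)) (G := G) X
  have hv : ContMDiff 𝓘(ℝ, V) 𝓘(ℝ, V).tangent 1 (fun x ↦ (⟨x, v x⟩ : TangentBundle 𝓘(ℝ, V) G)) :=
    fun g => ContMDiffAt.of_le
      (smoothFieldAt_leftField (G := G) (g := g) (contMDiffAt_const (c := X))) one_le_infty
  obtain ⟨γ, h1, h2⟩ := exists_isMIntegralCurveAt_of_contMDiffAt_boundaryless (t₀ := 0)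
    (hv.contMDiffAt (x := (1 : G)))
  obtain ⟨ε, hε, h3⟩ := isMIntegralCurveAt_iff'.1 h2
  refine exists_isMIntegralCurve_of_isMIntegralCurveOn hv hε (fun g => ⟨fun t => g * γ t, by simp [h1], ?_⟩) 1
  rw [Real.ball_eq_Ioo, zero_sub, zero_add] at h3
  intro t ht
  have h4 := ((smooth_mul_left g).mdifferentiableAt (x := γ t) (by simp)).hasMFDerivAt.comp_hasMFDerivWithinAt t
    (h3 t ht)
  refine h4.congr_mfderiv ?_
  refine ContinuousLinearMap.ext_ring ?_
  refine (congrArg (mfderiv 𝓘(ℝ, V) 𝓘(ℝ, V) (fun x => g * x) (γ t)) (one_smul ℝ _)).trans ?_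
  refine Eq.trans ?_ (one_smul ℝ _).symm
  have h5 := dsmul_mul (smoothAction_self V G) g (γ t) 1 X
  rw [smul_eq_mul, mul_one] at h5
  exact h5.symm

/-- The Lie algebra of the stabilizer is the kernel of the differential of the projection. -/
lemma HomogProj.mem_subgroupLieAlgebra_iff [CompleteSpace V] {π : G → M} (hp : HomogProj V W π)
    {K : Subgroup G} (hK : ∀ k, k ∈ K ↔ π k = π 1) (X : V) :
    (show GroupLieAlgebra 𝓘(ℝ, V) G from X) ∈ subgroupLieAlgebra V K ↔ dproj V W π X = 0 := by
  constructor
  · rintro ⟨γ, h0, h1, h2⟩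
    have h3 : ∀ᶠ t in 𝓝 (0 : ℝ), π (γ t) = π 1 := Eventually.of_forall fun t => (hK _).1 (h2 t)
    have h4 := mfderiv_const_flat (W := W) h3 (1 : ℝ)
    have h5 := HasMFDerivAt.comp 0 (hp.smooth.mdifferentiableAt (x := γ 0) (by simp)).hasMFDerivAt (h1 0)
    have h6 : (mfderiv 𝓘(ℝ, V) 𝓘(ℝ, W) π (γ 0) (dsmul V (γ 0) (1 : G) X : V) : W) = 0 := by
      refine Eq.trans ?_ h4
      refine Eq.trans ?_ (congrArg (fun L : ℝ →L[ℝ] W => L 1) h5.mfderiv).symm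
      exact (congrArg (mfderiv 𝓘(ℝ, V) 𝓘(ℝ, W) π (γ 0)) (one_smul ℝ _)).symm
    rw [hp.mfderiv_dsmul_one, h0, dsmul_one] at h6
    exact h6
  · intro hX
    obtain ⟨γ, h0, h1⟩ := exists_integralCurve (G := G) X
    refine ⟨γ, h0, h1, fun t => (hK _).2 ?_⟩
    rw [hp.eq_const_of_integralCurve hX h1 t, h0]

end Homogeneous

/-! ### Local sections and paths in the fibres of a submersion. -/

section Submersion
variable {V : Type*} [NormedAddCommGroup V] [NormedSpace ℝ V]
  {W : Type*} [NormedAddCommGroup W] [NormedSpace ℝ W]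
  {A : Type*} [TopologicalSpace A] [ChartedSpace V A] [IsManifold 𝓘(ℝ, V) ∞ A]
  {B : Type*} [TopologicalSpace B] [ChartedSpace W B] [IsManifold 𝓘(ℝ, W) ∞ B]

/-- A submersion has local sections through every point. -/
lemma exists_section_of_isSubmersion {f : A → B}
    (hf : Manifold.IsSubmersion 𝓘(ℝ, V) 𝓘(ℝ, W) ∞ f) (a : A) :
    ∃ σ : B → A, ContMDiffAt 𝓘(ℝ, W) 𝓘(ℝ, V) ∞ σ (f a) ∧ σ (f a) = a ∧
      ∀ᶠ y in 𝓝 (f a), ContMDiffAt 𝓘(ℝ, W) 𝓘(ℝ, V) ∞ σ y ∧ f (σ y) = y := by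
  obtain ⟨F, _, _, hF⟩ := hf
  have h := hF a
  set φ := h.domChart.extend 𝓘(ℝ, V) with hφ
  set ψ := h.codChart.extend 𝓘(ℝ, W) with hψ
  have hψs : ψ.source = h.codChart.source := by simp [hψ]
  have hs : ∀ y ∈ ψ.source, ContMDiffAt 𝓘(ℝ, W) 𝓘(ℝ, W) ∞ ψ y := fun y hy =>
    (h.codChart.contMDiffOn_extend h.codChart_mem_maximalAtlas).contMDiffAt
      (h.codChart.open_source.mem_nhds (hψs ▸ hy))
  have has : a ∈ φ.source := by simpa [hφ] using h.mem_domChart_source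
  have hfas : f a ∈ ψ.source := by simpa [hψ] using h.mem_codChart_source
  have hopen : IsOpen φ.target := by
    simpa [hφ, OpenPartialHomeomorph.extend] using h.domChart.open_target
  have hφa : φ a ∈ φ.target := φ.map_source has
  have hw : ∀ z ∈ φ.target, ψ (f (φ.symm z)) = (h.equiv z).1 := fun z hz => h.writtenInCharts hz
  have hmap : ∀ z ∈ φ.target, f (φ.symm z) ∈ ψ.source := by
    intro z hz
    have h1 : φ.symm z ∈ φ.source := φ.map_target hz
    have h2 : φ.symm z ∈ h.domChart.source := by simpa [hφ] using h1
    simpa [hψ] using h.mapsto_domChart_source_codChart_source h2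
  have hu0 : ψ (f a) = (h.equiv (φ a)).1 := by
    have := hw _ hφa
    rwa [φ.left_inv has] at this
  -- In adapted charts `f` is the first projection; the section varies the first coordinate and
  -- freezes the second at its value at `a`.
  let τ : B → V := fun y => h.equiv.symm (ψ y, (h.equiv (φ a)).2)
  have hτa : τ (f a) = φ a := by
    simp only [τ]
    rw [hu0]
    exact h.equiv.symm_apply_apply _
  have hτ : ∀ y ∈ ψ.source, ContMDiffAt 𝓘(ℝ, W) 𝓘(ℝ, V) ∞ τ y := by
    intro y hy
    have h1 : ContMDiffAt 𝓘(ℝ, W) 𝓘(ℝ, W × F) ∞ (fun y => (ψ y, (h.equiv (φ a)).2)) y :=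
      (hs y hy).prodMk_space contMDiffAt_const
    exact h.equiv.symm.contDiff.contMDiff.contMDiffAt.comp y h1
  have hsym : ∀ z ∈ φ.target, ContMDiffAt 𝓘(ℝ, V) 𝓘(ℝ, V) ∞ φ.symm z := by
    intro z hz
    have h1 := contMDiffOn_extend_symm (I := 𝓘(ℝ, V)) h.domChart_mem_maximalAtlas
    refine h1.contMDiffAt ?_
    have h2 : 𝓘(ℝ, V) '' h.domChart.target = φ.target := by
      simp [hφ, OpenPartialHomeomorph.extend]
    rw [h2]
    exact hopen.mem_nhds hz
  refine ⟨fun y => φ.symm (τ y), ?_, ?_, ?_⟩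
  · refine ContMDiffAt.comp (f a) (hsym _ ?_) (hτ _ hfas)
    rwa [hτa]
  · simp only [hτa]
    exact φ.left_inv has
  · have h1 : ∀ᶠ y in 𝓝 (f a), τ y ∈ φ.target := by
      refine (hτ _ hfas).continuousAt (hopen.mem_nhds ?_)
      rwa [hτa]
    have h2 : ∀ᶠ y in 𝓝 (f a), y ∈ ψ.source := by
      rw [hψs]
      exact h.codChart.open_source.mem_nhds h.mem_codChart_source
    filter_upwards [h1, h2] with y hy1 hy2
    refine ⟨ContMDiffAt.comp y (hsym _ hy1) (hτ _ hy2), ?_⟩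
    refine ψ.injOn (hmap _ hy1) hy2 ?_
    rw [hw _ hy1]
    simp [τ]

/-- Points of a fibre of a submersion that are close to each other are joined by a path in the
fibre. -/
lemma exists_path_of_isSubmersion {f : A → B}
    (hf : Manifold.IsSubmersion 𝓘(ℝ, V) 𝓘(ℝ, W) ∞ f) (a : A) :
    ∀ᶠ k in 𝓝 a, f k = f a → ∃ c : ℝ → A, c 0 = a ∧ c 1 = k ∧
      ContMDiff 𝓘(ℝ, ℝ) 𝓘(ℝ, V) ∞ c ∧ ∀ t, f (c t) = f a := by
  obtain ⟨F, _, _, hF⟩ := hf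
  have h := hF a
  set φ := h.domChart.extend 𝓘(ℝ, V) with hφ
  set ψ := h.codChart.extend 𝓘(ℝ, W) with hψ
  have has : a ∈ φ.source := by simpa [hφ] using h.mem_domChart_source
  have hfas : f a ∈ ψ.source := by simpa [hψ] using h.mem_codChart_source
  have hopen : IsOpen φ.target := by
    simpa [hφ, OpenPartialHomeomorph.extend] using h.domChart.open_target
  have hφa : φ a ∈ φ.target := φ.map_source has
  have hw : ∀ z ∈ φ.target, ψ (f (φ.symm z)) = (h.equiv z).1 := fun z hz => h.writtenInCharts hz
  have hmap : ∀ z ∈ φ.target, f (φ.symm z) ∈ ψ.source := by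
    intro z hz
    have h1 : φ.symm z ∈ φ.source := φ.map_target hz
    have h2 : φ.symm z ∈ h.domChart.source := by simpa [hφ] using h1
    simpa [hψ] using h.mapsto_domChart_source_codChart_source h2
  have hw' : ∀ k ∈ φ.source, ψ (f k) = (h.equiv (φ k)).1 := by
    intro k hk
    have := hw _ (φ.map_source hk)
    rwa [φ.left_inv hk] at this
  have hsym : ContMDiffOn 𝓘(ℝ, V) 𝓘(ℝ, V) ∞ φ.symm φ.target := by
    have h1 := contMDiffOn_extend_symm (I := 𝓘(ℝ, V)) h.domChart_mem_maximalAtlas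
    have h2 : 𝓘(ℝ, V) '' h.domChart.target = φ.target := by
      simp [hφ, OpenPartialHomeomorph.extend]
    rwa [h2] at h1
  obtain ⟨r, hr, hball⟩ := Metric.isOpen_iff.1 hopen _ hφa
  have hsrc : ∀ᶠ k in 𝓝 a, k ∈ φ.source := by
    have h3 : φ.source = h.domChart.source := by simp [hφ]
    rw [h3]
    exact h.domChart.open_source.mem_nhds h.mem_domChart_source
  have hcont : ContinuousAt φ a := h.domChart.continuousAt_extend h.mem_domChart_source
  filter_upwards [hsrc, hcont (Metric.ball_mem_nhds _ hr)] with k hk1 hk2 hk3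
  -- The segment joining the two points in the adapted chart. The smooth transition function has
  -- values in `[0, 1]`, so the path is defined on the whole line without leaving the ball; the
  -- endpoints share their first coordinate, so all of it lies in the fibre.
  let ℓ : ℝ → V := fun t => φ a + Real.smoothTransition t • (φ k - φ a)
  have hℓ : ContDiff ℝ ∞ ℓ := contDiff_const.add (Real.smoothTransition.contDiff.smul contDiff_const)
  have hℓb : ∀ t, ℓ t ∈ φ.target := fun t => hball <|
    (convex_ball (φ a) r).add_smul_sub_mem (Metric.mem_ball_self hr) hk2
      ⟨Real.smoothTransition.nonneg t, Real.smoothTransition.le_one t⟩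
  refine ⟨fun t => φ.symm (ℓ t), ?_, ?_, ?_, ?_⟩
  · simp [ℓ, φ.left_inv has]
  · simp [ℓ, φ.left_inv hk1]
  · exact fun t => ContMDiffAt.comp t (hsym.contMDiffAt (hopen.mem_nhds (hℓb t)))
      hℓ.contMDiff.contMDiffAt
  · intro t
    refine ψ.injOn (hmap _ (hℓb t)) hfas ?_
    rw [hw _ (hℓb t), hw' a has]
    have h4 := hw' k hk1
    rw [hk3, hw' a has] at h4
    simp [ℓ, ← h4]

end Submersion

/-! ### The quotient as a homogeneous space. -/

section Quotient
variable {V : Type*} [NormedAddCommGroup V] [NormedSpace ℝ V]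
  {W : Type*} [NormedAddCommGroup W] [NormedSpace ℝ W]
  {G : Type*} [Group G] [TopologicalSpace G] [ChartedSpace V G] [LieGroup 𝓘(ℝ, V) ∞ G]

/-- The action is smooth because, with `σ` a local section, it is locally the projection of the
product `g * σ x` computed in `G`. -/
lemma homogProj_mk (K : Subgroup G) [ChartedSpace W (G ⧸ K)] [IsManifold 𝓘(ℝ, W) ∞ (G ⧸ K)]
    (hπ : Manifold.IsSubmersion 𝓘(ℝ, V) 𝓘(ℝ, W) ∞ (QuotientGroup.mk : G → G ⧸ K)) :
    HomogProj V W (QuotientGroup.mk : G → G ⧸ K) := by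
  have hs : ContMDiff 𝓘(ℝ, V) 𝓘(ℝ, W) ∞ (QuotientGroup.mk : G → G ⧸ K) := hπ.contMDiff
  refine ⟨?_, hs, fun _ _ => rfl, QuotientGroup.mk_surjective,
    exists_section_of_isSubmersion hπ, exists_path_of_isSubmersion hπ 1⟩
  rintro ⟨g, x⟩
  obtain ⟨k, rfl⟩ := QuotientGroup.mk_surjective x
  obtain ⟨σ, h1, h2, h3⟩ := exists_section_of_isSubmersion hπ k
  have h4 : ContMDiffAt (𝓘(ℝ, V).prod 𝓘(ℝ, W)) 𝓘(ℝ, V) ∞ (fun p : G × (G ⧸ K) => p.1 * σ p.2)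
      (g, (k : G ⧸ K)) :=
    contMDiffAt_fst.mul (ContMDiffAt.comp (g, (k : G ⧸ K)) (g := σ) h1 contMDiffAt_snd)
  refine (hs.contMDiffAt.comp (g, (k : G ⧸ K)) h4).congr_of_eventuallyEq ?_
  have h5 : Tendsto (fun p : G × (G ⧸ K) => p.2) (𝓝 (g, (k : G ⧸ K))) (𝓝 (k : G ⧸ K)) :=
    continuous_snd.tendsto _
  filter_upwards [h5.eventually h3] with p hp
  exact (congrArg (fun x => p.1 • x) hp.2).symm

end Quotient

/-! ### Real and imaginary parts in a complexification. -/

section Complexification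
variable {U U' : Type*} [AddCommGroup U] [Module ℝ U] [AddCommGroup U'] [Module ℝ U']

/-- The element `a + i b` of the complexification. -/
def cpx (a b : U) : ℂ ⊗[ℝ] U := (1 : ℂ) ⊗ₜ[ℝ] a + Complex.I ⊗ₜ[ℝ] b

lemma exists_cpx (z : ℂ ⊗[ℝ] U) : ∃ a b : U, z = cpx a b := by
  induction z using TensorProduct.induction_on with
  | zero => exact ⟨0, 0, by simp [cpx]⟩
  | tmul c u =>
    refine ⟨c.re • u, c.im • u, ?_⟩
    rw [cpx, TensorProduct.tmul_smul, TensorProduct.tmul_smul, TensorProduct.smul_tmul',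
      TensorProduct.smul_tmul', ← TensorProduct.add_tmul]
    congr 1
    apply Complex.ext <;> simp
  | add x y hx hy =>
    obtain ⟨a, b, rfl⟩ := hx
    obtain ⟨c, d, rfl⟩ := hy
    refine ⟨a + c, b + d, ?_⟩
    simp only [cpx, TensorProduct.tmul_add]
    abel

/-- Real and imaginary parts. -/
def rePart : ℂ ⊗[ℝ] U →ₗ[ℝ] U :=
  TensorProduct.lid ℝ U ∘ₗ TensorProduct.map Complex.reLm LinearMap.id

def imPart : ℂ ⊗[ℝ] U →ₗ[ℝ] U :=
  TensorProduct.lid ℝ U ∘ₗ TensorProduct.map Complex.imLm LinearMap.id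

lemma rePart_cpx (a b : U) : rePart (cpx a b) = a := by simp [rePart, cpx]
lemma imPart_cpx (a b : U) : imPart (cpx a b) = b := by simp [imPart, cpx]

lemma cpx_inj {a b c d : U} : cpx a b = cpx c d ↔ a = c ∧ b = d := by
  refine ⟨fun h => ⟨?_, ?_⟩, fun h => by rw [h.1, h.2]⟩
  · rw [← rePart_cpx a b, h, rePart_cpx]
  · rw [← imPart_cpx a b, h, imPart_cpx]

lemma cpx_add (a b c d : U) : cpx a b + cpx c d = cpx (a + c) (b + d) := by
  simp only [cpx, TensorProduct.tmul_add]; abel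

lemma cpx_sub (a b c d : U) : cpx a b - cpx c d = cpx (a - c) (b - d) := by
  simp only [cpx, TensorProduct.tmul_sub]; abel

lemma cpx_neg (a b : U) : - cpx a b = cpx (-a) (-b) := by
  simp only [cpx, TensorProduct.tmul_neg]; abel

lemma cpx_zero_zero : cpx (0 : U) 0 = 0 := by simp [cpx]

lemma one_tmul_eq_cpx (a : U) : (1 : ℂ) ⊗ₜ[ℝ] a = cpx a 0 := by simp [cpx]

lemma smul_cpx (c : ℂ) (a b : U) :
    c • cpx a b = cpx (c.re • a - c.im • b) (c.re • b + c.im • a) := by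
  simp only [cpx, smul_add, TensorProduct.smul_tmul', smul_eq_mul, mul_one, TensorProduct.tmul_add,
    TensorProduct.tmul_sub, TensorProduct.tmul_smul]
  have h1 : c ⊗ₜ[ℝ] a = c.re • ((1 : ℂ) ⊗ₜ[ℝ] a) + c.im • (Complex.I ⊗ₜ[ℝ] a) := by
    rw [TensorProduct.smul_tmul', TensorProduct.smul_tmul', ← TensorProduct.add_tmul]
    congr 1; apply Complex.ext <;> simp
  have h2 : (c * Complex.I) ⊗ₜ[ℝ] b = c.re • (Complex.I ⊗ₜ[ℝ] b) - c.im • ((1 : ℂ) ⊗ₜ[ℝ] b) := by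
    rw [TensorProduct.smul_tmul', TensorProduct.smul_tmul', ← TensorProduct.sub_tmul]
    congr 1; apply Complex.ext <;> simp
  rw [h1, h2]
  simp only [TensorProduct.smul_tmul']
  abel

lemma I_smul_cpx (a b : U) : Complex.I • cpx a b = cpx (-b) a := by
  rw [smul_cpx]; simp

lemma real_smul_cpx (r : ℝ) (a b : U) : (r : ℂ) • cpx a b = cpx (r • a) (r • b) := by
  rw [smul_cpx]; simp

lemma baseChange_cpx (f : U →ₗ[ℝ] U') (a b : U) :
    f.baseChange ℂ (cpx a b) = cpx (f a) (f b) := by simp [cpx]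

lemma dual_cpx (ξ : Module.Dual ℂ (ℂ ⊗[ℝ] U)) (a b : U) :
    ξ (cpx a b) = ξ ((1 : ℂ) ⊗ₜ[ℝ] a) + Complex.I * ξ ((1 : ℂ) ⊗ₜ[ℝ] b) := by
  have : Complex.I ⊗ₜ[ℝ] b = Complex.I • ((1 : ℂ) ⊗ₜ[ℝ] b) := by simp [TensorProduct.smul_tmul']
  rw [cpx, map_add, this, map_smul, smul_eq_mul]

/-- `cpx` as a real-linear map. -/
def cpxL : U × U →ₗ[ℝ] ℂ ⊗[ℝ] U where
  toFun p := cpx p.1 p.2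
  map_add' p q := (cpx_add _ _ _ _).symm
  map_smul' r p := by simp [cpx, TensorProduct.tmul_smul]

/-- The eigenvalue equation reads `J a = -b` and `J b = a`, and the second follows from the first by
`J² = -1`. So eigenvectors are parametrized by their real parts. -/
lemma mem_iEigenspace {J : U →ₗ[ℝ] U} (hJ : ∀ u, J (J u) = -u) (a b : U) :
    cpx a b ∈ iEigenspace J ↔ b = - J a := by
  rw [iEigenspace, Module.End.mem_eigenspace_iff, baseChange_cpx, I_smul_cpx, cpx_inj]
  constructor
  · rintro ⟨h, -⟩; rw [h, neg_neg]
  · rintro rfl; simp [hJ]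

end Complexification

/-! ### Complex conjugation. -/

section Conj
variable {V : Type*} [AddCommGroup V] [Module ℝ V]

lemma conj_cpx (a b : V) : conj (cpx a b) = cpx a (-b) := by
  change TensorProduct.map Complex.conjAe.toLinearMap (LinearMap.id : V →ₗ[ℝ] V) (cpx a b) = _
  simp [cpx, TensorProduct.neg_tmul, TensorProduct.tmul_neg]

lemma conj_conj (z : ℂ ⊗[ℝ] V) : conj (conj z) = z := by
  obtain ⟨a, b, rfl⟩ := exists_cpx z
  rw [conj_cpx, conj_cpx, neg_neg]

end Conj

/-! ### The complexified double and its pairing. -/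

section Double
variable {V : Type*} [NormedAddCommGroup V] [NormedSpace ℝ V]
  {W : Type*} [NormedAddCommGroup W] [NormedSpace ℝ W]

lemma vecPart_cpx (a b : V × (V →L[ℝ] ℝ)) : vecPart (cpx a b) = cpx a.1 b.1 :=
  baseChange_cpx _ a b

lemma covecPart_cpx (a b : V × (V →L[ℝ] ℝ)) (v w : V) :
    covecPart (cpx a b) (cpx v w) =
      ((a.2 v - b.2 w : ℝ) : ℂ) + ((a.2 w + b.2 v : ℝ) : ℂ) * Complex.I := by
  rw [dual_cpx]
  simp [covecPart, cpx]
  ring_nf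
  simp
  ring

/-- The pairing of the double `V ⊕ V*`. -/
def pair (a b : V × (V →L[ℝ] ℝ)) : ℝ := b.2 a.1 + a.2 b.1

/-- The complexified pairing. -/
def cpair (w z : ℂ ⊗[ℝ] (V × (V →L[ℝ] ℝ))) : ℂ :=
  covecPart z (vecPart w) + covecPart w (vecPart z)

lemma cpair_cpx (a b c d : V × (V →L[ℝ] ℝ)) : cpair (cpx a b) (cpx c d) =
    ((pair a c - pair b d : ℝ) : ℂ) + ((pair a d + pair b c : ℝ) : ℂ) * Complex.I := by
  simp only [cpair, vecPart_cpx, covecPart_cpx, pair]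
  push_cast
  ring

/-- A complex functional is determined by the real and imaginary parts of its restriction to `V`,
and these are continuous because `V` is finite-dimensional. -/
lemma exists_vecPart_covecPart [FiniteDimensional ℝ V] (x : ℂ ⊗[ℝ] V)
    (ξ : Module.Dual ℂ (ℂ ⊗[ℝ] V)) : ∃ w, vecPart w = x ∧ covecPart w = ξ := by
  obtain ⟨a, b, rfl⟩ := exists_cpx x
  let f : V →ₗ[ℝ] ℂ := ξ.restrictScalars ℝ ∘ₗ (TensorProduct.mk ℝ ℂ V 1)
  let r : V →L[ℝ] ℝ := LinearMap.toContinuousLinearMap (Complex.reLm ∘ₗ f)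
  let i : V →L[ℝ] ℝ := LinearMap.toContinuousLinearMap (Complex.imLm ∘ₗ f)
  refine ⟨cpx (a, r) (b, i), vecPart_cpx _ _, ?_⟩
  apply LinearMap.ext
  intro z
  obtain ⟨v, w, rfl⟩ := exists_cpx z
  rw [covecPart_cpx, dual_cpx]
  have h1 : ∀ v : V, ξ ((1 : ℂ) ⊗ₜ[ℝ] v) = (r v : ℂ) + (i v : ℂ) * Complex.I := fun v =>
    (Complex.re_add_im _).symm
  rw [h1, h1]
  push_cast
  ring_nf
  simp
  ring

lemma ext_vecPart_covecPart {w z : ℂ ⊗[ℝ] (V × (V →L[ℝ] ℝ))} (h1 : vecPart w = vecPart z)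
    (h2 : covecPart w = covecPart z) : w = z := by
  obtain ⟨a, b, rfl⟩ := exists_cpx w
  obtain ⟨c, d, rfl⟩ := exists_cpx z
  rw [vecPart_cpx, vecPart_cpx, cpx_inj] at h1
  have h3 : ∀ v, a.2 v = c.2 v ∧ b.2 v = d.2 v := by
    intro v
    have := congrArg (fun L => L (cpx v 0)) h2
    simp only [covecPart_cpx] at this
    have hr := congrArg Complex.re this
    have hi := congrArg Complex.im this
    simp at hr hi
    exact ⟨hr, hi⟩
  rw [cpx_inj]
  exact ⟨Prod.ext h1.1 (ContinuousLinearMap.ext fun v => (h3 v).1),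
    Prod.ext h1.2 (ContinuousLinearMap.ext fun v => (h3 v).2)⟩

/-- `w ∈ V ⊕ V*` and `d ∈ W ⊕ W*` are related by `P : V → W`. -/
def Rel (P : V →L[ℝ] W) (w : V × (V →L[ℝ] ℝ)) (d : W × (W →L[ℝ] ℝ)) : Prop :=
  P w.1 = d.1 ∧ w.2 = d.2.comp P

lemma mem_diracPullback {P : V →L[ℝ] W} {D : Submodule ℂ (ℂ ⊗[ℝ] (W × (W →L[ℝ] ℝ)))}
    {w₁ w₂ : V × (V →L[ℝ] ℝ)} :
    cpx w₁ w₂ ∈ diracPullback P D ↔ ∃ d₁ d₂, Rel P w₁ d₁ ∧ Rel P w₂ d₂ ∧ cpx d₁ d₂ ∈ D := by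
  simp only [diracPullback, Submodule.mem_map, Submodule.mem_comap]
  constructor
  · rintro ⟨z, hz1, hz2⟩
    obtain ⟨a, b, rfl⟩ := exists_cpx z
    rw [baseChange_cpx] at hz1 hz2
    rw [cpx_inj] at hz2
    obtain ⟨rfl, rfl⟩ := hz2
    exact ⟨_, _, ⟨rfl, rfl⟩, ⟨rfl, rfl⟩, hz1⟩
  · rintro ⟨d₁, d₂, ⟨h1, h2⟩, ⟨h3, h4⟩, h5⟩
    refine ⟨cpx (w₁.1, d₁.2) (w₂.1, d₂.2), ?_, ?_⟩
    · rw [baseChange_cpx]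
      have e1 : (LinearMap.prodMap P.toLinearMap (LinearMap.id : (W →L[ℝ] ℝ) →ₗ[ℝ] _)) (w₁.1, d₁.2) = d₁ :=
        Prod.ext h1 rfl
      have e2 : (LinearMap.prodMap P.toLinearMap (LinearMap.id : (W →L[ℝ] ℝ) →ₗ[ℝ] _)) (w₂.1, d₂.2) = d₂ :=
        Prod.ext h3 rfl
      rw [e1, e2]
      exact h5
    · rw [baseChange_cpx, cpx_inj]
      exact ⟨Prod.ext rfl h2.symm, Prod.ext rfl h4.symm⟩

end Double

/-! ### Alternating two-forms as bilinear maps. -/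

section Alternating
variable {𝕜 E : Type*} [Field 𝕜] [AddCommGroup E] [Module 𝕜 E]

lemma alt_add_left (ε : E [⋀^Fin 2]→ₗ[𝕜] 𝕜) (x y z : E) : ε ![x + y, z] = ε ![x, z] + ε ![y, z] :=
  AlternatingMap.map_vecCons_add ε ![z] x y

lemma alt_smul_left (ε : E [⋀^Fin 2]→ₗ[𝕜] 𝕜) (c : 𝕜) (x z : E) : ε ![c • x, z] = c • ε ![x, z] :=
  AlternatingMap.map_vecCons_smul ε ![z] c x

lemma alt_swap (ε : E [⋀^Fin 2]→ₗ[𝕜] 𝕜) (x y : E) : ε ![x, y] = - ε ![y, x] := by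
  have := ε.map_swap ![y, x] (i := 0) (j := 1) (by simp)
  rw [← this]
  congr 1
  funext i
  fin_cases i <;> simp

/-- An alternating two-form as a bilinear map. -/
def altBil (ε : E [⋀^Fin 2]→ₗ[𝕜] 𝕜) : E →ₗ[𝕜] E →ₗ[𝕜] 𝕜 :=
  LinearMap.mk₂ 𝕜 (fun x y => ε ![x, y]) (alt_add_left ε) (fun c x y => alt_smul_left ε c x y)
    (fun x y z => by
      rw [alt_swap ε x, alt_add_left, alt_swap ε x y, alt_swap ε x z]; ring)
    (fun c x y => by
      rw [alt_swap ε x, alt_smul_left, alt_swap ε x y]; simp)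

lemma altBil_apply (ε : E [⋀^Fin 2]→ₗ[𝕜] 𝕜) (x y : E) : altBil ε x y = ε ![x, y] := rfl

/-- An alternating bilinear map as an alternating two-form. -/
def altOfBil (B : E →ₗ[𝕜] E →ₗ[𝕜] 𝕜) (hB : ∀ x, B x x = 0) : E [⋀^Fin 2]→ₗ[𝕜] 𝕜 where
  toFun v := B (v 0) (v 1)
  map_update_add' v i x y := by fin_cases i <;> simp [Function.update]
  map_update_smul' v i c x := by fin_cases i <;> simp [Function.update]
  map_eq_zero_of_eq' v i j hij hne := by
    fin_cases i <;> fin_cases j <;> simp_all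

end Alternating

/-! ### Lagrangian subspaces are the spaces `L(E, ε)`. -/

section Lagrangian
variable {V : Type*} [NormedAddCommGroup V] [NormedSpace ℝ V]

lemma cpair_comm (w z : ℂ ⊗[ℝ] (V × (V →L[ℝ] ℝ))) : cpair w z = cpair z w := add_comm _ _

/-- The complexified pairing as a bilinear form. -/
def cpairForm : LinearMap.BilinForm ℂ (ℂ ⊗[ℝ] (V × (V →L[ℝ] ℝ))) :=
  LinearMap.mk₂ ℂ cpair
    (fun a b c => by simp only [cpair, map_add, LinearMap.add_apply]; ring)
    (fun r a b => by simp only [cpair, map_smul, LinearMap.smul_apply, smul_eq_mul]; ring)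
    (fun a b c => by simp only [cpair, map_add, LinearMap.add_apply]; ring)
    (fun r a b => by simp only [cpair, map_smul, LinearMap.smul_apply, smul_eq_mul]; ring)

lemma cpairForm_apply (w z : ℂ ⊗[ℝ] (V × (V →L[ℝ] ℝ))) : cpairForm w z = cpair w z := rfl

lemma cpair_add_left (a b c : ℂ ⊗[ℝ] (V × (V →L[ℝ] ℝ))) :
    cpair (a + b) c = cpair a c + cpair b c := LinearMap.map_add₂ cpairForm a b c

lemma cpair_smul_left (r : ℂ) (a c : ℂ ⊗[ℝ] (V × (V →L[ℝ] ℝ))) :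
    cpair (r • a) c = r * cpair a c := LinearMap.map_smul₂ cpairForm r a c

/-- A subspace equal to its own orthogonal complement. -/
def IsLagrangian (L : Submodule ℂ (ℂ ⊗[ℝ] (V × (V →L[ℝ] ℝ)))) : Prop :=
  ∀ w, w ∈ L ↔ ∀ z ∈ L, cpair w z = 0

variable [FiniteDimensional ℝ V]

lemma mem_of_forall_annihilator (E : Submodule ℂ (ℂ ⊗[ℝ] V)) (x : ℂ ⊗[ℝ] V)
    (h : ∀ ζ : Module.Dual ℂ (ℂ ⊗[ℝ] V), (∀ y ∈ E, ζ y = 0) → ζ x = 0) : x ∈ E := by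
  rw [← Subspace.dualAnnihilator_dualCoannihilator_eq (W := E), Submodule.mem_dualCoannihilator]
  intro ζ hζ
  exact h ζ ((Submodule.mem_dualAnnihilator ζ).1 hζ)

lemma exists_extension (E : Submodule ℂ (ℂ ⊗[ℝ] V)) (f : E →ₗ[ℂ] ℂ) :
    ∃ ξ : Module.Dual ℂ (ℂ ⊗[ℝ] V), ∀ y : E, ξ y = f y := by
  obtain ⟨ξ, hξ⟩ := LinearMap.exists_extend f
  exact ⟨ξ, fun y => congrArg (fun L => L y) hξ⟩

variable {E : Submodule ℂ (ℂ ⊗[ℝ] V)} {ε : E [⋀^Fin 2]→ₗ[ℂ] ℂ}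

/-- The functional `ε(x, ·)` extends from `E` to the whole space, so `L(E, ε)` projects onto `E`. -/
lemma exists_mem_diracSpace (x : E) : ∃ w ∈ diracSpace E ε, vecPart w = (x : ℂ ⊗[ℝ] V) := by
  obtain ⟨ξ, hξ⟩ := exists_extension E (altBil ε x)
  obtain ⟨w, h1, h2⟩ := exists_vecPart_covecPart (x : ℂ ⊗[ℝ] V) ξ
  refine ⟨w, ⟨by rw [h1]; exact x.2, fun Y => ?_⟩, h1⟩
  rw [h2, hξ, altBil_apply]
  congr 3
  exact Subtype.ext h1.symm

omit [FiniteDimensional ℝ V] in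
lemma cpair_eq_zero_of_mem_diracSpace {w z : ℂ ⊗[ℝ] (V × (V →L[ℝ] ℝ))}
    (hw : w ∈ diracSpace E ε) (hz : z ∈ diracSpace E ε) : cpair w z = 0 := by
  obtain ⟨h1, h2⟩ := hw
  obtain ⟨h3, h4⟩ := hz
  have e1 := h2 ⟨_, h3⟩
  have e2 := h4 ⟨_, h1⟩
  simp only at e1 e2
  rw [cpair, e1, e2, alt_swap]
  ring

/-- Pairing with `(0, ζ)`, for `ζ` annihilating `E`, forces the vector part into `E` by double
annihilation; pairing with an element over `Y` then evaluates the covector part on `Y`. -/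
lemma mem_diracSpace_of_cpair {w : ℂ ⊗[ℝ] (V × (V →L[ℝ] ℝ))}
    (h : ∀ z ∈ diracSpace E ε, cpair w z = 0) : w ∈ diracSpace E ε := by
  have hx : vecPart w ∈ E := by
    refine mem_of_forall_annihilator E _ fun ζ hζ => ?_
    obtain ⟨z, h1, h2⟩ := exists_vecPart_covecPart (0 : ℂ ⊗[ℝ] V) ζ
    have hz : z ∈ diracSpace E ε := by
      refine ⟨by rw [h1]; exact E.zero_mem, fun Y => ?_⟩
      have e : (⟨vecPart z, by rw [h1]; exact E.zero_mem⟩ : E) = 0 := Subtype.ext h1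
      rw [e, h2, hζ _ Y.2, ← altBil_apply, map_zero]
      rfl
    have := h z hz
    rwa [cpair, h1, h2, map_zero, add_zero] at this
  refine ⟨hx, fun Y => ?_⟩
  obtain ⟨z, hz, hzY⟩ := exists_mem_diracSpace (ε := ε) Y
  have h1 := h z hz
  obtain ⟨h2, h3⟩ := hz
  have h4 := h3 ⟨_, hx⟩
  have h5 : (⟨vecPart z, h2⟩ : E) = Y := Subtype.ext hzY
  simp only at h4
  rw [cpair, hzY, h4, h5, alt_swap] at h1
  exact (neg_add_eq_zero.1 h1).symm

variable (E ε) in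
/-- `L(E, ε)` as a subspace. -/
def diracSubmodule : Submodule ℂ (ℂ ⊗[ℝ] (V × (V →L[ℝ] ℝ))) where
  carrier := diracSpace E ε
  -- The subspace axioms follow from self-orthogonality, an equation linear in the element, which
  -- avoids working with the dependent condition directly.
  add_mem' {a b} ha hb := mem_diracSpace_of_cpair fun z hz => by
    rw [cpair_add_left, cpair_eq_zero_of_mem_diracSpace ha hz,
      cpair_eq_zero_of_mem_diracSpace hb hz, add_zero]
  zero_mem' := mem_diracSpace_of_cpair fun z _ => LinearMap.map_zero₂ cpairForm z
  smul_mem' c a ha := mem_diracSpace_of_cpair fun z hz => by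
    rw [cpair_smul_left, cpair_eq_zero_of_mem_diracSpace ha hz, mul_zero]

lemma coe_diracSubmodule : (diracSubmodule E ε : Set _) = diracSpace E ε := rfl

lemma isLagrangian_diracSubmodule : IsLagrangian (diracSubmodule E ε) := fun _ =>
  ⟨fun hw _ hz => cpair_eq_zero_of_mem_diracSpace hw hz, mem_diracSpace_of_cpair⟩

/-- A Lagrangian subspace is of the form `L(E, ε)`. -/
lemma IsLagrangian.exists_eq_diracSpace {L : Submodule ℂ (ℂ ⊗[ℝ] (V × (V →L[ℝ] ℝ)))}
    (hL : IsLagrangian L) : ∃ (E : Submodule ℂ (ℂ ⊗[ℝ] V)) (ε : E [⋀^Fin 2]→ₗ[ℂ] ℂ),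
      (L : Set (ℂ ⊗[ℝ] (V × (V →L[ℝ] ℝ)))) = diracSpace E ε := by
  let E := L.map vecPart
  let p : L →ₗ[ℂ] E := (vecPart.comp L.subtype).codRestrict E
    fun w => Submodule.mem_map_of_mem w.2
  have hp : Function.Surjective p := by
    rintro ⟨x, w, hw, rfl⟩
    exact ⟨⟨w, hw⟩, rfl⟩
  obtain ⟨s, hs⟩ := p.exists_rightInverse_of_surjective (LinearMap.range_eq_top.2 hp)
  have hs' : ∀ x : E, vecPart (s x : ℂ ⊗[ℝ] (V × (V →L[ℝ] ℝ))) = (x : ℂ ⊗[ℝ] V) := fun x =>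
    congrArg Subtype.val (congrArg (fun f => f x) hs)
  -- The two-form is read off from an arbitrary linear section `s` of `L → E`. Isotropy makes it
  -- alternating, and also shows that the choice of section is irrelevant on `E`.
  let B : E →ₗ[ℂ] E →ₗ[ℂ] ℂ := LinearMap.mk₂ ℂ (fun x y => covecPart (s x : ℂ ⊗[ℝ] (V × (V →L[ℝ] ℝ))) y)
    (fun x y z => by simp) (fun c x y => by simp) (fun x y z => by simp) (fun c x y => by simp)
  have hB : ∀ x, B x x = 0 := by
    intro x
    have h1 := (hL _).1 (s x).2 _ (s x).2
    rw [cpair, hs'] at h1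
    have h2 : (2 : ℂ) * B x x = 0 := by rw [two_mul]; exact h1
    simpa using h2
  have hcov : ∀ w ∈ L, ∀ (x y : E), vecPart w = (x : ℂ ⊗[ℝ] V) → covecPart w y = B x y := by
    intro w hw x y hwx
    have h1 := (hL _).1 (L.sub_mem hw (s x).2) _ (s y).2
    rw [cpair, map_sub, hs', hs', hwx, sub_self, map_zero, zero_add, map_sub, LinearMap.sub_apply,
      sub_eq_zero] at h1
    exact h1
  refine ⟨E, altOfBil B hB, ?_⟩
  have hsub : (L : Set (ℂ ⊗[ℝ] (V × (V →L[ℝ] ℝ)))) ⊆ diracSpace E (altOfBil B hB) := fun w hw =>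
    ⟨Submodule.mem_map_of_mem hw, fun Y => hcov w hw _ Y rfl⟩
  -- `L(E, ε)` is isotropic and contains `L`; a Lagrangian subspace has no larger isotropic set
  -- around it.
  refine Subset.antisymm hsub fun w hw => (hL w).2 fun z hz => ?_
  exact cpair_eq_zero_of_mem_diracSpace hw (hsub hz)

end Lagrangian

/-! ### Pullback along a surjection, and from eigenspaces to pairs. -/

section Relations
variable {V : Type*} [NormedAddCommGroup V] [NormedSpace ℝ V]
  {W : Type*} [NormedAddCommGroup W] [NormedSpace ℝ W]
  {P : V →L[ℝ] W}

lemma pair_comm (a b : V × (V →L[ℝ] ℝ)) : pair a b = pair b a := add_comm _ _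

lemma pair_neg_left (a b : V × (V →L[ℝ] ℝ)) : pair (-a) b = - pair a b := by
  simp [pair]; ring

lemma pair_neg_right (a b : V × (V →L[ℝ] ℝ)) : pair a (-b) = - pair a b := by
  simp [pair]; ring

lemma pair_add_left (a b c : V × (V →L[ℝ] ℝ)) : pair (a + b) c = pair a c + pair b c := by
  simp [pair]; ring

lemma pair_sub_left (a b c : V × (V →L[ℝ] ℝ)) : pair (a - b) c = pair a c - pair b c := by
  simp [pair]; ring

lemma cpair_cpx_eq_zero {a b c d : V × (V →L[ℝ] ℝ)} :
    cpair (cpx a b) (cpx c d) = 0 ↔ pair a c = pair b d ∧ pair a d = - pair b c := by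
  rw [cpair_cpx, Complex.ext_iff]
  simp
  constructor
  · rintro ⟨h1, h2⟩; constructor <;> linarith
  · rintro ⟨h1, h2⟩; constructor <;> linarith

lemma eq_zero_of_pair [FiniteDimensional ℝ V] {a : V × (V →L[ℝ] ℝ)} (h : ∀ b, pair a b = 0) :
    a = 0 := by
  refine Prod.ext ?_ (ContinuousLinearMap.ext fun v => ?_)
  · by_contra hne
    obtain ⟨f, -, hf⟩ := exists_dual_vector ℝ a.1 (norm_ne_zero_iff.2 hne)
    have h1 := h (0, f)
    simp [pair] at h1
    rw [h1] at hf
    exact hne (norm_eq_zero.1 (by simpa using hf.symm))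
  · simpa [pair] using h (v, 0)

lemma Rel.pair_eq {a b : V × (V →L[ℝ] ℝ)} {d e : W × (W →L[ℝ] ℝ)} (h1 : Rel P a d)
    (h2 : Rel P b e) : pair a b = pair d e := by
  simp [pair, h1.2, h2.2, h1.1, h2.1]

lemma Rel.neg {a : V × (V →L[ℝ] ℝ)} {d : W × (W →L[ℝ] ℝ)} (h1 : Rel P a d) : Rel P (-a) (-d) :=
  ⟨by simp [h1.1], by ext; simp [h1.2]⟩

lemma Rel.sub {a b : V × (V →L[ℝ] ℝ)} {d e : W × (W →L[ℝ] ℝ)} (h1 : Rel P a d) (h2 : Rel P b e) :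
    Rel P (a - b) (d - e) :=
  ⟨by simp [h1.1, h2.1], by ext; simp [h1.2, h2.2]⟩

lemma Rel.add {a b : V × (V →L[ℝ] ℝ)} {d e : W × (W →L[ℝ] ℝ)} (h1 : Rel P a d) (h2 : Rel P b e) :
    Rel P (a + b) (d + e) :=
  ⟨by simp [h1.1, h2.1], by ext; simp [h1.2, h2.2]⟩

lemma Rel.smul {a : V × (V →L[ℝ] ℝ)} {d : W × (W →L[ℝ] ℝ)} (r : ℝ) (h1 : Rel P a d) :
    Rel P (r • a) (r • d) :=
  ⟨by simp [h1.1], by ext; simp [h1.2]⟩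

lemma Rel.unique (hP : Function.Surjective P) {a : V × (V →L[ℝ] ℝ)} {d e : W × (W →L[ℝ] ℝ)}
    (h1 : Rel P a d) (h2 : Rel P a e) : d = e := by
  refine Prod.ext (h1.1.symm.trans h2.1) (ContinuousLinearMap.ext fun w => ?_)
  obtain ⟨v, rfl⟩ := hP w
  have := h1.2.symm.trans h2.2
  exact congrArg (fun L => L v) this

lemma exists_continuous_rightInverse [FiniteDimensional ℝ W] (hP : Function.Surjective P) :
    ∃ R : W →L[ℝ] V, ∀ w, P (R w) = w := by
  obtain ⟨R, hR⟩ := P.toLinearMap.exists_rightInverse_of_surjective (LinearMap.range_eq_top.2 hP)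
  exact ⟨LinearMap.toContinuousLinearMap R, fun w => congrArg (fun f => f w) hR⟩

lemma exists_rel (hP : Function.Surjective P) (d : W × (W →L[ℝ] ℝ)) : ∃ a, Rel P a d := by
  obtain ⟨v, hv⟩ := hP d.1
  exact ⟨(v, d.2.comp P), hv, rfl⟩

/-- A covector that kills the kernel of `P` descends through any right inverse of `P`. -/
lemma exists_rel_of_vanish [FiniteDimensional ℝ W] (hP : Function.Surjective P)
    {a : V × (V →L[ℝ] ℝ)} (h : ∀ v, P v = 0 → a.2 v = 0) : ∃ d, Rel P a d := by
  obtain ⟨R, hR⟩ := exists_continuous_rightInverse hP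
  refine ⟨(P a.1, a.2.comp R), rfl, ContinuousLinearMap.ext fun v => ?_⟩
  have := h (v - R (P v)) (by rw [map_sub, hR, sub_self])
  rw [map_sub, sub_eq_zero] at this
  exact this

lemma rel_vertical {v : V} (hv : P v = 0) : Rel P (v, 0) 0 := ⟨hv, by ext; simp⟩

lemma Rel.sub_eq_vertical {a b : V × (V →L[ℝ] ℝ)} {d : W × (W →L[ℝ] ℝ)} (h1 : Rel P a d)
    (h2 : Rel P b d) : ∃ v, P v = 0 ∧ a = b + (v, 0) := by
  refine ⟨a.1 - b.1, by rw [map_sub, h1.1, h2.1, sub_self], Prod.ext (by simp) ?_⟩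
  simp [h1.2, h2.2]

/-- The pullback of a Lagrangian subspace under a surjection is Lagrangian. -/
lemma isLagrangian_diracPullback [FiniteDimensional ℝ W] (hP : Function.Surjective P)
    {D : Submodule ℂ (ℂ ⊗[ℝ] (W × (W →L[ℝ] ℝ)))} (hD : IsLagrangian D) :
    IsLagrangian (diracPullback P D) := by
  intro w
  obtain ⟨w₁, w₂, rfl⟩ := exists_cpx w
  constructor
  · intro hw z hz
    obtain ⟨z₁, z₂, rfl⟩ := exists_cpx z
    obtain ⟨d₁, d₂, h1, h2, h3⟩ := mem_diracPullback.1 hw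
    obtain ⟨e₁, e₂, h4, h5, h6⟩ := mem_diracPullback.1 hz
    have h7 := (hD _).1 h3 _ h6
    rw [cpair_cpx_eq_zero] at h7 ⊢
    rwa [h1.pair_eq h4, h1.pair_eq h5, h2.pair_eq h4, h2.pair_eq h5]
  · intro h
    -- The pullback contains all vertical vectors, so whatever is orthogonal to it has covectors
    -- that descend to `W`. There the Lagrangian property of `D` applies.
    have hv : ∀ v, P v = 0 → w₁.2 v = 0 ∧ w₂.2 v = 0 := by
      intro v hv
      have h1 : cpx ((v, 0) : V × (V →L[ℝ] ℝ)) 0 ∈ diracPullback P D :=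
        mem_diracPullback.2 ⟨0, 0, rel_vertical hv, by constructor <;> simp,
          by rw [cpx_zero_zero]; exact D.zero_mem⟩
      have h2 := cpair_cpx_eq_zero.1 (h _ h1)
      simp [pair] at h2
      exact ⟨h2.1, h2.2⟩
    obtain ⟨d₁, h1⟩ := exists_rel_of_vanish hP fun v hP => (hv v hP).1
    obtain ⟨d₂, h2⟩ := exists_rel_of_vanish hP fun v hP => (hv v hP).2
    refine mem_diracPullback.2 ⟨d₁, d₂, h1, h2, (hD _).2 fun z hz => ?_⟩
    obtain ⟨e₁, e₂, rfl⟩ := exists_cpx z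
    obtain ⟨z₁, h4⟩ := exists_rel hP e₁
    obtain ⟨z₂, h5⟩ := exists_rel hP e₂
    have h7 := h _ (mem_diracPullback.2 ⟨e₁, e₂, h4, h5, hz⟩)
    rw [cpair_cpx_eq_zero] at h7 ⊢
    rwa [h1.pair_eq h4, h1.pair_eq h5, h2.pair_eq h4, h2.pair_eq h5] at h7

variable {J : W × (W →L[ℝ] ℝ) →ₗ[ℝ] W × (W →L[ℝ] ℝ)}

lemma pair_J_left (hJ : ∀ u, J (J u) = -u) (hJo : ∀ u v, pair (J u) (J v) = pair u v)
    (u v : W × (W →L[ℝ] ℝ)) : pair (J u) v = - pair u (J v) := by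
  have := hJo u (J v)
  rw [hJ, pair_neg_right] at this
  linarith

/-- Isotropy is skewness of `J`. Conversely, pairing `a + ib` with `c - iJc` for all real `c` shows
that `b + J a` is orthogonal to everything. -/
lemma isLagrangian_iEigenspace [FiniteDimensional ℝ W] (hJ : ∀ u, J (J u) = -u)
    (hJo : ∀ u v, pair (J u) (J v) = pair u v) : IsLagrangian (iEigenspace J) := by
  intro w
  obtain ⟨a, b, rfl⟩ := exists_cpx w
  constructor
  · intro hw z hz
    obtain ⟨c, d, rfl⟩ := exists_cpx z
    rw [mem_iEigenspace hJ] at hw hz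
    subst hw hz
    rw [cpair_cpx_eq_zero]
    simp only [pair_neg_left, pair_neg_right, hJo, neg_neg, true_and]
    rw [pair_J_left hJ hJo]
  · intro h
    rw [mem_iEigenspace hJ]
    have h1 : b + J a = 0 := by
      refine eq_zero_of_pair fun c => ?_
      have h2 := (cpair_cpx_eq_zero.1 (h (cpx c (-J c)) ((mem_iEigenspace hJ _ _).2 rfl))).2
      rw [pair_neg_right] at h2
      rw [pair_add_left, pair_J_left hJ hJo]
      linarith
    exact eq_neg_of_add_eq_zero_left h1

lemma alt_congr_left {E : Submodule ℂ (ℂ ⊗[ℝ] V)} (ε : E [⋀^Fin 2]→ₗ[ℂ] ℂ) {x x' : E}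
    (h : (x : ℂ ⊗[ℝ] V) = x') (y : E) : ε ![x, y] = ε ![x', y] := by
  rw [Subtype.ext h]

/-- The linear conditions of a GC-pair. -/
structure LinearGCPair (P : V →L[ℝ] W) (E : Submodule ℂ (ℂ ⊗[ℝ] V)) (ε : E [⋀^Fin 2]→ₗ[ℂ] ℂ) :
    Prop where
  ker_le : ∀ X, P X = 0 → (1 : ℂ) ⊗ₜ[ℝ] X ∈ E
  sup_conj : E ⊔ E.map conj = ⊤
  vanish : ∀ X, P X = 0 → ∀ (hX : (1 : ℂ) ⊗ₜ[ℝ] X ∈ E) (Y : E), ε ![⟨(1 : ℂ) ⊗ₜ[ℝ] X, hX⟩, Y] = 0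
  nondegenerate : ∀ (X : E) (hX : conj X.1 ∈ E),
    (∀ (Y : E) (hY : conj Y.1 ∈ E),
      ε ![X, Y] - starRingEnd ℂ (ε ![⟨conj X.1, hX⟩, ⟨conj Y.1, hY⟩]) = 0) →
    ∃ a b, X.1 = cpx a b ∧ P a = 0 ∧ P b = 0

/-- This is how `conj (ε(X̄, Ȳ))` in the nondegeneracy condition is read as the value of a
conjugated covector. -/
lemma covecPart_conj (a b : V × (V →L[ℝ] ℝ)) (y : ℂ ⊗[ℝ] V) :
    covecPart (cpx a (-b)) (conj y) = starRingEnd ℂ (covecPart (cpx a b) y) := by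
  obtain ⟨c, d, rfl⟩ := exists_cpx y
  rw [conj_cpx, covecPart_cpx, covecPart_cpx]
  apply Complex.ext <;> simp
  ring

variable [FiniteDimensional ℝ V] [FiniteDimensional ℝ W]

lemma mem_iff_of_eq_diracSpace {E : Submodule ℂ (ℂ ⊗[ℝ] V)} {ε : E [⋀^Fin 2]→ₗ[ℂ] ℂ}
    {L : Submodule ℂ (ℂ ⊗[ℝ] (V × (V →L[ℝ] ℝ)))}
    (hL : (L : Set (ℂ ⊗[ℝ] (V × (V →L[ℝ] ℝ)))) = diracSpace E ε) (w) :
    w ∈ L ↔ w ∈ diracSpace E ε := by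
  rw [← hL]; rfl

/-- The pair attached to the pullback of the `i`-eigenspace of a linear generalized complex
structure. -/
lemma linearGCPair_of_iEigenspace (hP : Function.Surjective P) (hJ : ∀ u, J (J u) = -u)
    {E : Submodule ℂ (ℂ ⊗[ℝ] V)} {ε : E [⋀^Fin 2]→ₗ[ℂ] ℂ}
    (hL : (diracPullback P (iEigenspace J) : Set (ℂ ⊗[ℝ] (V × (V →L[ℝ] ℝ)))) = diracSpace E ε) :
    LinearGCPair P E ε := by
  have hmem := mem_iff_of_eq_diracSpace hL
  have hlift : ∀ {w₁ w₂ d}, Rel P w₁ d → Rel P w₂ (-J d) → cpx w₁ w₂ ∈ diracSpace E ε := by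
    intro w₁ w₂ d h1 h2
    exact (hmem _).1 (mem_diracPullback.2 ⟨d, _, h1, h2, (mem_iEigenspace hJ _ _).2 rfl⟩)
  have hvert : ∀ X, P X = 0 → cpx ((X, 0) : V × (V →L[ℝ] ℝ)) 0 ∈ diracSpace E ε := fun X hX =>
    hlift (rel_vertical hX) (by rw [map_zero, neg_zero]; constructor <;> simp)
  refine ⟨fun X hX => ?_, ?_, fun X hX hX' Y => ?_, fun X hX h => ?_⟩
  · have := (hvert X hX).1
    rw [vecPart_cpx] at this
    rwa [one_tmul_eq_cpx]
  · rw [eq_top_iff]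
    -- The element of `L` over `(P v, 0) - iJ(P v, 0)` can be chosen with vector part of real part
    -- `v`; averaging that vector part with its conjugate leaves `v`.
    have hr : ∀ v, cpx v 0 ∈ E ⊔ E.map conj := by
      intro v
      obtain ⟨w, hw⟩ := exists_rel hP (-J (P v, 0))
      have h1 := (hlift (w₁ := ((v, 0) : V × (V →L[ℝ] ℝ))) (d := (P v, 0))
        ⟨rfl, by ext; simp⟩ hw).1
      rw [vecPart_cpx] at h1
      have h2 : cpx v (-w.1) ∈ E.map conj := ⟨_, h1, conj_cpx _ _⟩
      have h3 := Submodule.add_mem_sup h1 h2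
      rw [cpx_add] at h3
      have h4 := Submodule.smul_mem _ ((1 / 2 : ℝ) : ℂ) h3
      rw [real_smul_cpx] at h4
      convert! h4 using 2
      · simp only [one_div]
        rw [← two_smul ℝ v, smul_smul]; simp
      · simp
    rintro z -
    obtain ⟨a, b, rfl⟩ := exists_cpx z
    have h1 := Submodule.add_mem _ (hr a) (Submodule.smul_mem _ Complex.I (hr b))
    rw [I_smul_cpx, cpx_add] at h1
    simpa using h1
  · obtain ⟨h1, h2⟩ := hvert X hX
    have h3 := h2 Y
    have h4 : (⟨(1 : ℂ) ⊗ₜ[ℝ] X, hX'⟩ : E) = ⟨_, h1⟩ := by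
      exact Subtype.ext ((one_tmul_eq_cpx X).trans
        (vecPart_cpx ((X, 0) : V × (V →L[ℝ] ℝ)) 0).symm)
    rw [h4, ← h3]
    obtain ⟨c, d, hY⟩ := exists_cpx (Y : ℂ ⊗[ℝ] V)
    rw [hY, covecPart_cpx]
    simp
  · obtain ⟨w, hw, hwX⟩ := exists_mem_diracSpace (ε := ε) X
    obtain ⟨z, hz, hzX⟩ := exists_mem_diracSpace (ε := ε) ⟨_, hX⟩
    obtain ⟨z₁, z₂, rfl⟩ := exists_cpx z
    have hE : ∀ y, y ∈ E.map conj → conj y ∈ E := by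
      rintro _ ⟨x, hx, rfl⟩
      rwa [conj_conj]
    -- The hypothesis says that the covectors of `w` over `X` and of the conjugate of `z` agree on
    -- `E ∩ Ē`. Their difference splits as `α + β` with `α` killing `E` and `β` killing `Ē`.
    -- Subtracting `α` from the covector of `w` yields `m` such that both `m` and its conjugate lie
    -- in `L`.
    have hann : covecPart w - covecPart (cpx z₁ (-z₂)) ∈ (E ⊓ E.map conj).dualAnnihilator := by
      rw [Submodule.mem_dualAnnihilator]
      rintro y ⟨hy1, hy2⟩
      have hy2' := hE y hy2
      obtain ⟨h1, h2⟩ := hw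
      obtain ⟨h3, h4⟩ := hz
      have e1 := h2 ⟨y, hy1⟩
      have e2 := h4 ⟨conj y, hy2'⟩
      have e3 := covecPart_conj z₁ z₂ (conj y)
      rw [conj_conj] at e3
      have e4 : (⟨vecPart w, h1⟩ : E) = X := Subtype.ext hwX
      have e5 : (⟨vecPart (cpx z₁ z₂), h3⟩ : E) = ⟨_, hX⟩ := Subtype.ext hzX
      rw [e4] at e1
      rw [e5] at e2
      rw [LinearMap.sub_apply, e3]
      exact (congrArg₂ (fun a b => a - starRingEnd ℂ b) e1 e2).trans (h ⟨y, hy1⟩ hy2')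
    rw [Subspace.dualAnnihilator_inf_eq, Submodule.mem_sup] at hann
    obtain ⟨α, hα, β, hβ, hαβ⟩ := hann
    rw [Submodule.mem_dualAnnihilator] at hα hβ
    obtain ⟨m, hm1, hm2⟩ := exists_vecPart_covecPart (X : ℂ ⊗[ℝ] V) (covecPart w - α)
    obtain ⟨m₁, m₂, rfl⟩ := exists_cpx m
    have hmL : cpx m₁ m₂ ∈ diracSpace E ε := by
      obtain ⟨h1, h2⟩ := hw
      refine ⟨by rw [hm1]; exact X.2, fun Y => ?_⟩
      rw [hm2, LinearMap.sub_apply, hα _ Y.2, sub_zero, h2 Y]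
      exact alt_congr_left ε (hwX.trans hm1.symm) Y
    have hmc : conj (vecPart (cpx m₁ m₂)) = vecPart (cpx m₁ (-m₂)) := by
      rw [vecPart_cpx, vecPart_cpx, conj_cpx]; rfl
    have hmL' : cpx m₁ (-m₂) ∈ diracSpace E ε := by
      have hv : vecPart (cpx m₁ (-m₂)) = conj X.1 := by rw [← hmc, hm1]
      obtain ⟨h3, h4⟩ := hz
      refine ⟨by rw [hv]; exact hX, fun Y => ?_⟩
      have e1 := covecPart_conj m₁ m₂ (conj (Y : ℂ ⊗[ℝ] V))
      rw [conj_conj] at e1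
      have e2 : covecPart w - α = covecPart (cpx z₁ (-z₂)) + β := by
        rw [sub_eq_iff_eq_add, sub_eq_iff_eq_add.1 hαβ.symm]
        abel
      have e3 := covecPart_conj z₁ z₂ (Y : ℂ ⊗[ℝ] V)
      rw [e1, hm2, e2, LinearMap.add_apply, hβ _ ⟨_, Y.2, rfl⟩, add_zero, e3, Complex.conj_conj, h4 Y]
      exact alt_congr_left ε (hzX.trans hv.symm) Y
    -- Both `m` and its conjugate descend into the eigenspace with the same real part `d₁`, so the
    -- imaginary part `-J d₁` equals its own negative. Hence the image of `m` is zero and `X` is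
    -- vertical.
    obtain ⟨d₁, d₂, r1, r2, r3⟩ := mem_diracPullback.1 ((hmem _).2 hmL)
    obtain ⟨e₁, e₂, s1, s2, s3⟩ := mem_diracPullback.1 ((hmem _).2 hmL')
    have h5 := r1.unique hP s1
    have h6 := r2.neg.unique hP s2
    rw [mem_iEigenspace hJ] at r3 s3
    rw [← h5, ← h6, r3, neg_neg] at s3
    have h7 : J d₁ = 0 := by
      have : (2 : ℝ) • J d₁ = 0 := by rw [two_smul]; nth_rewrite 1 [s3]; simp
      simpa using this
    have h8 : d₁ = 0 := by
      have := hJ d₁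
      rw [h7, map_zero] at this
      simpa using this.symm
    rw [h7, neg_zero] at r3
    refine ⟨m₁.1, m₂.1, ?_, ?_, ?_⟩
    · rw [← hm1, vecPart_cpx]
    · rw [r1.1, h8]; rfl
    · rw [r2.1, r3]; rfl
end Relations

/-! ### From linear pairs back to linear complex structures. -/

section FromPair
variable {V : Type*} [NormedAddCommGroup V] [NormedSpace ℝ V] [FiniteDimensional ℝ V]
  {W : Type*} [NormedAddCommGroup W] [NormedSpace ℝ W] [FiniteDimensional ℝ W]
  {P : V →L[ℝ] W}

/-- A Lagrangian subspace meeting its conjugate trivially is the `i`-eigenspace of a linear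
generalized complex structure. -/
lemma IsLagrangian.exists_complexStructure {D : Submodule ℂ (ℂ ⊗[ℝ] (W × (W →L[ℝ] ℝ)))}
    (hD : IsLagrangian D) (hbar : ∀ a b, cpx a b ∈ D → cpx a (-b) ∈ D → a = 0 ∧ b = 0) :
    ∃ J : W × (W →L[ℝ] ℝ) →ₗ[ℝ] W × (W →L[ℝ] ℝ), (∀ u, J (J u) = -u) ∧
      (∀ u v, pair (J u) (J v) = pair u v) ∧ D = iEigenspace J := by
  have hnd : (cpairForm (V := W)).Nondegenerate := by
    have hl : ∀ z : ℂ ⊗[ℝ] (W × (W →L[ℝ] ℝ)), (∀ y, cpair z y = 0) → z = 0 := by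
      intro z hz
      obtain ⟨a, b, rfl⟩ := exists_cpx z
      have ha : a = 0 := eq_zero_of_pair fun c => by
        have := (cpair_cpx_eq_zero.1 (hz (cpx c 0))).1
        rw [this]; simp [pair]
      have hb : b = 0 := eq_zero_of_pair fun c => by
        have := (cpair_cpx_eq_zero.1 (hz (cpx c 0))).2
        rw [← neg_eq_zero, ← this]; simp [pair]
      rw [ha, hb, cpx_zero_zero]
    exact ⟨hl, fun z hz => hl z fun y => by rw [cpair_comm]; exact hz y⟩
  let S : Submodule ℂ (ℂ ⊗[ℝ] (W × (W →L[ℝ] ℝ))) := D ⊔ D.map conj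
  have hconjmem : ∀ a b, cpx a b ∈ D → cpx a (-b) ∈ D.map conj := fun a b h =>
    ⟨_, h, conj_cpx a b⟩
  -- Anything orthogonal to `D` and to its conjugate lies in both, as these are Lagrangian. By
  -- nondegeneracy of the pairing, trivial intersection then makes the sum everything.
  have hS0 : cpairForm.orthogonal S = ⊥ := by
    rw [eq_bot_iff]
    intro z hz
    rw [LinearMap.BilinForm.mem_orthogonal_iff] at hz
    obtain ⟨a, b, rfl⟩ := exists_cpx z
    have h1 : cpx a b ∈ D := (hD _).2 fun y hy => by
      rw [cpair_comm]; exact hz y (Submodule.mem_sup_left hy)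
    have h2 : cpx a (-b) ∈ D := (hD _).2 fun y hy => by
      obtain ⟨c, d, rfl⟩ := exists_cpx y
      have h3 := hz _ (Submodule.mem_sup_right (hconjmem c d hy))
      rw [cpairForm_apply, cpair_cpx_eq_zero] at h3
      rw [cpair_cpx_eq_zero]
      simp only [pair_neg_left, pair_neg_right] at h3 ⊢
      rw [pair_comm a c, pair_comm b d, pair_comm a d, pair_comm b c]
      exact ⟨by linarith [h3.1], by linarith [h3.2]⟩
    obtain ⟨rfl, rfl⟩ := hbar a b h1 h2
    exact cpx_zero_zero
  have hS : S = ⊤ := by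
    have h1 := LinearMap.BilinForm.finrank_orthogonal hnd S
    rw [hS0, finrank_bot] at h1
    refine Submodule.eq_top_of_finrank_eq (le_antisymm (Submodule.finrank_le S) ?_)
    omega
  -- Write real `d` as `z + ȳ` with `z`, `y` in `D`; then `z + y` is in `D` and has the same real
  -- part. The imaginary part is unique, and its negative is declared to be `J d`.
  have hex : ∀ d, ∃ e, cpx d (-e) ∈ D := by
    intro d
    have h1 : cpx d 0 ∈ S := by rw [hS]; trivial
    obtain ⟨z, hz, y', ⟨y, hy, rfl⟩, h2⟩ := Submodule.mem_sup.1 h1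
    obtain ⟨a, b, rfl⟩ := exists_cpx z
    obtain ⟨c, e, rfl⟩ := exists_cpx y
    rw [conj_cpx, cpx_add, cpx_inj] at h2
    have h3 := D.add_mem hz hy
    rw [cpx_add, h2.1] at h3
    exact ⟨-(b + e), by rwa [neg_neg]⟩
  have huniq : ∀ d e e', cpx d (-e) ∈ D → cpx d (-e') ∈ D → e = e' := by
    intro d e e' h1 h2
    have h3 := D.sub_mem h1 h2
    rw [cpx_sub, sub_self] at h3
    have h4 := D.neg_mem h3
    rw [cpx_neg, neg_zero] at h4
    have h5 := (hbar _ _ h3 h4).2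
    rw [neg_sub_neg, sub_eq_zero] at h5
    exact h5.symm
  choose j hj using hex
  let J : W × (W →L[ℝ] ℝ) →ₗ[ℝ] W × (W →L[ℝ] ℝ) :=
    { toFun := j
      map_add' := fun x y => huniq _ _ _ (hj _) (by
        have := D.add_mem (hj x) (hj y)
        rwa [cpx_add, ← neg_add] at this)
      map_smul' := fun r x => huniq _ _ _ (hj _) (by
        have := D.smul_mem (r : ℂ) (hj x)
        rwa [real_smul_cpx, smul_neg] at this) }
  -- Multiplication by `i` turns `u - iJu` into `Ju + iu`, which stays in `D`.
  have hJ : ∀ u, J (J u) = -u := fun u => huniq (j u) _ _ (hj _) (by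
    have := D.smul_mem Complex.I (hj u)
    rw [I_smul_cpx, neg_neg] at this
    rwa [neg_neg])
  refine ⟨J, hJ, fun u v => ?_, ?_⟩
  · have := (cpair_cpx_eq_zero.1 ((hD _).1 (hj u) _ (hj v))).1
    rw [pair_neg_left, pair_neg_right, neg_neg] at this
    exact this.symm
  · ext z
    obtain ⟨a, b, rfl⟩ := exists_cpx z
    rw [mem_iEigenspace hJ]
    constructor
    · intro h
      have := huniq a (-b) (j a) (by rwa [neg_neg]) (hj a)
      rw [← neg_neg b, this]; rfl
    · rintro rfl; exact hj a

variable {E : Submodule ℂ (ℂ ⊗[ℝ] V)} {ε : E [⋀^Fin 2]→ₗ[ℂ] ℂ}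

/-- Conditions 1 and 4 together say precisely that `L(E, ε)` contains the kernel of `P`. -/
lemma LinearGCPair.vertical_mem (h : LinearGCPair P E ε) {v : V} (hv : P v = 0) :
    cpx ((v, 0) : V × (V →L[ℝ] ℝ)) 0 ∈ diracSpace E ε := by
  have h0 : vecPart (cpx ((v, 0) : V × (V →L[ℝ] ℝ)) 0) = (1 : ℂ) ⊗ₜ[ℝ] v :=
    (vecPart_cpx _ _).trans (one_tmul_eq_cpx v).symm
  have h1 := h.ker_le v hv
  refine ⟨by rw [h0]; exact h1, fun Y => ?_⟩
  rw [alt_congr_left ε (x' := ⟨_, h1⟩) h0 Y, h.vanish v hv]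
  obtain ⟨c, d, hY⟩ := exists_cpx (Y : ℂ ⊗[ℝ] V)
  rw [hY, covecPart_cpx]
  simp

lemma LinearGCPair.vertical_mem' (h : LinearGCPair P E ε) {v w : V} (hv : P v = 0) (hw : P w = 0) :
    cpx ((v, 0) : V × (V →L[ℝ] ℝ)) (w, 0) ∈ diracSubmodule E ε := by
  have h1 := (diracSubmodule E ε).add_mem (h.vertical_mem hv)
    ((diracSubmodule E ε).smul_mem Complex.I (h.vertical_mem hw))
  rw [I_smul_cpx, cpx_add] at h1
  simpa using h1

/-- Every linear GC-pair comes from a linear generalized complex structure. -/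
lemma LinearGCPair.exists_complexStructure (hP : Function.Surjective P)
    (h : LinearGCPair P E ε) :
    ∃ J : W × (W →L[ℝ] ℝ) →ₗ[ℝ] W × (W →L[ℝ] ℝ), (∀ u, J (J u) = -u) ∧
      (∀ u v, pair (J u) (J v) = pair u v) ∧
      diracPullback P (iEigenspace J) = diracSubmodule E ε := by
  set L := diracSubmodule E ε with hLdef
  have hL : IsLagrangian L := isLagrangian_diracSubmodule
  -- The pushforward of `L` along `P`, which is to be the eigenspace.
  let D : Submodule ℂ (ℂ ⊗[ℝ] (W × (W →L[ℝ] ℝ))) :=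
    { carrier := {z | ∃ w₁ w₂ d₁ d₂, z = cpx d₁ d₂ ∧ cpx w₁ w₂ ∈ L ∧ Rel P w₁ d₁ ∧ Rel P w₂ d₂}
      add_mem' := by
        rintro _ _ ⟨w₁, w₂, d₁, d₂, rfl, h1, h2, h3⟩ ⟨w₁', w₂', d₁', d₂', rfl, h1', h2', h3'⟩
        exact ⟨_, _, _, _, cpx_add _ _ _ _, by rw [← cpx_add]; exact L.add_mem h1 h1',
          h2.add h2', h3.add h3'⟩
      zero_mem' := ⟨0, 0, 0, 0, cpx_zero_zero.symm, by rw [cpx_zero_zero]; exact L.zero_mem,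
        ⟨by simp, by ext; simp⟩, ⟨by simp, by ext; simp⟩⟩
      smul_mem' := by
        rintro c _ ⟨w₁, w₂, d₁, d₂, rfl, h1, h2, h3⟩
        exact ⟨_, _, _, _, smul_cpx _ _ _, by rw [← smul_cpx]; exact L.smul_mem c h1,
          (h2.smul _).sub (h3.smul _), (h3.smul _).add (h2.smul _)⟩ }
  have hmemD : ∀ d₁ d₂, cpx d₁ d₂ ∈ D ↔ ∃ w₁ w₂, cpx w₁ w₂ ∈ L ∧ Rel P w₁ d₁ ∧ Rel P w₂ d₂ := by
    intro d₁ d₂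
    constructor
    · rintro ⟨w₁, w₂, d₁', d₂', h0, h1, h2, h3⟩
      obtain ⟨rfl, rfl⟩ := cpx_inj.1 h0
      exact ⟨w₁, w₂, h1, h2, h3⟩
    · rintro ⟨w₁, w₂, h1, h2, h3⟩
      exact ⟨w₁, w₂, d₁, d₂, rfl, h1, h2, h3⟩
  have hrel : ∀ {w₁ w₂}, cpx w₁ w₂ ∈ L → ∃ d₁ d₂, Rel P w₁ d₁ ∧ Rel P w₂ d₂ := by
    intro w₁ w₂ hw
    have hv : ∀ v, P v = 0 → w₁.2 v = 0 ∧ w₂.2 v = 0 := by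
      intro v hv
      have h2 := cpair_cpx_eq_zero.1 ((hL _).1 hw _ (h.vertical_mem hv))
      simp [pair] at h2
      exact ⟨h2.1, h2.2⟩
    obtain ⟨d₁, h1⟩ := exists_rel_of_vanish hP fun v hP => (hv v hP).1
    obtain ⟨d₂, h2⟩ := exists_rel_of_vanish hP fun v hP => (hv v hP).2
    exact ⟨d₁, d₂, h1, h2⟩
  -- Two lifts of the same element differ by vertical vectors, and these lie in `L`; so `L` is the
  -- full pullback of `D`.
  have hlift : ∀ {w₁ w₂ d₁ d₂}, cpx d₁ d₂ ∈ D → Rel P w₁ d₁ → Rel P w₂ d₂ → cpx w₁ w₂ ∈ L := by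
    intro w₁ w₂ d₁ d₂ hd h1 h2
    obtain ⟨w₁', w₂', h3, h4, h5⟩ := (hmemD _ _).1 hd
    obtain ⟨v₁, h6, rfl⟩ := h1.sub_eq_vertical h4
    obtain ⟨v₂, h7, rfl⟩ := h2.sub_eq_vertical h5
    rw [← cpx_add]
    exact L.add_mem h3 (h.vertical_mem' h6 h7)
  have hD : IsLagrangian D := by
    intro z
    obtain ⟨d₁, d₂, rfl⟩ := exists_cpx z
    constructor
    · intro hd y hy
      obtain ⟨e₁, e₂, rfl⟩ := exists_cpx y
      obtain ⟨w₁, w₂, h1, h2, h3⟩ := (hmemD _ _).1 hd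
      obtain ⟨z₁, z₂, h4, h5, h6⟩ := (hmemD _ _).1 hy
      have h7 := (hL _).1 h1 _ h4
      rw [cpair_cpx_eq_zero] at h7 ⊢
      rwa [h2.pair_eq h5, h2.pair_eq h6, h3.pair_eq h5, h3.pair_eq h6] at h7
    · intro hd
      obtain ⟨w₁, r1⟩ := exists_rel hP d₁
      obtain ⟨w₂, r2⟩ := exists_rel hP d₂
      refine (hmemD _ _).2 ⟨w₁, w₂, (hL _).2 fun y hy => ?_, r1, r2⟩
      obtain ⟨z₁, z₂, rfl⟩ := exists_cpx y
      obtain ⟨e₁, e₂, s1, s2⟩ := hrel hy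
      have h7 := hd _ ((hmemD _ _).2 ⟨z₁, z₂, hy, s1, s2⟩)
      rw [cpair_cpx_eq_zero] at h7 ⊢
      rwa [r1.pair_eq s1, r1.pair_eq s2, r2.pair_eq s1, r2.pair_eq s2]
  have hbar : ∀ a b, cpx a b ∈ D → cpx a (-b) ∈ D → a = 0 ∧ b = 0 := by
    intro a b h1 h2
    obtain ⟨w₁, r1⟩ := exists_rel hP a
    obtain ⟨w₂, r2⟩ := exists_rel hP b
    have hw : cpx w₁ w₂ ∈ diracSpace E ε := hlift h1 r1 r2
    have hw' : cpx w₁ (-w₂) ∈ diracSpace E ε := hlift h2 r1 r2.neg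
    obtain ⟨k1, k2⟩ := hw
    obtain ⟨k3, k4⟩ := hw'
    have hc : conj (vecPart (cpx w₁ w₂)) = vecPart (cpx w₁ (-w₂)) := by
      rw [vecPart_cpx, vecPart_cpx, conj_cpx]; rfl
    have hX : conj (vecPart (cpx w₁ w₂)) ∈ E := by rw [hc]; exact k3
    -- With a lift and its conjugate both in `L`, condition 5 makes the vector part vertical.
    -- Condition 4 then makes the covector vanish on `E` and on `Ē`, hence everywhere by condition
    -- 2, and a vertical vector with zero covector descends to zero.
    obtain ⟨x₁, x₂, e0, e1, e2⟩ := h.nondegenerate ⟨_, k1⟩ hX (by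
      intro Y hY
      have e3 : ε ![⟨conj (vecPart (cpx w₁ w₂)), hX⟩, ⟨conj Y.1, hY⟩] = _ :=
        (alt_congr_left ε (x' := ⟨_, k3⟩) hc _).trans (k4 ⟨conj Y.1, hY⟩).symm
      rw [e3, ← k2 Y]
      simp only
      rw [covecPart_conj, Complex.conj_conj, sub_self])
    simp only [vecPart_cpx] at e0
    obtain ⟨rfl, rfl⟩ := cpx_inj.1 e0
    have f1 : ∀ y ∈ E, covecPart (cpx w₁ w₂) y = 0 := by
      intro y hy
      have hker1 := h.ker_le _ e1
      have hker2 := h.ker_le _ e2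
      have g1 := k2 ⟨y, hy⟩
      have g2 : (⟨vecPart (cpx w₁ w₂), k1⟩ : E) =
          (⟨_, hker1⟩ : E) + Complex.I • (⟨_, hker2⟩ : E) := by
        apply Subtype.ext
        have : vecPart (cpx w₁ w₂) = (1 : ℂ) ⊗ₜ[ℝ] w₁.1 + Complex.I • ((1 : ℂ) ⊗ₜ[ℝ] w₂.1) := by
          rw [vecPart_cpx, one_tmul_eq_cpx, one_tmul_eq_cpx, I_smul_cpx, cpx_add]; simp
        exact this
      rw [g2, alt_add_left, alt_smul_left, h.vanish _ e1, h.vanish _ e2] at g1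
      simpa using g1
    have f2 : ∀ y ∈ E, covecPart (cpx w₁ (-w₂)) y = 0 := by
      intro y hy
      have hker1 := h.ker_le _ e1
      have hker2 := h.ker_le _ e2
      have g1 := k4 ⟨y, hy⟩
      have g2 : (⟨vecPart (cpx w₁ (-w₂)), k3⟩ : E) =
          (⟨_, hker1⟩ : E) + (-Complex.I) • (⟨_, hker2⟩ : E) := by
        apply Subtype.ext
        have : vecPart (cpx w₁ (-w₂)) =
            (1 : ℂ) ⊗ₜ[ℝ] w₁.1 + (-Complex.I) • ((1 : ℂ) ⊗ₜ[ℝ] w₂.1) := by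
          rw [vecPart_cpx, one_tmul_eq_cpx, one_tmul_eq_cpx, neg_smul, I_smul_cpx, cpx_neg, cpx_add]
          simp
        exact this
      rw [g2, alt_add_left, alt_smul_left, h.vanish _ e1, h.vanish _ e2] at g1
      simpa using g1
    have f3 : covecPart (cpx w₁ w₂) = 0 := by
      apply LinearMap.ext
      intro z
      have hz : z ∈ E ⊔ E.map conj := by rw [h.sup_conj]; trivial
      obtain ⟨y, hy, _, ⟨x, hx, rfl⟩, rfl⟩ := Submodule.mem_sup.1 hz
      have g := covecPart_conj w₁ (-w₂) x
      rw [neg_neg, f2 x hx, map_zero] at g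
      rw [map_add, f1 y hy, zero_add]
      exact g
    have f4 : cpx w₁ w₂ = cpx (w₁.1, 0) (w₂.1, 0) := by
      refine ext_vecPart_covecPart (by rw [vecPart_cpx, vecPart_cpx]) ?_
      rw [f3]
      apply LinearMap.ext
      intro z
      obtain ⟨c, d, rfl⟩ := exists_cpx z
      rw [covecPart_cpx]
      simp
    obtain ⟨f5, f6⟩ := cpx_inj.1 f4
    rw [f5] at r1
    rw [f6] at r2
    exact ⟨r1.unique hP (rel_vertical e1), r2.unique hP (rel_vertical e2)⟩
  obtain ⟨J, j1, j2, j3⟩ := hD.exists_complexStructure hbar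
  refine ⟨J, j1, j2, ?_⟩
  rw [← j3]
  ext z
  obtain ⟨w₁, w₂, rfl⟩ := exists_cpx z
  rw [mem_diracPullback]
  constructor
  · rintro ⟨d₁, d₂, h1, h2, h3⟩
    exact hlift h3 h1 h2
  · intro hw
    obtain ⟨d₁, d₂, h1, h2⟩ := hrel hw
    exact ⟨d₁, d₂, h1, h2, (hmemD _ _).2 ⟨_, _, hw, h1, h2⟩⟩

end FromPair

/-! ### Invariant subspaces of linear differential equations. -/

section ODE
/-- A solution of a linear differential equation that starts in an invariant subspace stays in
it. -/
lemma mem_of_linearODE {U : Type*} [NormedAddCommGroup U] [NormedSpace ℝ U] [FiniteDimensional ℝ U]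
    (S : Submodule ℝ U) {B : ℝ → U →L[ℝ] U} (hB : Continuous B) (hS : ∀ t, ∀ u ∈ S, B t u ∈ S)
    {y : ℝ → U} (hy : ∀ t, HasDerivAt y (B t (y t)) t) (h0 : y 0 ∈ S) {T : ℝ} (hT : 0 ≤ T) :
    y T ∈ S := by
  -- `p` is a projection with kernel `S`. Since `B` preserves `S`, the function `p y` satisfies the
  -- closed linear equation `(p y)' = p B (p y)` with zero initial value, and a Grönwall estimate
  -- keeps it zero.
  obtain ⟨q, hq⟩ := S.subtype.exists_leftInverse_of_injective S.ker_subtype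
  let p : U →L[ℝ] U := LinearMap.toContinuousLinearMap (LinearMap.id - S.subtype ∘ₗ q)
  have hp : ∀ u, p u = u - q u := fun _ => rfl
  have hpS : ∀ u ∈ S, p u = 0 := by
    intro u hu
    have : q u = ⟨u, hu⟩ := congrArg (fun f => f ⟨u, hu⟩) hq
    rw [hp, this, sub_self]
  have hpS' : ∀ u, p u = 0 → u ∈ S := by
    intro u hu
    rw [hp, sub_eq_zero] at hu
    rw [hu]; exact (q u).2
  have hz : ∀ t, HasDerivAt (fun t => p (y t)) (p (B t (p (y t)))) t := by
    intro t
    have h1 := p.hasFDerivAt.comp_hasDerivAt t (hy t)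
    convert! h1 using 1
    have h2 : p (B t (y t - p (y t))) = 0 := hpS _ (hS t _ (by rw [hp, sub_sub_cancel]; exact (q _).2))
    rw [map_sub, map_sub, sub_eq_zero] at h2
    exact h2.symm
  obtain ⟨C, hC⟩ := (isCompact_Icc (a := (0 : ℝ)) (b := T)).exists_bound_of_continuousOn
    (f := fun t => p.comp (B t)) (by fun_prop)
  apply hpS'
  refine eq_zero_of_abs_deriv_le_mul_abs_self_of_eq_zero_right (f := fun t => p (y t))
    (f' := fun t => p (B t (p (y t)))) (K := C) (a := 0) (b := T)
    (fun t _ => (hz t).continuousAt.continuousWithinAt) (fun t _ => (hz t).hasDerivWithinAt)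
    (hpS _ h0) (fun t ht => ?_) T ⟨hT, le_rfl⟩
  exact (ContinuousLinearMap.le_opNorm (p.comp (B t)) _).trans
    (mul_le_mul_of_nonneg_right (hC t ⟨ht.1, ht.2.le⟩) (norm_nonneg _))
end ODE

/-! ### The Lie bracket on the model space and its complexification. -/

section Bracket
variable {V : Type*} [NormedAddCommGroup V] [NormedSpace ℝ V] [FiniteDimensional ℝ V] [CompleteSpace V]
  {G : Type*} [Group G] [TopologicalSpace G] [ChartedSpace V G] [LieGroup 𝓘(ℝ, V) ∞ G]

variable (G) in
/-- The Lie bracket as a continuous bilinear map on the model space. -/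
def lieBL : V →L[ℝ] V →L[ℝ] V :=
  LinearMap.toContinuousLinearMap (LinearMap.toContinuousLinearMap.toLinearMap ∘ₗ
    LinearMap.mk₂ ℝ (lieB (V := V) (G := G))
      (fun a b c => add_lie (L := GroupLieAlgebra 𝓘(ℝ, V) G) (M := GroupLieAlgebra 𝓘(ℝ, V) G) a b c)
      (fun r a b => smul_lie (R := ℝ) (L := GroupLieAlgebra 𝓘(ℝ, V) G)
        (M := GroupLieAlgebra 𝓘(ℝ, V) G) r a b)
      (fun a b c => lie_add (L := GroupLieAlgebra 𝓘(ℝ, V) G) (M := GroupLieAlgebra 𝓘(ℝ, V) G) a b c)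
      (fun r a b => lie_smul (R := ℝ) (L := GroupLieAlgebra 𝓘(ℝ, V) G)
        (M := GroupLieAlgebra 𝓘(ℝ, V) G) r a b))

lemma lieBL_apply (a b : V) : lieBL G a b = lieB (G := G) a b := rfl

lemma lieB_swap (a b : V) : lieB (G := G) a b = - lieB (G := G) b a :=
  (lie_skew (L := GroupLieAlgebra 𝓘(ℝ, V) G) a b).symm

variable (G) in
/-- The complexified Lie bracket on the model space. -/
def clie (x y : ℂ ⊗[ℝ] V) : ℂ ⊗[ℝ] V :=
  (Bracket.bracket (show ℂ ⊗[ℝ] GroupLieAlgebra 𝓘(ℝ, V) G from x)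
    (show ℂ ⊗[ℝ] GroupLieAlgebra 𝓘(ℝ, V) G from y) : ℂ ⊗[ℝ] GroupLieAlgebra 𝓘(ℝ, V) G)

lemma clie_tmul (s t : ℂ) (x y : V) :
    clie G (s ⊗ₜ[ℝ] x) (t ⊗ₜ[ℝ] y) = (s * t) ⊗ₜ[ℝ] lieB (G := G) x y :=
  LieAlgebra.ExtendScalars.bracket_tmul ℝ ℂ (GroupLieAlgebra 𝓘(ℝ, V) G)
    (GroupLieAlgebra 𝓘(ℝ, V) G) s t x y

lemma clie_cpx (a b c d : V) : clie G (cpx a b) (cpx c d) =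
    cpx (lieB (G := G) a c - lieB (G := G) b d) (lieB (G := G) a d + lieB (G := G) b c) := by
  have h1 : ∀ x y z : ℂ ⊗[ℝ] V, clie G (x + y) z = clie G x z + clie G y z := fun x y z =>
    add_lie (L := ℂ ⊗[ℝ] GroupLieAlgebra 𝓘(ℝ, V) G) (M := ℂ ⊗[ℝ] GroupLieAlgebra 𝓘(ℝ, V) G) x y z
  have h2 : ∀ x y z : ℂ ⊗[ℝ] V, clie G x (y + z) = clie G x y + clie G x z := fun x y z =>
    lie_add (L := ℂ ⊗[ℝ] GroupLieAlgebra 𝓘(ℝ, V) G) (M := ℂ ⊗[ℝ] GroupLieAlgebra 𝓘(ℝ, V) G) x y z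
  simp only [cpx, h1, h2, clie_tmul, mul_one, one_mul, Complex.I_mul_I, TensorProduct.tmul_add,
    TensorProduct.tmul_sub, TensorProduct.neg_tmul]
  abel

end Bracket

/-! ### Integrating infinitesimal invariance along curves in the stabilizer. -/

section Invariance
variable {V : Type*} [NormedAddCommGroup V] [NormedSpace ℝ V] [FiniteDimensional ℝ V] [CompleteSpace V]
  {W : Type*} [NormedAddCommGroup W] [NormedSpace ℝ W]
  {G : Type*} [Group G] [TopologicalSpace G] [ChartedSpace V G] [LieGroup 𝓘(ℝ, V) ∞ G]
  {M : Type*} [TopologicalSpace M] [ChartedSpace W M] [IsManifold 𝓘(ℝ, W) ∞ M] [MulAction G M]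

omit [FiniteDimensional ℝ V] [CompleteSpace V] in
/-- The logarithmic derivative of a curve in `G`. -/
lemma exists_logDeriv {c : ℝ → G} (hc : ContMDiff 𝓘(ℝ, ℝ) 𝓘(ℝ, V) ∞ c) :
    ∃ X : ℝ → V, Continuous X ∧
      ∀ t, (mfderiv 𝓘(ℝ, ℝ) 𝓘(ℝ, V) c t (1 : ℝ) : V) = leftField (fun _ : G => X t) (c t) := by
  let X : ℝ → V := fun t => dsmul V (c t)⁻¹ (c t) (mfderiv 𝓘(ℝ, ℝ) 𝓘(ℝ, V) c t (1 : ℝ))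
  refine ⟨X, ?_, fun t => ?_⟩
  · have h1 : ContMDiff 𝓘(ℝ, ℝ).tangent 𝓘(ℝ, V).tangent ∞ (tangentMap 𝓘(ℝ, ℝ) 𝓘(ℝ, V) c) :=
      ContMDiff.contMDiff_tangentMap hc (m := ∞) (by simp)
    have h2 : ContMDiff 𝓘(ℝ, ℝ) 𝓘(ℝ, ℝ).tangent ∞ (fun t : ℝ => (⟨t, (1 : ℝ)⟩ : TangentBundle 𝓘(ℝ, ℝ) ℝ)) :=
      fun t => smoothFieldAt_iff.2 (by
        have : (fun y : ℝ => (mfderiv 𝓘(ℝ, ℝ) 𝓘(ℝ, ℝ) (extChartAt 𝓘(ℝ, ℝ) t) y (1 : ℝ) : ℝ)) =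
            fun _ => (1 : ℝ) := by
          funext y
          rw [extChartAt_model_space_eq_id]
          exact congrArg (fun L : ℝ →L[ℝ] ℝ => L 1) (mfderiv_id (I := 𝓘(ℝ, ℝ)) (x := y))
        rw [this]
        exact contMDiffAt_const)
    have h3 := h1.comp h2
    have h4 : ContMDiff 𝓘(ℝ, ℝ) 𝓘(ℝ, V) ∞ X := by
      intro t
      have hi : ContMDiffAt 𝓘(ℝ, ℝ) 𝓘(ℝ, V) ∞ (fun t => (c t)⁻¹) t := hc.inv.contMDiffAt
      have h5 := contMDiffAt_partial_tangent (smoothAction_self V G) hi (h3.contMDiffAt (x := t))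
      refine (contMDiffAt_tangent_const_iff (o := (1 : G))).1
        (h5.congr_of_eventuallyEq (Eventually.of_forall fun s => ?_))
      exact tangent_mk_congr (inv_mul_cancel (c s)).symm _
    exact h4.continuous
  · have := dsmul_dsmul_inv (smoothAction_self V G) (c t) (1 : G)
      (mfderiv 𝓘(ℝ, ℝ) 𝓘(ℝ, V) c t (1 : ℝ))
    rw [smul_eq_mul, mul_one] at this
    exact this.symm

/-- The equation satisfied by `Ad(c(t)⁻¹) Y`. -/
lemma hasDerivAt_adInv {c : ℝ → G} (hc : ContMDiff 𝓘(ℝ, ℝ) 𝓘(ℝ, V) ∞ c) {X : ℝ → V}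
    (hX : ∀ t, (mfderiv 𝓘(ℝ, ℝ) 𝓘(ℝ, V) c t (1 : ℝ) : V) = leftField (fun _ : G => X t) (c t))
    (Y : V) (t : ℝ) :
    HasDerivAt (fun t => adInv (c t) Y) (- lieBL G (X t) (adInv (c t) Y)) t := by
  have h1 : ContMDiffAt 𝓘(ℝ, ℝ) 𝓘(ℝ, V) ∞ (fun t => adInv (c t) Y) t :=
    ContMDiffAt.comp t (contMDiffAt_adInv Y (c t)) hc.contMDiffAt
  have h2 : DifferentiableAt ℝ (fun t => adInv (c t) Y) t :=
    h1.contDiffAt.differentiableAt (by simp)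
  have h3 := along_comp (contMDiffAt_adInv Y (c t) |>.mdifferentiableAt (by simp))
    (hc.mdifferentiableAt (x := t) (by simp)) (1 : ℝ)
  have h4 := (h3.trans (congrArg (along (fun g : G => adInv g Y) (c t)) (hX t))).trans
    (along_adInv (X t) Y (c t))
  have h5 := (along_eq_fderiv_vec (fun t => adInv (c t) Y) t (1 : ℝ)).symm.trans h4
  have h6 := h2.hasDerivAt
  rw [← fderiv_apply_one_eq_deriv, h5] at h6
  exact h6

/-- A GC-pair, in terms of the model space. -/
structure LieGCPair (G : Type*) [Group G] [TopologicalSpace G] [ChartedSpace V G]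
    [LieGroup 𝓘(ℝ, V) ∞ G] (P : V →L[ℝ] W) (E : Submodule ℂ (ℂ ⊗[ℝ] V)) (ε : E [⋀^Fin 2]→ₗ[ℂ] ℂ) :
    Prop extends LinearGCPair P E ε where
  lie_mem : ∀ x ∈ E, ∀ y ∈ E, clie G x y ∈ E
  closed : ∀ X Y Z : E, ε ![X, ⟨clie G Y.1 Z.1, lie_mem _ Y.2 _ Z.2⟩]
    + ε ![Y, ⟨clie G Z.1 X.1, lie_mem _ Z.2 _ X.2⟩]
    + ε ![Z, ⟨clie G X.1 Y.1, lie_mem _ X.2 _ Y.2⟩] = 0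

/-- `Ad(g⁻¹)` on the complexified Lie algebra. -/
def cadInv (g : G) : ℂ ⊗[ℝ] V →ₗ[ℂ] ℂ ⊗[ℝ] V := (adInv (V := V) g).toLinearMap.baseChange ℂ

omit [FiniteDimensional ℝ V] [CompleteSpace V] in
lemma cadInv_cpx (g : G) (a b : V) : cadInv g (cpx a b) = cpx (adInv g a) (adInv g b) :=
  baseChange_cpx _ a b

omit [FiniteDimensional ℝ V] [CompleteSpace V] in
lemma cadInv_mul (g k : G) (x : ℂ ⊗[ℝ] V) : cadInv (g * k) x = cadInv k (cadInv g x) := by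
  obtain ⟨a, b, rfl⟩ := exists_cpx x
  simp only [cadInv_cpx, adInv_mul]

omit [FiniteDimensional ℝ V] [CompleteSpace V] in
lemma cadInv_one (x : ℂ ⊗[ℝ] V) : cadInv (1 : G) x = x := by
  obtain ⟨a, b, rfl⟩ := exists_cpx x
  simp only [cadInv_cpx, adInv_one]

/-- `Ad(g⁻¹)` preserves `(E, ε)`. -/
def Preserves (E : Submodule ℂ (ℂ ⊗[ℝ] V)) (ε : E [⋀^Fin 2]→ₗ[ℂ] ℂ) (g : G) : Prop :=
  ∃ h : ∀ x ∈ E, cadInv g x ∈ E, ∀ x y : E,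
    ε ![⟨cadInv g x.1, h _ x.2⟩, ⟨cadInv g y.1, h _ y.2⟩] = ε ![x, y]

variable {P : V →L[ℝ] W} {E : Submodule ℂ (ℂ ⊗[ℝ] V)} {ε : E [⋀^Fin 2]→ₗ[ℂ] ℂ}

/-- `(E, ε)` is preserved along curves tangent to the stabilizer. -/
lemma LieGCPair.preserves_of_curve (h : LieGCPair G P E ε) {c : ℝ → G}
    (hc : ContMDiff 𝓘(ℝ, ℝ) 𝓘(ℝ, V) ∞ c) (hc0 : c 0 = 1) {X : ℝ → V} (hXc : Continuous X)
    (hX : ∀ t, (mfderiv 𝓘(ℝ, ℝ) 𝓘(ℝ, V) c t (1 : ℝ) : V) = leftField (fun _ : G => X t) (c t))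
    (hXP : ∀ t, P (X t) = 0) : Preserves E ε (c 1) := by
  have hmem : ∀ x ∈ E, ∀ t, 0 ≤ t → cadInv (c t) x ∈ E := by
    intro x hx t ht
    obtain ⟨a, b, rfl⟩ := exists_cpx x
    let S : Submodule ℝ (V × V) := (E.restrictScalars ℝ).comap cpxL
    have hS : ∀ p : V × V, p ∈ S ↔ cpx p.1 p.2 ∈ E := fun _ => Iff.rfl
    -- `-ad X(t)` acting on real and imaginary parts. It preserves `E` because `X(t)` lies in `𝔨 ⊂
    -- E` and `E` is a subalgebra.
    let B : ℝ → V × V →L[ℝ] V × V := fun t => - (lieBL G (X t)).prodMap (lieBL G (X t))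
    have hB : Continuous B := by
      have h1 : Continuous fun t => lieBL G (X t) := (lieBL G).continuous.comp hXc
      have h2 : Continuous fun L : V →L[ℝ] V => L.prodMap L :=
        (ContinuousLinearMap.prodMapL ℝ V V V V).continuous.comp (continuous_id.prodMk continuous_id)
      exact (h2.comp h1).neg
    have hBS : ∀ t, ∀ u ∈ S, B t u ∈ S := by
      intro t u hu
      have h1 := h.lie_mem _ (h.ker_le _ (hXP t)) _ ((hS u).1 hu)
      rw [one_tmul_eq_cpx, clie_cpx] at h1
      have h2 := E.neg_mem h1
      rw [cpx_neg] at h2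
      rw [hS]
      have e : ∀ v : V, lieB (G := G) 0 v = 0 := fun v => by
        rw [← lieBL_apply, map_zero]; rfl
      rw [e, e, sub_zero, add_zero] at h2
      exact h2
    have h3 := mem_of_linearODE S hB hBS (y := fun t => (adInv (c t) a, adInv (c t) b))
      (fun t => by
        have := (hasDerivAt_adInv hc hX a t).prodMk (hasDerivAt_adInv hc hX b t)
        exact this) (by
        rw [hS]
        simp only [hc0, adInv_one]
        exact hx) ht
    rw [cadInv_cpx]
    exact (hS _).1 h3
  refine ⟨fun x hx => hmem x hx 1 zero_le_one, fun x y => ?_⟩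
  -- A linear retraction onto `E` extends `ε` to the whole space, so that it can be differentiated
  -- along curves without carrying membership proofs.
  obtain ⟨q, hq⟩ := E.subtype.exists_leftInverse_of_injective E.ker_subtype
  have hqE : ∀ z (hz : z ∈ E), q z = ⟨z, hz⟩ := fun z hz => congrArg (fun f => f ⟨z, hz⟩) hq
  let β : (V × V) →ₗ[ℝ] (V × V) →ₗ[ℝ] ℂ := LinearMap.mk₂ ℝ
    (fun u v => altBil ε (q (cpxL u)) (q (cpxL v)))
    (fun a b c => by simp) (fun r a b => by
      have : q (cpxL (r • a)) = (r : ℂ) • q (cpxL a) := by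
        rw [← map_smul]
        exact congrArg q (real_smul_cpx _ _ _).symm
      rw [this]; simp)
    (fun a b c => by simp) (fun r a b => by
      have : q (cpxL (r • b)) = (r : ℂ) • q (cpxL b) := by
        rw [← map_smul]
        exact congrArg q (real_smul_cpx _ _ _).symm
      rw [this]; simp)
  let βL : (V × V) →L[ℝ] (V × V) →L[ℝ] ℂ :=
    LinearMap.toContinuousLinearMap (LinearMap.toContinuousLinearMap.toLinearMap ∘ₗ β)
  have hβ : ∀ u v : V × V, βL u v = altBil ε (q (cpx u.1 u.2)) (q (cpx v.1 v.2)) := fun _ _ => rfl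
  obtain ⟨x, hx⟩ := x
  obtain ⟨y, hy⟩ := y
  obtain ⟨a, b, rfl⟩ := exists_cpx x
  obtain ⟨a', b', rfl⟩ := exists_cpx y
  let u : ℝ → V × V := fun t => (adInv (c t) a, adInv (c t) b)
  let v : ℝ → V × V := fun t => (adInv (c t) a', adInv (c t) b')
  let B : ℝ → V × V →L[ℝ] V × V := fun t => - (lieBL G (X t)).prodMap (lieBL G (X t))
  have hu : ∀ t, HasDerivAt u (B t (u t)) t := fun t =>
    (hasDerivAt_adInv hc hX a t).prodMk (hasDerivAt_adInv hc hX b t)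
  have hv : ∀ t, HasDerivAt v (B t (v t)) t := fun t =>
    (hasDerivAt_adInv hc hX a' t).prodMk (hasDerivAt_adInv hc hX b' t)
  have huE : ∀ t, 0 ≤ t → cpx (u t).1 (u t).2 ∈ E := fun t ht => by
    have := hmem _ hx t ht
    rwa [cadInv_cpx] at this
  have hvE : ∀ t, 0 ≤ t → cpx (v t).1 (v t).2 ∈ E := fun t ht => by
    have := hmem _ hy t ht
    rwa [cadInv_cpx] at this
  have hf : ∀ t, HasDerivAt (fun t => βL (u t) (v t)) (βL (u t) (B t (v t)) + βL (B t (u t)) (v t)) t :=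
    fun t => by
      have := (βL.hasFDerivAt.comp_hasDerivAt t (hu t)).clm_apply (hv t)
      convert! this using 1
      exact add_comm _ _
  have hBc : ∀ t (w : V × V), cpx (B t w).1 (B t w).2 = - clie G ((1 : ℂ) ⊗ₜ[ℝ] X t) (cpx w.1 w.2) := by
    intro t w
    have e : ∀ v : V, lieB (G := G) 0 v = 0 := fun v => by
      rw [← lieBL_apply, map_zero]; rfl
    rw [one_tmul_eq_cpx, clie_cpx, e, e, sub_zero, add_zero, cpx_neg]
    rfl
  have hskew : ∀ x y : ℂ ⊗[ℝ] V, clie G x y = - clie G y x := fun x y =>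
    (lie_skew (L := ℂ ⊗[ℝ] GroupLieAlgebra 𝓘(ℝ, V) G) x y).symm
  -- The derivative is `-ε(u, [X, v]) - ε([X, u], v)`. It vanishes by `d_E ε(X, u, v) = 0`, because
  -- the remaining term `ε(X, [u, v])` is zero by condition 4.
  have hzero : ∀ t, 0 ≤ t → βL (u t) (B t (v t)) + βL (B t (u t)) (v t) = 0 := by
    intro t ht
    have hXE := h.ker_le _ (hXP t)
    have k1 := huE t ht
    have k2 := hvE t ht
    have k3 := h.closed ⟨_, hXE⟩ ⟨_, k1⟩ ⟨_, k2⟩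
    rw [h.vanish _ (hXP t), zero_add] at k3
    have m1 := h.lie_mem _ hXE _ k1
    have m2 := h.lie_mem _ hXE _ k2
    rw [hβ, hβ, hBc, hBc, map_neg q, map_neg q, hqE _ k1, hqE _ k2, hqE _ m1, hqE _ m2, map_neg, map_neg,
      LinearMap.neg_apply, altBil_apply, altBil_apply]
    have n1 : (⟨clie G (cpx (v t).1 (v t).2) ((1 : ℂ) ⊗ₜ[ℝ] X t), h.lie_mem _ k2 _ hXE⟩ : E) =
      (-1 : ℂ) • ⟨_, m2⟩ := by
        exact Subtype.ext ((hskew _ _).trans (neg_one_smul ℂ _).symm)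
    rw [n1, alt_swap ε ⟨cpx (u t).1 (u t).2, k1⟩, alt_smul_left, alt_swap ε ⟨cpx (v t).1 (v t).2, k2⟩,
      alt_swap ε ⟨_, m2⟩] at k3
    rw [smul_eq_mul] at k3
    linear_combination k3
  have hconst : βL (u 1) (v 1) = βL (u 0) (v 0) := by
    refine constant_of_has_deriv_right_zero (f := fun t => βL (u t) (v t)) (a := 0) (b := 1)
      (fun t _ => (hf t).continuousAt.continuousWithinAt) (fun t ht => ?_) 1 ⟨zero_le_one, le_rfl⟩
    have := (hf t).hasDerivWithinAt (s := Ici t)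
    rwa [hzero t ht.1] at this
  rw [hβ, hβ, hqE _ (huE 1 zero_le_one), hqE _ (hvE 1 zero_le_one), hqE _ (huE 0 le_rfl),
    hqE _ (hvE 0 le_rfl)] at hconst
  have z1 : ∀ a : V, adInv (c 0) a = a := fun a => by rw [hc0, adInv_one]
  simp only [u, v, z1] at hconst
  simp only [cadInv_cpx]
  exact hconst

end Invariance

/-! ### Invariance under the connected stabilizer, and transport between fibres. -/

section Stabilizer
variable {V : Type*} [NormedAddCommGroup V] [NormedSpace ℝ V] [FiniteDimensional ℝ V] [CompleteSpace V]
  {W : Type*} [NormedAddCommGroup W] [NormedSpace ℝ W]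
  {G : Type*} [Group G] [TopologicalSpace G] [ChartedSpace V G] [LieGroup 𝓘(ℝ, V) ∞ G]
  {M : Type*} [TopologicalSpace M] [ChartedSpace W M] [IsManifold 𝓘(ℝ, W) ∞ M] [MulAction G M]
  {π : G → M} {E : Submodule ℂ (ℂ ⊗[ℝ] V)} {ε : E [⋀^Fin 2]→ₗ[ℂ] ℂ}

omit [FiniteDimensional ℝ V] [CompleteSpace V] in
lemma Preserves.mul {g k : G} (hg : Preserves E ε g) (hk : Preserves E ε k) :
    Preserves E ε (g * k) := by
  obtain ⟨g1, g2⟩ := hg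
  obtain ⟨k1, k2⟩ := hk
  refine ⟨fun x hx => by rw [cadInv_mul]; exact k1 _ (g1 _ hx), fun x y => ?_⟩
  simp only [cadInv_mul]
  rw [k2 ⟨_, g1 _ x.2⟩ ⟨_, g1 _ y.2⟩, g2]

omit [FiniteDimensional ℝ V] [CompleteSpace V] in
lemma HomogProj.smul_one (hp : HomogProj V W π) (g : G) : g • π 1 = π g := by
  rw [← hp.equivariant, mul_one]

/-- A GC-pair is preserved by the connected stabilizer. -/
lemma LieGCPair.preserves (hp : HomogProj V W π) (h : LieGCPair G (dproj V W π) E ε)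
    (hK : IsPreconnected {k : G | π k = π 1}) {k : G} (hk : π k = π 1) : Preserves E ε k := by
  have htop : IsTopologicalGroup G := topologicalGroup_of_lieGroup 𝓘(ℝ, V) ∞
  have hloc : ∀ᶠ k in 𝓝 (1 : G), π k = π 1 → Preserves E ε k := by
    filter_upwards [hp.exists_path] with k hk hk1
    obtain ⟨c, c0, c1, hc, hcπ⟩ := hk hk1
    obtain ⟨X, hXc, hX⟩ := exists_logDeriv hc
    rw [← c1]
    refine h.preserves_of_curve hc c0 hXc hX fun t => ?_
    -- The path stays in the fibre, so `0 = dl_{c(t)} (P X(t))`; the translation is invertible,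
    -- hence `X(t)` is vertical.
    have h1 := mfderiv_comp_flat (f := c) (h := π) (x := t) rfl
      (hp.smooth.mdifferentiableAt (by simp)) (hc.mdifferentiableAt (by simp)) (1 : ℝ)
    rw [mfderiv_const_flat (Eventually.of_forall hcπ), hX t] at h1
    have h2 : (0 : W) = dsmul W (c t) (π 1) (dproj V W π (X t)) :=
      h1.trans (hp.mfderiv_dsmul_one (c t) (X t))
    have h3 := dsmul_inv_dsmul hp.act (c t) (π 1) (dproj V W π (X t))
    rw [← h3, ← h2, map_zero]
  have hstab : ∀ {x y : G}, π x = π 1 → π y = π 1 → π (x⁻¹ * y) = π 1 := by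
    intro x y hx hy
    rw [hp.equivariant, hy]
    conv_lhs => rw [← hx]
    rw [← hp.equivariant, inv_mul_cancel]
  -- The relation "`x⁻¹ y` preserves the pair" is transitive and holds in both directions between
  -- nearby points of the fibre, so it holds throughout a connected fibre.
  have key := hK.induction₂' (fun x y => π x = π 1 → π y = π 1 → Preserves E ε (x⁻¹ * y))
    (fun x hx => ?_) ?_ (x := 1) (y := k) rfl hk rfl hk
  · rwa [inv_one, one_mul] at key
  · have t1 : Tendsto (fun y : G => x⁻¹ * y) (𝓝[{k : G | π k = π 1}] x) (𝓝 1) := by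
      have : Tendsto (fun y : G => x⁻¹ * y) (𝓝 x) (𝓝 (x⁻¹ * x)) :=
        (continuous_const.mul continuous_id).tendsto x
      rw [inv_mul_cancel] at this
      exact this.mono_left nhdsWithin_le_nhds
    have t2 : Tendsto (fun y : G => y⁻¹ * x) (𝓝[{k : G | π k = π 1}] x) (𝓝 1) := by
      have : Tendsto (fun y : G => y⁻¹ * x) (𝓝 x) (𝓝 (x⁻¹ * x)) :=
        (continuous_inv.mul continuous_const).tendsto x
      rw [inv_mul_cancel] at this
      exact this.mono_left nhdsWithin_le_nhds
    filter_upwards [t1.eventually hloc, t2.eventually hloc] with y h1 h2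
    exact ⟨fun hx hy => h1 (hstab hx hy), fun hy hx => h2 (hstab hy hx)⟩
  · intro x y z hx hy hz h1 h2 hx' hz'
    have := (h1 hx hy).mul (h2 hy hz)
    rwa [mul_assoc, mul_inv_cancel_left] at this

omit [FiniteDimensional ℝ V] [CompleteSpace V] in
-- Since `k` fixes the base point, `π(k⁻¹ x k) = k⁻¹ • π x`; differentiate at the identity.
lemma dproj_adInv (hp : HomogProj V W π) {k : G} (hk : π k = π 1) (v : V) :
    dproj V W π (adInv k v) = dsmul W k⁻¹ (π 1) (dproj V W π v) := by
  have h1 : (fun x : G => π (k⁻¹ * (x * k))) = fun x => k⁻¹ • π x := by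
    funext x
    rw [hp.equivariant, hp.equivariant, hk, hp.smul_one]
  have hd : MDifferentiableAt 𝓘(ℝ, V) 𝓘(ℝ, V) (fun x : G => k⁻¹ * (x * k)) 1 :=
    ((smooth_mul_left _).comp (smooth_mul_right _)).mdifferentiableAt (by simp)
  have h2 := mfderiv_comp_flat (f := fun x : G => k⁻¹ * (x * k)) (h := π) (x := 1) (y := 1) (by simp)
    (hp.smooth.mdifferentiableAt (by simp)) hd v
  have h3 := mfderiv_comp_flat (f := π) (h := fun x : M => k⁻¹ • x) (x := (1 : G)) rfl
    ((hp.act.smul_left k⁻¹).mdifferentiableAt (by simp)) (hp.smooth.mdifferentiableAt (by simp)) v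
  rw [h1] at h2
  exact h2.symm.trans h3

variable (π) in
/-- Transport of generalized tangent vectors from the base point to `π g`. -/
def push (g : G) : W × (W →L[ℝ] ℝ) →ₗ[ℝ] W × (W →L[ℝ] ℝ) where
  toFun d := (dsmul W g (π 1) d.1, d.2.comp (dsmul W g⁻¹ (π g)))
  map_add' _ _ := Prod.ext (map_add _ _ _) rfl
  map_smul' _ _ := Prod.ext (map_smul _ _ _) rfl

variable (π) in
/-- Transport of generalized tangent vectors from `π g` to the base point. -/
def pull (g : G) : W × (W →L[ℝ] ℝ) →ₗ[ℝ] W × (W →L[ℝ] ℝ) where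
  toFun d := (dsmul W g⁻¹ (π g) d.1, d.2.comp (dsmul W g (π 1)))
  map_add' _ _ := Prod.ext (map_add _ _ _) rfl
  map_smul' _ _ := Prod.ext (map_smul _ _ _) rfl

section
omit [FiniteDimensional ℝ V] [CompleteSpace V]
lemma HomogProj.dsmul_inv_dsmul (hp : HomogProj V W π) (g : G) (w : W) :
    dsmul W g⁻¹ (π g) (dsmul W g (π 1) w) = w := by
  have := GenCplx.dsmul_inv_dsmul hp.act g (π 1) w
  rwa [hp.smul_one] at this

lemma HomogProj.dsmul_dsmul_inv (hp : HomogProj V W π) (g : G) (w : W) :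
    dsmul W g (π 1) (dsmul W g⁻¹ (π g) w) = w := by
  have := GenCplx.dsmul_dsmul_inv hp.act g (π 1) w
  rwa [hp.smul_one] at this

lemma HomogProj.pull_push (hp : HomogProj V W π) (g : G) (d : W × (W →L[ℝ] ℝ)) :
    pull π g (push π g d) = d :=
  Prod.ext (hp.dsmul_inv_dsmul g d.1)
    (ContinuousLinearMap.ext fun w => congrArg d.2 (hp.dsmul_inv_dsmul g w))

lemma HomogProj.push_pull (hp : HomogProj V W π) (g : G) (d : W × (W →L[ℝ] ℝ)) :
    push π g (pull π g d) = d :=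
  Prod.ext (hp.dsmul_dsmul_inv g d.1)
    (ContinuousLinearMap.ext fun w => congrArg d.2 (hp.dsmul_dsmul_inv g w))

lemma HomogProj.pair_push (hp : HomogProj V W π) (g : G) (d e : W × (W →L[ℝ] ℝ)) :
    pair (push π g d) (push π g e) = pair d e :=
  congrArg₂ (fun a b => e.2 a + d.2 b) (hp.dsmul_inv_dsmul g d.1) (hp.dsmul_inv_dsmul g e.1)

/-- The action of `G` on the generalized tangent bundle in terms of `push`. -/
lemma HomogProj.translate_push (hp : HomogProj V W π) (h g : G) (d : W × (W →L[ℝ] ℝ)) :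
    (translate h (π g) (push π g d : W × (W →L[ℝ] ℝ)) : W × (W →L[ℝ] ℝ)) = push π (h * g) d := by
  have hx : h • π g = π (h * g) := (hp.equivariant h g).symm
  have hinv : (mfderiv 𝓘(ℝ, W) 𝓘(ℝ, W) (fun y : M => h • y) (π g)).inverse =
      (dsmul W h⁻¹ (h • π g) : W →L[ℝ] W) := by
    let e : W ≃L[ℝ] W := ContinuousLinearEquiv.equivOfInverse (dsmul W h (π g))
      (dsmul W h⁻¹ (h • π g)) (GenCplx.dsmul_inv_dsmul hp.act h (π g))
      (GenCplx.dsmul_dsmul_inv hp.act h (π g))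
    exact ContinuousLinearMap.inverse_equiv e
  refine Prod.ext ?_ (ContinuousLinearMap.ext fun w => ?_)
  · have := dsmul_mul hp.act h g (π 1) d.1
    rw [hp.smul_one] at this
    exact this.symm
  · have e1 := congrArg (fun L : W →L[ℝ] W => d.2 (dsmul W g⁻¹ (π g) (L w))) hinv
    refine Eq.trans e1 ?_
    have e2 := dsmul_mul hp.act g⁻¹ h⁻¹ (h • π g) w
    rw [inv_smul_smul, ← mul_inv_rev, hx] at e2
    exact congrArg d.2 (by rw [← hx] at e2 ⊢; exact e2.symm)
end

end Stabilizer

/-! ### Smoothness along maps and for operator-valued functions. -/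

section Smoothness
variable {V : Type*} [NormedAddCommGroup V] [NormedSpace ℝ V]
  {W : Type*} [NormedAddCommGroup W] [NormedSpace ℝ W]
  {F : Type*} [NormedAddCommGroup F] [NormedSpace ℝ F]
  {F' : Type*} [NormedAddCommGroup F'] [NormedSpace ℝ F']
  {E : Type*} [NormedAddCommGroup E] [NormedSpace ℝ E]
  {N : Type*} [TopologicalSpace N] [ChartedSpace E N]
  {M : Type*} [TopologicalSpace M] [ChartedSpace W M] [IsManifold 𝓘(ℝ, W) ∞ M]

lemma SmoothFormAt.apply_along {η : ∀ x : M, CotangentSpace W x} {f : N → M} {v : N → W} {n : N}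
    (hη : SmoothFormAt η (f n))
    (hv : ContMDiffAt 𝓘(ℝ, E) 𝓘(ℝ, W).tangent ∞ (fun m => (⟨f m, v m⟩ : TangentBundle 𝓘(ℝ, W) M)) n) :
    ContMDiffAt 𝓘(ℝ, E) 𝓘(ℝ, ℝ) ∞ (fun m => η (f m) (v m)) n := by
  obtain ⟨h1, h2⟩ := Bundle.contMDiffAt_totalSpace.1 hv
  have h1' : ContMDiffAt 𝓘(ℝ, E) 𝓘(ℝ, W) ∞ f n := h1
  have h3 : ContMDiffAt 𝓘(ℝ, E) 𝓘(ℝ, W →L[ℝ] ℝ) ∞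
      (fun m => formInChart η (f n) (extChartAt 𝓘(ℝ, W) (f n) (f m))) n :=
    ContMDiffAt.comp n (smoothFormAt_iff.1 hη) h1'
  refine (h3.clm_apply h2).congr_of_eventuallyEq ?_
  filter_upwards [h1'.continuousAt (chart_source_mem_nhds W (f n))] with m hm
  exact (form_apply_eq η hm (v m)).trans
    (congrArg (formInChart η (f n) (extChartAt 𝓘(ℝ, W) (f n) (f m)))
      (trivializationAt_snd hm (v m)).symm)

lemma contMDiffAt_clm_of_apply [FiniteDimensional ℝ F] {T : N → F →L[ℝ] F'} {x : N}
    (h : ∀ v, ContMDiffAt 𝓘(ℝ, E) 𝓘(ℝ, F') ∞ (fun y => T y v) x) :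
    ContMDiffAt 𝓘(ℝ, E) 𝓘(ℝ, F →L[ℝ] F') ∞ T x := by
  let b := Module.finBasis ℝ F
  let c : Fin (Module.finrank ℝ F) → F' →L[ℝ] F →L[ℝ] F' := fun i =>
    ContinuousLinearMap.smulRightL ℝ F F' (LinearMap.toContinuousLinearMap (b.coord i))
  have h2 : T = fun y => ∑ i, c i (T y (b i)) := by
    funext y
    ext v
    conv_lhs => rw [← b.sum_repr v, map_sum]
    simp only [map_smul, _root_.sum_apply]
    rfl
  rw [h2]
  exact ContMDiffAt.sum fun i _ => (c i).contMDiff.contMDiffAt.comp x (h (b i))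

omit [IsManifold 𝓘(ℝ, W) ∞ M] in
lemma along_clm_comp (L : F →L[ℝ] F') {h : M → F} {x : M}
    (hh : MDifferentiableAt 𝓘(ℝ, W) 𝓘(ℝ, F) h x) (v : TangentSpace 𝓘(ℝ, W) x) :
    along (fun y => L (h y)) x v = L (along h x v) := by
  have h1 := along_comp (h := fun u : F => L u) (f := h) (x := x)
    L.mdifferentiableAt hh v
  refine h1.trans ((along_eq_fderiv_vec (fun u : F => L u) (h x) _).trans ?_)
  exact congrArg (fun T : F →L[ℝ] F' => T (along h x v)) (L.fderiv (x := h x))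

/-- A section of the generalized tangent bundle is smooth at a point. -/
def SmoothSecAt (s : ∀ x : M, GenTangent W x) (x : M) : Prop :=
  SmoothFieldAt (fun y => (s y).1) x ∧ SmoothFormAt (fun y => (s y).2) x

end Smoothness

/-! ### The Courant bracket computed on the group. -/

section Courant
variable {V : Type*} [NormedAddCommGroup V] [NormedSpace ℝ V]
  {W : Type*} [NormedAddCommGroup W] [NormedSpace ℝ W]
  {G : Type*} [Group G] [TopologicalSpace G] [ChartedSpace V G] [LieGroup 𝓘(ℝ, V) ∞ G]
  {M : Type*} [TopologicalSpace M] [ChartedSpace W M] [IsManifold 𝓘(ℝ, W) ∞ M] [MulAction G M]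
  {π : G → M}

/-- Although the generalized tangent bundle of `M` need not be trivial, its sections become
functions on `G` with values in the fibre at the base point. -/
lemma HomogProj.contMDiffAt_pull [FiniteDimensional ℝ W] (hp : HomogProj V W π)
    {s : ∀ x : M, GenTangent W x} {g : G} (hs : SmoothSecAt s (π g)) :
    ContMDiffAt 𝓘(ℝ, V) 𝓘(ℝ, W × (W →L[ℝ] ℝ)) ∞ (fun k => pull π k (s (π k))) g := by
  refine ContMDiffAt.prodMk_space (contMDiffAt_hat hp.act hp.smooth hp.equivariant hs.1) ?_
  refine contMDiffAt_clm_of_apply fun w => ?_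
  have h1 := contMDiffAt_dsmul hp.act (π 1) (contMDiffAt_id (I := 𝓘(ℝ, V)) (x := g))
    (contMDiffAt_const (c := w))
  have h2 : ContMDiffAt 𝓘(ℝ, V) 𝓘(ℝ, W).tangent ∞
      (fun k : G => (⟨π k, dsmul W k (π 1) w⟩ : TangentBundle 𝓘(ℝ, W) M)) g :=
    h1.congr_of_eventuallyEq (Eventually.of_forall fun k => tangent_mk_congr (hp.smul_one k).symm _)
  exact SmoothFormAt.apply_along hs.2 h2

variable (G) in
/-- The Courant-Dorfman trilinear form of the double of the Lie algebra. -/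
def alg (a b c : V × (V →L[ℝ] ℝ)) : ℝ :=
  a.2 (lieB (G := G) b.1 c.1) + b.2 (lieB (G := G) c.1 a.1) + c.2 (lieB (G := G) a.1 b.1)

/-- The derivative of `B` along the left-invariant direction of the vector part of `a`. -/
def covD (a : V × (V →L[ℝ] ℝ)) (B : G → V × (V →L[ℝ] ℝ)) (g : G) : V × (V →L[ℝ] ℝ) :=
  along B g (leftField (fun _ : G => a.1) g)

lemma along_snd_fst {S T : G → V × (V →L[ℝ] ℝ)} {g : G}
    (hS : MDifferentiableAt 𝓘(ℝ, V) 𝓘(ℝ, V × (V →L[ℝ] ℝ)) S g)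
    (hT : MDifferentiableAt 𝓘(ℝ, V) 𝓘(ℝ, V × (V →L[ℝ] ℝ)) T g) (a : V × (V →L[ℝ] ℝ)) :
    along (fun k => (S k).2 (T k).1) g (leftField (fun _ : G => a.1) g) =
      (covD a S g).2 (T g).1 + (S g).2 (covD a T g).1 := by
  have hS2 : MDifferentiableAt 𝓘(ℝ, V) 𝓘(ℝ, V →L[ℝ] ℝ) (fun k => (S k).2) g :=
    (ContinuousLinearMap.snd ℝ V (V →L[ℝ] ℝ)).mdifferentiableAt.comp g hS
  have hT1 : MDifferentiableAt 𝓘(ℝ, V) 𝓘(ℝ, V) (fun k => (T k).1) g :=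
    (ContinuousLinearMap.fst ℝ V (V →L[ℝ] ℝ)).mdifferentiableAt.comp g hT
  refine (along_clm_apply hS2 hT1 (leftField (fun _ : G => a.1) g)).trans ?_
  exact congrArg₂ (fun (p : V →L[ℝ] ℝ) (q : V) => p (T g).1 + (S g).2 q)
    (along_clm_comp (ContinuousLinearMap.snd ℝ V (V →L[ℝ] ℝ)) hS _)
    (along_clm_comp (ContinuousLinearMap.fst ℝ V (V →L[ℝ] ℝ)) hT _)

variable [FiniteDimensional ℝ V] [CompleteSpace V] [FiniteDimensional ℝ W] [CompleteSpace W]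

/-- The Courant bracket on a homogeneous space in terms of lifts to the group. -/
lemma pairing_courant (hp : HomogProj V W π) {s t u : ∀ x : M, GenTangent W x} {g : G}
    (hs : SmoothSecAt s (π g)) (ht : SmoothSecAt t (π g)) (hu : SmoothSecAt u (π g))
    {S T U : G → V × (V →L[ℝ] ℝ)}
    (hS : ContMDiffAt 𝓘(ℝ, V) 𝓘(ℝ, V × (V →L[ℝ] ℝ)) ∞ S g)
    (hT : ContMDiffAt 𝓘(ℝ, V) 𝓘(ℝ, V × (V →L[ℝ] ℝ)) ∞ T g)
    (hU : ContMDiffAt 𝓘(ℝ, V) 𝓘(ℝ, V × (V →L[ℝ] ℝ)) ∞ U g)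
    (rS : ∀ k, Rel (dproj V W π) (S k) (pull π k (s (π k))))
    (rT : ∀ k, Rel (dproj V W π) (T k) (pull π k (t (π k))))
    (rU : ∀ k, Rel (dproj V W π) (U k) (pull π k (u (π k)))) :
    pairing (courant s t (π g)) (u (π g)) = alg G (S g) (T g) (U g)
      + pair (covD (S g) T g) (U g) - pair (covD (T g) S g) (U g)
      + 1 / 2 * (pair (covD (U g) S g) (T g) - pair (covD (U g) T g) (S g)) := by
  have hd : ∀ {A : G → V × (V →L[ℝ] ℝ)}, ContMDiffAt 𝓘(ℝ, V) 𝓘(ℝ, V × (V →L[ℝ] ℝ)) ∞ A g →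
      MDifferentiableAt 𝓘(ℝ, V) 𝓘(ℝ, V × (V →L[ℝ] ℝ)) A g := fun h => h.mdifferentiableAt (by simp)
  have hA1 : ∀ {A : G → V × (V →L[ℝ] ℝ)}, ContMDiffAt 𝓘(ℝ, V) 𝓘(ℝ, V × (V →L[ℝ] ℝ)) ∞ A g →
      ContMDiffAt 𝓘(ℝ, V) 𝓘(ℝ, V) ∞ (fun k => (A k).1) g := fun h =>
    (ContinuousLinearMap.fst ℝ V (V →L[ℝ] ℝ)).contMDiff.contMDiffAt.comp g h
  -- the vector parts are related
  have hvec : ∀ {a : ∀ x : M, GenTangent W x} {A : G → V × (V →L[ℝ] ℝ)},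
      (∀ k, Rel (dproj V W π) (A k) (pull π k (a (π k)))) → ∀ k,
      (mfderiv 𝓘(ℝ, V) 𝓘(ℝ, W) π k (leftField (fun k => (A k).1) k) : W) = (a (π k)).1 := by
    intro a A r k
    refine (hp.mfderiv_dsmul_one k (A k).1).trans ?_
    rw [(r k).1]
    exact hp.dsmul_dsmul_inv k _
  have hcov : ∀ {a : ∀ x : M, GenTangent W x} {A : G → V × (V →L[ℝ] ℝ)},
      (∀ k, Rel (dproj V W π) (A k) (pull π k (a (π k)))) → ∀ k (v : V),
      (a (π k)).2 (dsmul W k (π 1) (dproj V W π v)) = (A k).2 v := by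
    intro a A r k v
    rw [(r k).2]
    rfl
  have hcov' : ∀ {a b : ∀ x : M, GenTangent W x} {A B : G → V × (V →L[ℝ] ℝ)},
      (∀ k, Rel (dproj V W π) (A k) (pull π k (a (π k)))) →
      (∀ k, Rel (dproj V W π) (B k) (pull π k (b (π k)))) → ∀ k,
      (a (π k)).2 (b (π k)).1 = (A k).2 (B k).1 := by
    intro a b A B rA rB k
    rw [← hcov rA, (rB k).1]
    exact congrArg (a (π k)).2 (hp.dsmul_dsmul_inv k _).symm
  have hder : ∀ {a b c : ∀ x : M, GenTangent W x} {A B C : G → V × (V →L[ℝ] ℝ)},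
      SmoothSecAt a (π g) → SmoothSecAt b (π g) →
      ContMDiffAt 𝓘(ℝ, V) 𝓘(ℝ, V × (V →L[ℝ] ℝ)) ∞ A g →
      ContMDiffAt 𝓘(ℝ, V) 𝓘(ℝ, V × (V →L[ℝ] ℝ)) ∞ B g →
      (∀ k, Rel (dproj V W π) (A k) (pull π k (a (π k)))) →
      (∀ k, Rel (dproj V W π) (B k) (pull π k (b (π k)))) →
      (∀ k, Rel (dproj V W π) (C k) (pull π k (c (π k)))) →
      along (fun y => (a y).2 (b y).1) (π g) (c (π g)).1 =
        (covD (C g) A g).2 (B g).1 + (A g).2 (covD (C g) B g).1 := by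
    intro a b c A B C ha hb hA hB rA rB rC
    have h1 := along_comp (h := fun y => (a y).2 (b y).1) (f := π) (x := g)
      ((ha.2.apply hb.1).mdifferentiableAt (by simp)) (hp.smooth.mdifferentiableAt (by simp))
      (leftField (fun k => (C k).1) g)
    have h2 := congrArg (along (fun y => (a y).2 (b y).1) (π g)) (hvec rC g)
    refine h2.symm.trans (h1.symm.trans ?_)
    rw [← along_snd_fst (hd hA) (hd hB)]
    exact along_congr (Eventually.of_forall fun k => hcov' rA rB k) _
  -- The left-trivialized lifts are `π`-related to the fields below, so their bracket on `G`
  -- projects to the bracket on `M`. The covector of a lift is the pullback of the covector below,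
  -- so it may be evaluated upstairs.
  have hbr : ∀ {a b c : ∀ x : M, GenTangent W x} {A B C : G → V × (V →L[ℝ] ℝ)},
      SmoothSecAt a (π g) → SmoothSecAt b (π g) →
      ContMDiffAt 𝓘(ℝ, V) 𝓘(ℝ, V × (V →L[ℝ] ℝ)) ∞ A g →
      ContMDiffAt 𝓘(ℝ, V) 𝓘(ℝ, V × (V →L[ℝ] ℝ)) ∞ B g →
      (∀ k, Rel (dproj V W π) (A k) (pull π k (a (π k)))) →
      (∀ k, Rel (dproj V W π) (B k) (pull π k (b (π k)))) →
      (∀ k, Rel (dproj V W π) (C k) (pull π k (c (π k)))) →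
      (c (π g)).2 (mlieBracket 𝓘(ℝ, W) (fun y => (a y).1) (fun y => (b y).1) (π g)) =
        (C g).2 (lieB (G := G) (A g).1 (B g).1 + (covD (A g) B g).1 - (covD (B g) A g).1) := by
    intro a b c A B C ha hb hA hB rA rB rC
    have h1 := mfderiv_mlieBracket_of_related (f := π) (x := g) hp.smooth.contMDiffAt
      (smoothFieldAt_leftField (hA1 hA)).diff (smoothFieldAt_leftField (hA1 hB)).diff
      ha.1.diff hb.1.diff (Eventually.of_forall fun k => hvec rA k)
      (Eventually.of_forall fun k => hvec rB k)
    have h2 := mlieBracket_leftField (hA1 hA) (hA1 hB)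
    rw [← hcov rC]
    refine congrArg (c (π g)).2 (h1.symm.trans ?_)
    refine (congrArg (mfderiv 𝓘(ℝ, V) 𝓘(ℝ, W) π g) h2).trans ((hp.mfderiv_dsmul_one g _).trans ?_)
    have e : ∀ {A : G → V × (V →L[ℝ] ℝ)}, ContMDiffAt 𝓘(ℝ, V) 𝓘(ℝ, V × (V →L[ℝ] ℝ)) ∞ A g →
        ∀ v : V, along (fun k => (A k).1) g v = (along A g v).1 := fun hA v =>
      along_clm_comp (ContinuousLinearMap.fst ℝ V (V →L[ℝ] ℝ)) (hd hA) v
    have e2 := congrArg₂ (fun p q : V => dsmul W g (π 1) (dproj V W π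
      (lieB (G := G) (A g).1 (B g).1 + p - q))) (e hB (leftField (fun k => (A k).1) g))
      (e hA (leftField (fun k => (B k).1) g))
    exact e2
  -- After Cartan's formula only derivatives of functions and brackets of fields remain, which
  -- `hder` and `hbr` compute on `G`.
  have c1 := contractD_apply ht.2 hs.1 hu.1
  have c2 := contractD_apply hs.2 ht.1 hu.1
  have expand : pairing (courant s t (π g)) (u (π g)) =
      (u (π g)).2 (mlieBracket 𝓘(ℝ, W) (fun y => (s y).1) (fun y => (t y).1) (π g))
      + (contractD (fun y => (t y).2) (π g) (s (π g)).1 (u (π g)).1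
        + 1 / 2 * along (fun y => (t y).2 (s y).1) (π g) (u (π g)).1
        - contractD (fun y => (s y).2) (π g) (t (π g)).1 (u (π g)).1
        - 1 / 2 * along (fun y => (s y).2 (t y).1) (π g) (u (π g)).1) := rfl
  rw [expand, c1, c2, hbr hs ht hS hT rS rT rU, hbr hs hu hS hU rS rU rT, hbr ht hu hT hU rT rU rS,
    hder ht hu hT hU rT rU rS, hder ht hs hT hS rT rS rU, hder hs hu hS hU rS rU rT,
    hder hs ht hS hT rS rT rU]
  simp only [alg, pair, map_add, map_sub]
  rw [lieB_swap (U g).1 (S g).1, map_neg]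
  ring

end Courant

/-! ### Lifts of sections, and cancellation of the derivative terms. -/

section Lifts
variable {V : Type*} [NormedAddCommGroup V] [NormedSpace ℝ V] [FiniteDimensional ℝ V] [CompleteSpace V]
  {W : Type*} [NormedAddCommGroup W] [NormedSpace ℝ W] [FiniteDimensional ℝ W] [CompleteSpace W]
  {G : Type*} [Group G] [TopologicalSpace G] [ChartedSpace V G] [LieGroup 𝓘(ℝ, V) ∞ G]
  {M : Type*} [TopologicalSpace M] [ChartedSpace W M] [IsManifold 𝓘(ℝ, W) ∞ M] [MulAction G M]
  {π : G → M} {g : G}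

/-- `S` is a smooth lift of the section `s` to the left-trivialized double of `G`. -/
structure IsLift (π : G → M) (s : ∀ x : M, GenTangent W x) (g : G) (S : G → V × (V →L[ℝ] ℝ)) :
    Prop where
  sec : SmoothSecAt s (π g)
  smooth : ContMDiffAt 𝓘(ℝ, V) 𝓘(ℝ, V × (V →L[ℝ] ℝ)) ∞ S g
  rel : ∀ k, Rel (dproj V W π) (S k) (pull π k (s (π k)))

lemma IsLift.diff {s : ∀ x : M, GenTangent W x} {S : G → V × (V →L[ℝ] ℝ)} (h : IsLift π s g S) :
    MDifferentiableAt 𝓘(ℝ, V) 𝓘(ℝ, V × (V →L[ℝ] ℝ)) S g := h.smooth.mdifferentiableAt (by simp)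

/-- Apply a fixed right inverse of `P` to the pulled-back section, and add the constant vertical
vector that corrects the value at `g` to the prescribed one. -/
lemma HomogProj.exists_lift (hp : HomogProj V W π) {s : ∀ x : M, GenTangent W x}
    (hs : SmoothSecAt s (π g)) {w : V × (V →L[ℝ] ℝ)}
    (hw : Rel (dproj V W π) w (pull π g (s (π g)))) : ∃ S, IsLift π s g S ∧ S g = w := by
  obtain ⟨R, hR⟩ := exists_continuous_rightInverse hp.dproj_surjective
  let c : (W →L[ℝ] ℝ) →L[ℝ] (V →L[ℝ] ℝ) :=
    (ContinuousLinearMap.compL ℝ V W ℝ).flip (dproj V W π)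
  let r : W × (W →L[ℝ] ℝ) →L[ℝ] V × (V →L[ℝ] ℝ) := R.prodMap c
  have hf := hp.contMDiffAt_pull hs
  let f : G → W × (W →L[ℝ] ℝ) := fun k => pull π k (s (π k))
  have hw' : Rel (dproj V W π) w (f g) := hw
  let v : V := w.1 - R (f g).1
  have hv : dproj V W π v = 0 := by
    simp only [v, map_sub, hR, hw'.1, sub_self]
  refine ⟨fun k => r (f k) + (v, 0), ⟨hs, ?_, fun k => ⟨?_, ?_⟩⟩, ?_⟩
  · exact (r.contMDiff.contMDiffAt.comp g hf).add contMDiffAt_const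
  · change dproj V W π (R (f k).1 + v) = (f k).1
    rw [map_add, hR, hv, add_zero]
  · change (f k).2.comp (dproj V W π) + 0 = (f k).2.comp (dproj V W π)
    rw [add_zero]
  · refine Prod.ext ?_ ?_
    · change R (f g).1 + (w.1 - R (f g).1) = w.1
      abel
    · change (f g).2.comp (dproj V W π) + 0 = w.2
      rw [add_zero, hw'.2]

/-- Derivatives of a section of a constant complex subspace lie in the subspace. -/
lemma cpx_covD_mem {L : Submodule ℂ (ℂ ⊗[ℝ] (V × (V →L[ℝ] ℝ)))} {S T : G → V × (V →L[ℝ] ℝ)}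
    (hS : MDifferentiableAt 𝓘(ℝ, V) 𝓘(ℝ, V × (V →L[ℝ] ℝ)) S g)
    (hT : MDifferentiableAt 𝓘(ℝ, V) 𝓘(ℝ, V × (V →L[ℝ] ℝ)) T g)
    (h : ∀ᶠ k in 𝓝 g, cpx (S k) (T k) ∈ L) (a : V × (V →L[ℝ] ℝ)) :
    cpx (covD a S g) (covD a T g) ∈ L := by
  let p : Submodule ℝ ((V × (V →L[ℝ] ℝ)) × (V × (V →L[ℝ] ℝ))) := (L.restrictScalars ℝ).comap cpxL
  by_contra hne
  -- A functional vanishing on `L` but not on the derivative: composed with the section it is zero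
  -- near `g`, so its derivative would have to be zero.
  obtain ⟨f, hf, hfp⟩ := p.exists_le_ker_of_notMem
    (v := ((covD a S g, covD a T g) : (V × (V →L[ℝ] ℝ)) × (V × (V →L[ℝ] ℝ)))) hne
  let F : (V × (V →L[ℝ] ℝ)) × (V × (V →L[ℝ] ℝ)) →L[ℝ] ℝ := LinearMap.toContinuousLinearMap f
  have hd : MDifferentiableAt 𝓘(ℝ, V) 𝓘(ℝ, (V × (V →L[ℝ] ℝ)) × (V × (V →L[ℝ] ℝ)))
      (fun k => (S k, T k)) g := hS.prodMk_space hT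
  let v : V := leftField (fun _ : G => a.1) g
  have h1 : along (fun k => F (S k, T k)) g v = F (along (fun k => (S k, T k)) g v) :=
    along_clm_comp F hd v
  have h2 : along (fun k => (S k, T k)) g v = (covD a S g, covD a T g) :=
    Prod.ext (along_clm_comp (ContinuousLinearMap.fst ℝ _ _) hd v).symm
      (along_clm_comp (ContinuousLinearMap.snd ℝ _ _) hd v).symm
  have h3 : along (fun k => F (S k, T k)) g v = 0 :=
    mfderiv_const_flat (c := (0 : ℝ)) (h.mono fun k hk => hfp (x := (S k, T k)) hk) v
  rw [h1, h2] at h3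
  exact hf h3

variable (G) in
/-- The imaginary part of the complexification of `alg`. -/
def algIm (a a' b b' c c' : V × (V →L[ℝ] ℝ)) : ℝ :=
  alg G a b' c + alg G a' b c + alg G a b c' - alg G a' b' c'

/-- The imaginary part of `⟨[s + is', t + it'], u + iu'⟩` for sections of a Lagrangian
subbundle. -/
lemma courant_im (hp : HomogProj V W π) {L : Submodule ℂ (ℂ ⊗[ℝ] (V × (V →L[ℝ] ℝ)))}
    (hL : IsLagrangian L) {s s' t t' u u' : ∀ x : M, GenTangent W x}
    {S S' T T' U U' : G → V × (V →L[ℝ] ℝ)}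
    (hS : IsLift π s g S) (hS' : IsLift π s' g S') (hT : IsLift π t g T) (hT' : IsLift π t' g T')
    (hU : IsLift π u g U) (hU' : IsLift π u' g U')
    (mS : ∀ᶠ k in 𝓝 g, cpx (S k) (S' k) ∈ L) (mT : ∀ᶠ k in 𝓝 g, cpx (T k) (T' k) ∈ L)
    (mU : cpx (U g) (U' g) ∈ L) :
    pairing (courant s t' (π g)) (u (π g)) + pairing (courant s' t (π g)) (u (π g))
      + pairing (courant s t (π g)) (u' (π g)) - pairing (courant s' t' (π g)) (u' (π g)) =
    algIm G (S g) (S' g) (T g) (T' g) (U g) (U' g) := by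
  have key : ∀ {a b c : ∀ x : M, GenTangent W x} {A B C : G → V × (V →L[ℝ] ℝ)},
      IsLift π a g A → IsLift π b g B → IsLift π c g C →
      pairing (courant a b (π g)) (c (π g)) = alg G (A g) (B g) (C g)
        + pair (covD (A g) B g) (C g) - pair (covD (B g) A g) (C g)
        + 1 / 2 * (pair (covD (C g) A g) (B g) - pair (covD (C g) B g) (A g)) :=
    fun h1 h2 h3 => pairing_courant hp h1.sec h2.sec h3.sec h1.smooth h2.smooth h3.smooth
      h1.rel h2.rel h3.rel
  have iso : ∀ {x x' y y' : V × (V →L[ℝ] ℝ)}, cpx x x' ∈ L → cpx y y' ∈ L →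
      pair x y = pair x' y' ∧ pair x y' = - pair x' y := fun h1 h2 =>
    cpair_cpx_eq_zero.1 ((hL _).1 h1 _ h2)
  have dS := cpx_covD_mem hS.diff hS'.diff mS
  have dT := cpx_covD_mem hT.diff hT'.diff mT
  have mS' := mS.self_of_nhds
  have mT' := mT.self_of_nhds
  -- Each identity pairs a derivative of a section of `L` with an element of `L`; together they
  -- account for every derivative term of `pairing_courant`.
  have a1 := (iso (dT (S g)) mU).2
  have a2 := (iso (dT (S' g)) mU).1
  have a3 := (iso (dS (T g)) mU).2
  have a4 := (iso (dS (T' g)) mU).1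
  have a5 := (iso (dS (U g)) mT').2
  have a6 := (iso (dS (U' g)) mT').1
  have a7 := (iso (dT (U g)) mS').2
  have a8 := (iso (dT (U' g)) mS').1
  rw [key hS hT' hU, key hS' hT hU, key hS hT hU', key hS' hT' hU', algIm]
  linear_combination a1 + a2 - a3 - a4 + 1 / 2 * (a5 + a6) - 1 / 2 * (a7 + a8)

end Lifts

/-! ### Transport along local sections. -/

section Smoothness
variable {V : Type*} [NormedAddCommGroup V] [NormedSpace ℝ V]
  {W : Type*} [NormedAddCommGroup W] [NormedSpace ℝ W] [FiniteDimensional ℝ W]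
  {G : Type*} [Group G] [TopologicalSpace G] [ChartedSpace V G] [LieGroup 𝓘(ℝ, V) ∞ G]
  {M : Type*} [TopologicalSpace M] [ChartedSpace W M] [IsManifold 𝓘(ℝ, W) ∞ M] [MulAction G M]
  {π : G → M}

lemma isSmoothOn_iff {s : ∀ x : M, GenTangent W x} {U : Set M} (hU : IsOpen U) :
    IsSmoothOn s U ↔ ∀ x ∈ U, SmoothSecAt s x :=
  ⟨fun h x hx => ⟨h.1.contMDiffAt (hU.mem_nhds hx), h.2.contMDiffAt (hU.mem_nhds hx)⟩,
    fun h => ⟨fun x hx => (h x hx).1.contMDiffWithinAt, fun x hx => (h x hx).2.contMDiffWithinAt⟩⟩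

/-- Transport along a local section is smooth. -/
lemma HomogProj.smoothSecAt_push (hp : HomogProj V W π) {σ : M → G} {e : M → W × (W →L[ℝ] ℝ)} {x : M}
    (hσ : ContMDiffAt 𝓘(ℝ, W) 𝓘(ℝ, V) ∞ σ x) (hσx : ∀ᶠ y in 𝓝 x, π (σ y) = y)
    (he : ContMDiffAt 𝓘(ℝ, W) 𝓘(ℝ, W × (W →L[ℝ] ℝ)) ∞ e x) :
    SmoothSecAt (fun y => (push π (σ y) (e y) : W × (W →L[ℝ] ℝ))) x := by
  have he1 : ContMDiffAt 𝓘(ℝ, W) 𝓘(ℝ, W) ∞ (fun y => (e y).1) x :=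
    (ContinuousLinearMap.fst ℝ W (W →L[ℝ] ℝ)).contMDiff.contMDiffAt.comp x he
  have he2 : ContMDiffAt 𝓘(ℝ, W) 𝓘(ℝ, W →L[ℝ] ℝ) ∞ (fun y => (e y).2) x :=
    (ContinuousLinearMap.snd ℝ W (W →L[ℝ] ℝ)).contMDiff.contMDiffAt.comp x he
  refine ⟨?_, smoothFormAt_of_apply fun X hX => ?_⟩
  · refine (contMDiffAt_dsmul hp.act (π 1) hσ he1).congr_of_eventuallyEq ?_
    filter_upwards [hσx] with y hy
    exact tangent_mk_congr (by rw [hp.smul_one, hy]) _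
  · have hx := hσx.self_of_nhds
    have h1 : ContMDiffAt 𝓘(ℝ, V) 𝓘(ℝ, W) ∞ (hat π X) (σ x) :=
      contMDiffAt_hat hp.act hp.smooth hp.equivariant (by rw [hx]; exact hX)
    have h2 : ContMDiffAt 𝓘(ℝ, W) 𝓘(ℝ, W) ∞ (fun y => hat π X (σ y)) x := ContMDiffAt.comp x h1 hσ
    refine (he2.clm_apply h2).congr_of_eventuallyEq ?_
    filter_upwards [hσx] with y hy
    exact congrArg (fun z => (e y).2 (dsmul W (σ y)⁻¹ (π (σ y)) (X z : W))) hy.symm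

end Smoothness

/-! ### The algebraic form of integrability. -/

section Algebra
variable {V : Type*} [NormedAddCommGroup V] [NormedSpace ℝ V] [FiniteDimensional ℝ V] [CompleteSpace V]
  {W : Type*} [NormedAddCommGroup W] [NormedSpace ℝ W]
  {G : Type*} [Group G] [TopologicalSpace G] [ChartedSpace V G] [LieGroup 𝓘(ℝ, V) ∞ G]
  {E : Submodule ℂ (ℂ ⊗[ℝ] V)} {ε : E [⋀^Fin 2]→ₗ[ℂ] ℂ} {P : V →L[ℝ] W}

variable (G) in
/-- The complexification of `alg`. -/
def calg (w z y : ℂ ⊗[ℝ] (V × (V →L[ℝ] ℝ))) : ℂ :=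
  covecPart w (clie G (vecPart z) (vecPart y)) + covecPart z (clie G (vecPart y) (vecPart w))
    + covecPart y (clie G (vecPart w) (vecPart z))

lemma calg_im (a a' b b' c c' : V × (V →L[ℝ] ℝ)) :
    (calg G (cpx a a') (cpx b b') (cpx c c')).im = algIm G a a' b b' c c' := by
  simp only [calg, vecPart_cpx, clie_cpx, covecPart_cpx, algIm, alg, map_add, map_sub]
  simp
  ring

lemma calg_I_smul (w z y : ℂ ⊗[ℝ] (V × (V →L[ℝ] ℝ))) :
    calg G (Complex.I • w) z y = Complex.I * calg G w z y := by
  have h1 : ∀ x x' : ℂ ⊗[ℝ] V, clie G x (Complex.I • x') = Complex.I • clie G x x' := fun x x' =>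
    lie_smul (R := ℂ) (L := ℂ ⊗[ℝ] GroupLieAlgebra 𝓘(ℝ, V) G)
      (M := ℂ ⊗[ℝ] GroupLieAlgebra 𝓘(ℝ, V) G) Complex.I x x'
  have h2 : ∀ x x' : ℂ ⊗[ℝ] V, clie G (Complex.I • x) x' = Complex.I • clie G x x' := fun x x' =>
    smul_lie (R := ℂ) (L := ℂ ⊗[ℝ] GroupLieAlgebra 𝓘(ℝ, V) G)
      (M := ℂ ⊗[ℝ] GroupLieAlgebra 𝓘(ℝ, V) G) Complex.I x x'
  simp only [calg, map_smul, LinearMap.smul_apply, h1, h2, smul_eq_mul]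
  ring

variable (G) in
/-- The algebraic form of integrability of a subspace of the complexified double. -/
def AlgIntegrable (L : Submodule ℂ (ℂ ⊗[ℝ] (V × (V →L[ℝ] ℝ)))) : Prop :=
  ∀ a a' b b' c c', cpx a a' ∈ L → cpx b b' ∈ L → cpx c c' ∈ L → algIm G a a' b b' c c' = 0

/-- Only imaginary parts are assumed to vanish, but `L` is stable under `i`, and the imaginary part
of `calg (i w)` is the real part of `calg w`. -/
lemma algIntegrable_iff {L : Submodule ℂ (ℂ ⊗[ℝ] (V × (V →L[ℝ] ℝ)))} :
    AlgIntegrable G L ↔ ∀ w ∈ L, ∀ z ∈ L, ∀ y ∈ L, calg G w z y = 0 := by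
  constructor
  · intro h w hw z hz y hy
    have him : ∀ w ∈ L, (calg G w z y).im = 0 := by
      intro w hw
      obtain ⟨a, a', rfl⟩ := exists_cpx w
      obtain ⟨b, b', rfl⟩ := exists_cpx z
      obtain ⟨c, c', rfl⟩ := exists_cpx y
      rw [calg_im]
      exact h _ _ _ _ _ _ hw hz hy
    have h1 := him _ (L.smul_mem Complex.I hw)
    rw [calg_I_smul] at h1
    exact Complex.ext (by simpa using h1) (him w hw)
  · intro h a a' b b' c c' ha hb hc
    rw [← calg_im, h _ ha _ hb _ hc, Complex.zero_im]

lemma lieGCPair_iff : LieGCPair G P E ε ↔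
    LinearGCPair P E ε ∧ AlgIntegrable G (diracSubmodule E ε) := by
  rw [algIntegrable_iff]
  constructor
  · intro h
    refine ⟨h.toLinearGCPair, ?_⟩
    rintro w ⟨w1, w2⟩ z ⟨z1, z2⟩ y ⟨y1, y2⟩
    have h1 := h.closed ⟨_, w1⟩ ⟨_, z1⟩ ⟨_, y1⟩
    rw [← w2, ← z2, ← y2] at h1
    exact h1
  · rintro ⟨h, hi⟩
    have hlie : ∀ x ∈ E, ∀ y ∈ E, clie G x y ∈ E := by
      intro x hx y hy
      obtain ⟨w, hw, hwx⟩ := exists_mem_diracSpace (ε := ε) ⟨x, hx⟩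
      obtain ⟨z, hz, hzy⟩ := exists_mem_diracSpace (ε := ε) ⟨y, hy⟩
      refine mem_of_forall_annihilator E _ fun ζ hζ => ?_
      -- Taking `(0, ζ)`, with `ζ` annihilating `E`, as third argument reduces the trilinear form to
      -- `ζ([x, y])`. Its vanishing for all such `ζ` puts the bracket in `E`, after which the form
      -- is `d_E ε`.
      obtain ⟨u, h1, h2⟩ := exists_vecPart_covecPart (0 : ℂ ⊗[ℝ] V) ζ
      have hu : u ∈ diracSpace E ε := by
        have h3 : vecPart u ∈ E := by rw [h1]; exact E.zero_mem
        refine ⟨h3, fun Y => ?_⟩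
        have e : (⟨vecPart u, h3⟩ : E) = 0 := Subtype.ext h1
        rw [e, h2, hζ _ Y.2, ← altBil_apply, map_zero]
        rfl
      have h0 : ∀ x : ℂ ⊗[ℝ] V, clie G x 0 = 0 := fun x =>
        lie_zero (L := ℂ ⊗[ℝ] GroupLieAlgebra 𝓘(ℝ, V) G)
          (M := ℂ ⊗[ℝ] GroupLieAlgebra 𝓘(ℝ, V) G) x
      have h0' : ∀ x : ℂ ⊗[ℝ] V, clie G 0 x = 0 := fun x =>
        zero_lie (L := ℂ ⊗[ℝ] GroupLieAlgebra 𝓘(ℝ, V) G)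
          (M := ℂ ⊗[ℝ] GroupLieAlgebra 𝓘(ℝ, V) G) x
      have h3 := hi w hw z hz u hu
      rwa [calg, h1, h0, h0', map_zero, map_zero, h2, hwx, hzy, add_zero, zero_add] at h3
    refine ⟨h, hlie, fun X Y Z => ?_⟩
    obtain ⟨w, hw, hwX⟩ := exists_mem_diracSpace (ε := ε) X
    obtain ⟨z, hz, hzY⟩ := exists_mem_diracSpace (ε := ε) Y
    obtain ⟨y, hy, hyZ⟩ := exists_mem_diracSpace (ε := ε) Z
    have h1 := hi w hw z hz y hy
    rw [calg, hwX, hzY, hyZ] at h1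
    obtain ⟨w1, w2⟩ := hw
    obtain ⟨z1, z2⟩ := hz
    obtain ⟨y1, y2⟩ := hy
    rw [← alt_congr_left ε (x := ⟨_, w1⟩) hwX, ← alt_congr_left ε (x := ⟨_, z1⟩) hzY,
      ← alt_congr_left ε (x := ⟨_, y1⟩) hyZ, ← w2, ← z2, ← y2]
    exact h1

end Algebra

/-! ### Involutivity of the eigenbundle and the algebraic condition. -/

section Integrability
variable {V : Type*} [NormedAddCommGroup V] [NormedSpace ℝ V] [FiniteDimensional ℝ V] [CompleteSpace V]
  {W : Type*} [NormedAddCommGroup W] [NormedSpace ℝ W] [FiniteDimensional ℝ W] [CompleteSpace W]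
  {G : Type*} [Group G] [TopologicalSpace G] [ChartedSpace V G] [LieGroup 𝓘(ℝ, V) ∞ G]
  {M : Type*} [TopologicalSpace M] [ChartedSpace W M] [IsManifold 𝓘(ℝ, W) ∞ M] [MulAction G M]
  {π : G → M} {J : ∀ x : M, GenTangent W x →ₗ[ℝ] GenTangent W x}
  {J₀ : W × (W →L[ℝ] ℝ) →ₗ[ℝ] W × (W →L[ℝ] ℝ)}

/-- An element of a fibre of the generalized tangent bundle in the model space. -/
def flat {x : M} (u : GenTangent W x) : W × (W →L[ℝ] ℝ) := u

variable (J) in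
/-- A field of endomorphisms, fibrewise on the model space. -/
def flatEnd (x : M) : W × (W →L[ℝ] ℝ) →ₗ[ℝ] W × (W →L[ℝ] ℝ) := J x

variable (π J J₀) in
/-- The field of endomorphisms `J` is obtained from `J₀` by transport. -/
def IsTransport : Prop :=
  ∀ (g : G) (d : W × (W →L[ℝ] ℝ)), flatEnd J (π g) (push π g d) = push π g (J₀ d)

lemma IsTransport.apply (hp : HomogProj V W π) (hJ : IsTransport π J J₀) (g : G)
    (d : W × (W →L[ℝ] ℝ)) : pull π g (flatEnd J (π g) d) = J₀ (pull π g d) := by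
  have h1 := hJ g (pull π g d)
  rw [hp.push_pull] at h1
  rw [h1, hp.pull_push]

lemma IsTransport.pull_mem (hp : HomogProj V W π) (hJ : IsTransport π J J₀)
    (hsq : ∀ x u, J x (J x u) = -u) (hJ₀ : ∀ u, J₀ (J₀ u) = -u) {g : G} {a b : W × (W →L[ℝ] ℝ)}
    (h : (cpx a b : ℂ ⊗[ℝ] GenTangent W (π g)) ∈ iEigenspace (J (π g))) :
    cpx (pull π g a) (pull π g b) ∈ iEigenspace J₀ := by
  have h1 : b = - flatEnd J (π g) a := (mem_iEigenspace (hsq _) _ _).1 h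
  rw [mem_iEigenspace hJ₀, h1, map_neg, hJ.apply hp]

lemma IsTransport.eventually_mem (hp : HomogProj V W π) (hJ : IsTransport π J J₀)
    (hsq : ∀ x u, J x (J x u) = -u) (hJ₀ : ∀ u, J₀ (J₀ u) = -u) {g : G}
    {s t : ∀ x : M, GenTangent W x} {S T : G → V × (V →L[ℝ] ℝ)}
    (hS : IsLift π s g S) (hT : IsLift π t g T)
    (h : ∀ᶠ x in 𝓝 (π g), complexSection s t x ∈ iEigenspace (J x)) :
    ∀ᶠ k in 𝓝 g, cpx (S k) (T k) ∈ diracPullback (dproj V W π) (iEigenspace J₀) := by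
  filter_upwards [hp.smooth.continuous.continuousAt.eventually h] with k hk
  exact mem_diracPullback.2 ⟨_, _, hS.rel k, hT.rel k, hJ.pull_mem hp hsq hJ₀ hk⟩

/-- The `i`-eigenbundle of an integrable invariant structure satisfies the algebraic
integrability condition. -/
lemma GenComplexStructure.algIntegrable (hp : HomogProj V W π) (𝒥 : GenComplexStructure W M)
    (hJ : IsTransport π 𝒥.J J₀) (hJ₀ : ∀ u, J₀ (J₀ u) = -u)
    (hJo : ∀ u v, pair (J₀ u) (J₀ v) = pair u v) :
    AlgIntegrable G (diracPullback (dproj V W π) (iEigenspace J₀)) := by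
  intro a a' b b' c c' ha hb hc
  obtain ⟨σ, -, hσ1, hσ⟩ := hp.exists_section 1
  obtain ⟨O, hO, hOo, hO1⟩ := eventually_nhds_iff.1 hσ
  -- Transporting a constant vector along a local section of `π` gives local sections; those of `d -
  -- iJ₀ d` lie in the eigenbundle and realize every value at the base point.
  let sec : W × (W →L[ℝ] ℝ) → ∀ x : M, GenTangent W x := fun d x =>
    (push π (σ x) d : W × (W →L[ℝ] ℝ))
  have hsec : ∀ d, ∀ x ∈ O, SmoothSecAt (sec d) x := fun d x hx =>
    hp.smoothSecAt_push (hO x hx).1 (eventually_nhds_iff.2 ⟨O, fun y hy => (hO y hy).2, hOo, hx⟩)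
      contMDiffAt_const
  have hmem : ∀ d, ∀ x ∈ O, complexSection (sec d) (sec (-J₀ d)) x ∈ iEigenspace (𝒥.J x) := by
    intro d x hx
    refine (mem_iEigenspace (𝒥.sq_eq_neg x) _ _).2 ?_
    have h1 : flatEnd 𝒥.J x (flat (sec d x)) = push π (σ x) (J₀ d) :=
      (congrArg (fun y => flatEnd 𝒥.J y (push π (σ x) d)) (hO x hx).2.symm).trans (hJ (σ x) d)
    exact (map_neg (push π (σ x)) (J₀ d)).trans (congrArg Neg.neg h1.symm)
  have hlift : ∀ {w d}, Rel (dproj V W π) w d → ∃ S, IsLift π (sec d) 1 S ∧ S 1 = w := by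
    intro w d h
    refine hp.exists_lift (hsec d _ hO1) ?_
    have h1 : pull π 1 (flat (sec d (π 1))) = d := by
      change pull π 1 (push π (σ (π 1)) d) = d
      rw [hσ1, hp.pull_push]
    exact (congrArg (Rel (dproj V W π) w) h1).mpr h
  have hD : ∀ {w w'}, cpx w w' ∈ diracPullback (dproj V W π) (iEigenspace J₀) →
      ∃ d, ∃ S S', IsLift π (sec d) 1 S ∧ IsLift π (sec (-J₀ d)) 1 S' ∧ S 1 = w ∧ S' 1 = w' := by
    intro w w' h
    obtain ⟨d, d', h1, h2, h3⟩ := mem_diracPullback.1 h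
    rw [mem_iEigenspace hJ₀] at h3
    subst h3
    obtain ⟨S, hS, hSw⟩ := hlift h1
    obtain ⟨S', hS', hSw'⟩ := hlift h2
    exact ⟨d, S, S', hS, hS', hSw, hSw'⟩
  have hL := isLagrangian_diracPullback hp.dproj_surjective (isLagrangian_iEigenspace hJ₀ hJo)
  have hev : ∀ d, ∀ᶠ x in 𝓝 (π 1), complexSection (sec d) (sec (-J₀ d)) x ∈ iEigenspace (𝒥.J x) :=
    fun d => eventually_nhds_iff.2 ⟨O, hmem d, hOo, hO1⟩
  obtain ⟨d, S, S', hS, hS', rfl, rfl⟩ := hD ha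
  obtain ⟨e, T, T', hT, hT', rfl, rfl⟩ := hD hb
  obtain ⟨f, U, U', hU, hU', rfl, rfl⟩ := hD hc
  have h1 := courant_im hp hL hS hS' hT hT' hU hU'
    (hJ.eventually_mem hp 𝒥.sq_eq_neg hJ₀ hS hS' (hev d))
    (hJ.eventually_mem hp 𝒥.sq_eq_neg hJ₀ hT hT' (hev e)) hc
  have hsm : ∀ d, IsSmoothOn (sec d) O := fun d => (isSmoothOn_iff hOo).2 (hsec d)
  have h2 := 𝒥.integrable O hOo _ _ _ _ (hsm d) (hsm (-J₀ d)) (hsm e) (hsm (-J₀ e))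
    (hmem d) (hmem e) _ hO1
  -- The bracket and the third section both lie in this isotropic eigenspace, so their pairing is
  -- zero; its imaginary part is the algebraic expression.
  have hLx : IsLagrangian (V := W) (iEigenspace (𝒥.J (π 1))) :=
    isLagrangian_iEigenspace (𝒥.sq_eq_neg (π 1)) (𝒥.orthogonal (π 1))
  have h3 := (cpair_cpx_eq_zero.1 ((hLx _).1 h2 _ (hmem f _ hO1))).2
  rw [← h1]
  have h4 := pair_sub_left (flat (courant (sec d) (sec e) (π 1)))
    (flat (courant (sec (-J₀ d)) (sec (-J₀ e)) (π 1))) (flat (sec (-J₀ f) (π 1)))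
  have h5 := pair_add_left (flat (courant (sec d) (sec (-J₀ e)) (π 1)))
    (flat (courant (sec (-J₀ d)) (sec e) (π 1))) (flat (sec f (π 1)))
  have h6 := (h4.symm.trans h3).trans (congrArg Neg.neg h5)
  change pair (flat (courant (sec d) (sec (-J₀ e)) (π 1))) (flat (sec f (π 1)))
    + pair (flat (courant (sec (-J₀ d)) (sec e) (π 1))) (flat (sec f (π 1)))
    + pair (flat (courant (sec d) (sec e) (π 1))) (flat (sec (-J₀ f) (π 1)))
    - pair (flat (courant (sec (-J₀ d)) (sec (-J₀ e)) (π 1))) (flat (sec (-J₀ f) (π 1))) = 0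
  linarith

/-- The algebraic integrability condition implies involutivity of the `i`-eigenbundle. -/
lemma IsTransport.complexCourant_mem (hp : HomogProj V W π) (hJ : IsTransport π J J₀)
    (hsq : ∀ x u, J x (J x u) = -u) (horth : ∀ x u v, pairing (J x u) (J x v) = pairing u v)
    (hJ₀ : ∀ u, J₀ (J₀ u) = -u) (hJo : ∀ u v, pair (J₀ u) (J₀ v) = pair u v)
    (hi : AlgIntegrable G (diracPullback (dproj V W π) (iEigenspace J₀)))
    {s s' t t' : ∀ x : M, GenTangent W x} {x : M} (hs : SmoothSecAt s x) (hs' : SmoothSecAt s' x)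
    (ht : SmoothSecAt t x) (ht' : SmoothSecAt t' x)
    (ms : ∀ᶠ y in 𝓝 x, complexSection s s' y ∈ iEigenspace (J y))
    (mt : ∀ᶠ y in 𝓝 x, complexSection t t' y ∈ iEigenspace (J y)) :
    complexCourant s s' t t' x ∈ iEigenspace (J x) := by
  obtain ⟨g, rfl⟩ := hp.surjective x
  obtain ⟨σ, hσs, hσ1, hσ⟩ := hp.exists_section g
  have hP := hp.dproj_surjective
  have hL := isLagrangian_diracPullback hP (isLagrangian_iEigenspace hJ₀ hJo)
  have hLx : IsLagrangian (V := W) (iEigenspace (J (π g))) :=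
    isLagrangian_iEigenspace (hsq (π g)) (horth (π g))
  have hlift : ∀ {a : ∀ x : M, GenTangent W x}, SmoothSecAt a (π g) →
      ∃ A : G → V × (V →L[ℝ] ℝ), IsLift π a g A := by
    intro a ha
    obtain ⟨w, hw⟩ := exists_rel hP (pull π g (a (π g)))
    obtain ⟨A, hA, -⟩ := hp.exists_lift ha hw
    exact ⟨A, hA⟩
  obtain ⟨S, hS⟩ := hlift hs
  obtain ⟨S', hS'⟩ := hlift hs'
  obtain ⟨T, hT⟩ := hlift ht
  obtain ⟨T', hT'⟩ := hlift ht'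
  have mS := hJ.eventually_mem hp hsq hJ₀ hS hS' ms
  have mT := hJ.eventually_mem hp hsq hJ₀ hT hT' mt
  let C : (∀ x : M, GenTangent W x) → (∀ x : M, GenTangent W x) → W × (W →L[ℝ] ℝ) :=
    fun a b => flat (courant a b (π g))
  let p : W × (W →L[ℝ] ℝ) := C s t - C s' t'
  let q : W × (W →L[ℝ] ℝ) := C s t' + C s' t
  -- By the Lagrangian property it suffices to pair the bracket with each eigenvector `c + ic'`,
  -- extended to smooth sections that need to lie in the eigenbundle only at this one point.
  have him : ∀ c c' : W × (W →L[ℝ] ℝ),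
      (cpx c c' : ℂ ⊗[ℝ] GenTangent W (π g)) ∈ iEigenspace (J (π g)) → pair p c' = - pair q c := by
    intro c c' hc
    let sec : W × (W →L[ℝ] ℝ) → ∀ x : M, GenTangent W x := fun d x =>
      (push π (σ x) (pull π g d) : W × (W →L[ℝ] ℝ))
    have hsec : ∀ d, SmoothSecAt (sec d) (π g) := fun d =>
      hp.smoothSecAt_push hσs (hσ.mono fun _ h => h.2) contMDiffAt_const
    have hval : ∀ d, flat (sec d (π g)) = d := by
      intro d
      change push π (σ (π g)) (pull π g d) = d
      rw [hσ1, hp.push_pull]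
    obtain ⟨U, hU⟩ := hlift (hsec c)
    obtain ⟨U', hU'⟩ := hlift (hsec c')
    have mU : cpx (U g) (U' g) ∈ diracPullback (dproj V W π) (iEigenspace J₀) := by
      refine mem_diracPullback.2 ⟨_, _, hU.rel g, hU'.rel g, hJ.pull_mem hp hsq hJ₀ ?_⟩
      exact (congrArg₂ (fun a b : W × (W →L[ℝ] ℝ) =>
        (cpx a b : ℂ ⊗[ℝ] GenTangent W (π g)) ∈ iEigenspace (J (π g))) (hval c) (hval c')).mpr hc
    have h1 := courant_im hp hL hS hS' hT hT' hU hU' mS mT mU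
    rw [hi _ _ _ _ _ _ mS.self_of_nhds mT.self_of_nhds mU] at h1
    have h2 : pair (C s t') c + pair (C s' t) c + pair (C s t) c' - pair (C s' t') c' = 0 :=
      (congrArg₂ (fun a b : W × (W →L[ℝ] ℝ) =>
        pair (C s t') a + pair (C s' t) a + pair (C s t) b - pair (C s' t') b)
        (hval c) (hval c')).symm.trans h1
    rw [pair_sub_left, pair_add_left]
    linarith
  refine (hLx (cpx p q)).2 fun z hz => ?_
  obtain ⟨c, c', rfl⟩ := exists_cpx z
  refine cpair_cpx_eq_zero.2 ⟨?_, him c c' hz⟩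
  -- The real part of the pairing comes from the imaginary-part identity applied to `i(c + ic')`.
  have h1 : cpx (-c') c ∈ iEigenspace (flatEnd J (π g)) := by
    rw [← I_smul_cpx]
    exact Submodule.smul_mem _ Complex.I hz
  have h2 := him _ _ h1
  rw [pair_neg_right, neg_neg] at h2
  exact h2

end Integrability

/-! ### Invariant structures as transports of a structure at the base point. -/

section Transport
variable {V : Type*} [NormedAddCommGroup V] [NormedSpace ℝ V] [FiniteDimensional ℝ V] [CompleteSpace V]
  {W : Type*} [NormedAddCommGroup W] [NormedSpace ℝ W] [FiniteDimensional ℝ W] [CompleteSpace W]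
  {G : Type*} [Group G] [TopologicalSpace G] [ChartedSpace V G] [LieGroup 𝓘(ℝ, V) ∞ G]
  {M : Type*} [TopologicalSpace M] [ChartedSpace W M] [IsManifold 𝓘(ℝ, W) ∞ M] [MulAction G M]
  {π : G → M} {J : ∀ x : M, GenTangent W x →ₗ[ℝ] GenTangent W x}
  {J₀ : W × (W →L[ℝ] ℝ) →ₗ[ℝ] W × (W →L[ℝ] ℝ)}

lemma HomogProj.push_one (hp : HomogProj V W π) (d : W × (W →L[ℝ] ℝ)) : push π 1 d = d := by
  have h : ∀ w : W, dsmul W (1 : G) (π 1) w = w := fun w => dsmul_one (π 1) w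
  refine Prod.ext (h _) (ContinuousLinearMap.ext fun w => congrArg d.2 ?_)
  rw [inv_one]
  exact h w

lemma HomogProj.translate_one (hp : HomogProj V W π) (g : G) (d : W × (W →L[ℝ] ℝ)) :
    flat (translate g (π 1) d) = push π g d := by
  have h := hp.translate_push g 1 d
  rw [hp.push_one, mul_one] at h
  exact h

lemma HomogProj.push_mul (hp : HomogProj V W π) (g : G) {k : G} (hk : π k = π 1)
    (d : W × (W →L[ℝ] ℝ)) : push π (g * k) d = push π g (push π k d) := by
  rw [← hp.translate_one g, ← hp.translate_push g k d]
  exact congrArg (fun x => flat (translate g x (push π k d : W × (W →L[ℝ] ℝ)))) hk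

lemma HomogProj.mk_eq (hp : HomogProj V W π) {g h : G} (hgh : π h = π g) : π (g⁻¹ * h) = π 1 := by
  rw [hp.equivariant, hgh, ← hp.equivariant, inv_mul_cancel]

lemma HomogProj.exists_push (hp : HomogProj V W π) {x : M} (u : GenTangent W x) :
    ∃ g d, π g = x ∧ flat u = push π g d := by
  obtain ⟨g, rfl⟩ := hp.surjective x
  exact ⟨g, pull π g (flat u), rfl, (hp.push_pull g _).symm⟩

lemma IsTransport.sq_eq_neg (hp : HomogProj V W π) (hJ : IsTransport π J J₀)
    (hJ₀ : ∀ u, J₀ (J₀ u) = -u) (x : M) (u : GenTangent W x) : J x (J x u) = -u := by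
  change flatEnd J x (flatEnd J x (flat u)) = - flat u
  obtain ⟨g, d, rfl, h⟩ := hp.exists_push u
  rw [h, hJ, hJ, hJ₀, map_neg]

lemma IsTransport.orthogonal (hp : HomogProj V W π) (hJ : IsTransport π J J₀)
    (hJo : ∀ u v, pair (J₀ u) (J₀ v) = pair u v) (x : M) (u v : GenTangent W x) :
    pairing (J x u) (J x v) = pairing u v := by
  change pair (flatEnd J x (flat u)) (flatEnd J x (flat v)) = pair (flat u) (flat v)
  obtain ⟨g, d, rfl, h⟩ := hp.exists_push u
  rw [h, ← hp.push_pull g (flat v), hJ, hJ, hp.pair_push, hp.pair_push, hJo]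

lemma SmoothSecAt.congr {s t : ∀ x : M, GenTangent W x} {x : M} (hs : SmoothSecAt s x)
    (h : ∀ᶠ y in 𝓝 x, t y = s y) : SmoothSecAt t x := by
  constructor
  · refine hs.1.congr_of_eventuallyEq ?_
    filter_upwards [h] with y hy
    rw [hy]
  · refine hs.2.congr_of_eventuallyEq ?_
    filter_upwards [h] with y hy
    rw [hy]

/-- Near `π g` the field `J s` is obtained by pulling `s` back along a smooth local section,
applying the constant map `J₀`, and pushing forward again. -/
lemma IsTransport.smoothSecAt (hp : HomogProj V W π) (hJ : IsTransport π J J₀)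
    {s : ∀ x : M, GenTangent W x} {x : M} (hs : SmoothSecAt s x) :
    SmoothSecAt (fun y => J y (s y)) x := by
  obtain ⟨g, rfl⟩ := hp.surjective x
  obtain ⟨σ, hσs, hσ1, hσ⟩ := hp.exists_section g
  have h1 : ContMDiffAt 𝓘(ℝ, V) 𝓘(ℝ, W × (W →L[ℝ] ℝ)) ∞ (fun k => pull π k (s (π k))) (σ (π g)) := by
    rw [hσ1]
    exact hp.contMDiffAt_pull hs
  have h2 : ContMDiffAt 𝓘(ℝ, W) 𝓘(ℝ, W × (W →L[ℝ] ℝ)) ∞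
      (fun y => pull π (σ y) (s (π (σ y)))) (π g) := ContMDiffAt.comp (π g) h1 hσs
  have h3 : ContMDiffAt 𝓘(ℝ, W) 𝓘(ℝ, W × (W →L[ℝ] ℝ)) ∞
      (fun y => J₀ (pull π (σ y) (s (π (σ y))))) (π g) :=
    (LinearMap.toContinuousLinearMap J₀).contMDiff.contMDiffAt.comp (π g) h2
  refine (hp.smoothSecAt_push hσs (hσ.mono fun _ h => h.2) h3).congr ?_
  filter_upwards [hσ] with y hy
  change flatEnd J y (flat (s y)) = push π (σ y) (J₀ (pull π (σ y) (flat (s (π (σ y))))))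
  rw [← hJ, hp.push_pull]
  exact congrArg (fun z => flatEnd J z (flat (s z))) hy.2.symm

/-- The generalized complex structure obtained by transporting a structure at the base point. -/
def IsTransport.genComplexStructure (hp : HomogProj V W π) (hJ : IsTransport π J J₀)
    (hJ₀ : ∀ u, J₀ (J₀ u) = -u) (hJo : ∀ u v, pair (J₀ u) (J₀ v) = pair u v)
    (hi : AlgIntegrable G (diracPullback (dproj V W π) (iEigenspace J₀))) :
    GenComplexStructure W M where
  J := J
  smooth _ hU _ hs := (isSmoothOn_iff hU).2 fun x hx =>
    hJ.smoothSecAt hp ((isSmoothOn_iff hU).1 hs x hx)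
  orthogonal := hJ.orthogonal hp hJo
  sq_eq_neg := hJ.sq_eq_neg hp hJ₀
  integrable _ hU _ _ _ _ hs ht hs' ht' hst hst' x hx :=
    hJ.complexCourant_mem hp (hJ.sq_eq_neg hp hJ₀) (hJ.orthogonal hp hJo) hJ₀ hJo hi
      ((isSmoothOn_iff hU).1 hs x hx) ((isSmoothOn_iff hU).1 ht x hx)
      ((isSmoothOn_iff hU).1 hs' x hx) ((isSmoothOn_iff hU).1 ht' x hx)
      (eventually_nhds_iff.2 ⟨_, hst, hU, hx⟩) (eventually_nhds_iff.2 ⟨_, hst', hU, hx⟩)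

lemma IsTransport.invariant (hp : HomogProj V W π) (hJ : IsTransport π J J₀) (g : G) (x : M)
    (u : GenTangent W x) : J (g • x) (translate g x u) = translate g x (J x u) := by
  obtain ⟨h, d, rfl, hd⟩ := hp.exists_push u
  let tr : W × (W →L[ℝ] ℝ) → W × (W →L[ℝ] ℝ) := fun e => flat (translate g (π h) e)
  have htr : ∀ e, tr (push π h e) = push π (g * h) e := fun e => hp.translate_push g h e
  change flatEnd J (g • π h) (tr (flat u)) = tr (flatEnd J (π h) (flat u))
  rw [hd, hJ, htr, htr, ← hp.equivariant]
  exact hJ _ _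

lemma GenComplexStructure.IsInvariant.isTransport (hp : HomogProj V W π)
    {𝒥 : GenComplexStructure W M} (h : 𝒥.IsInvariant G) :
    IsTransport π 𝒥.J (flatEnd 𝒥.J (π 1)) := by
  intro g d
  have h1 : flatEnd 𝒥.J (g • π 1) (flat (translate g (π 1) d)) =
    flat (translate g (π 1) (flatEnd 𝒥.J (π 1) d)) := h g (π 1) d
  rw [hp.translate_one, hp.smul_one] at h1
  exact h1.trans (hp.translate_one g _)

/-- A structure at the base point which is invariant under the stabilizer can be transported. -/
lemma HomogProj.exists_isTransport (hp : HomogProj V W π)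
    (hk : ∀ k : G, π k = π 1 → ∀ d, push π k (J₀ d) = J₀ (push π k d)) :
    ∃ J : ∀ x : M, GenTangent W x →ₗ[ℝ] GenTangent W x, IsTransport π J J₀ := by
  -- Any set-theoretic section will do, without continuity: two choices differ by the stabilizer,
  -- which commutes with `J₀`.
  choose τ hτ using hp.surjective
  refine ⟨fun x => (push π (τ x) ∘ₗ J₀ ∘ₗ pull π (τ x) :), fun g d => ?_⟩
  set h := τ (π g) with hh
  change push π h (J₀ (pull π h (push π g d))) = push π g (J₀ d)
  have h1 : π (g⁻¹ * h) = π 1 := hp.mk_eq (hτ _)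
  have h2 : ∀ e : W × (W →L[ℝ] ℝ), push π h e = push π g (push π (g⁻¹ * h) e) := by
    intro e
    rw [← hp.push_mul g h1, mul_inv_cancel_left]
  have h3 : push π g d = push π h (pull π (g⁻¹ * h) d) := by rw [h2, hp.push_pull]
  rw [h3, hp.pull_push, h2, hk _ h1, hp.push_pull]

variable {E : Submodule ℂ (ℂ ⊗[ℝ] V)} {ε : E [⋀^Fin 2]→ₗ[ℂ] ℂ}

/-- The action of `Ad(k)` on the double of the Lie algebra covers the isotropy action and preserves
`L(E, ε)`. So the isotropy action preserves the eigenspace of `J₀`, which is to commute with `J₀`.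
-/
lemma LieGCPair.push_comm (hp : HomogProj V W π) (h : LieGCPair G (dproj V W π) E ε)
    (hK : IsPreconnected {k : G | π k = π 1}) (hJ₀ : ∀ u, J₀ (J₀ u) = -u)
    (hL : diracPullback (dproj V W π) (iEigenspace J₀) = diracSubmodule E ε) {k : G}
    (hk : π k = π 1) (d : W × (W →L[ℝ] ℝ)) : push π k (J₀ d) = J₀ (push π k d) := by
  have hP := hp.dproj_surjective
  have hk' : π k⁻¹ = π 1 := by simpa using hp.mk_eq (g := k) (h := 1) hk.symm
  obtain ⟨p1, p2⟩ := h.preserves hp hK hk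
  obtain ⟨q1, q2⟩ := h.preserves hp hK hk'
  let A : V × (V →L[ℝ] ℝ) → V × (V →L[ℝ] ℝ) := fun w => (adInv k⁻¹ w.1, w.2.comp (adInv k))
  have hA : ∀ {w : V × (V →L[ℝ] ℝ)} {d : W × (W →L[ℝ] ℝ)}, Rel (dproj V W π) w d → Rel (dproj V W π) (A w) (push π k d) := by
    intro w d hw
    refine ⟨?_, ContinuousLinearMap.ext fun v => ?_⟩
    · change dproj V W π (adInv k⁻¹ w.1) = dsmul W k (π 1) d.1
      rw [dproj_adInv hp hk', hw.1, inv_inv]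
    · change w.2 (adInv k v) = d.2 (dsmul W k⁻¹ (π k) (dproj V W π v))
      rw [hw.2, hk]
      exact congrArg d.2 (dproj_adInv hp hk v)
  have hAm : ∀ w w', cpx w w' ∈ diracSpace E ε → cpx (A w) (A w') ∈ diracSpace E ε := by
    rintro w w' ⟨h1, h2⟩
    have e1 : vecPart (cpx (A w) (A w')) = cadInv k⁻¹ (vecPart (cpx w w')) := by
      rw [vecPart_cpx, vecPart_cpx, cadInv_cpx]
    have h3 := q1 _ h1
    refine ⟨by rw [e1]; exact h3, fun Y => ?_⟩
    have e2 : covecPart (cpx (A w) (A w')) Y = covecPart (cpx w w') (cadInv k Y) := by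
      obtain ⟨a, b, hab⟩ := exists_cpx (Y : ℂ ⊗[ℝ] V)
      rw [hab, cadInv_cpx, covecPart_cpx, covecPart_cpx]
      rfl
    have e3 : cadInv k⁻¹ (cadInv k (Y : ℂ ⊗[ℝ] V)) = Y := by
      rw [← cadInv_mul, mul_inv_cancel, cadInv_one]
    rw [e2, h2 ⟨_, p1 _ Y.2⟩, ← q2, alt_congr_left ε (x' := ⟨_, h3⟩) e1]
    exact congrArg (fun y => ε ![_, y]) (Subtype.ext e3)
  obtain ⟨w, hw⟩ := exists_rel hP d
  obtain ⟨w', hw'⟩ := exists_rel hP (-J₀ d)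
  have m1 : cpx w w' ∈ diracPullback (dproj V W π) (iEigenspace J₀) :=
    mem_diracPullback.2 ⟨_, _, hw, hw', (mem_iEigenspace hJ₀ _ _).2 rfl⟩
  have m2 : cpx (A w) (A w') ∈ diracPullback (dproj V W π) (iEigenspace J₀) := by
    rw [hL] at m1 ⊢
    exact hAm _ _ m1
  obtain ⟨e, e', r1, r2, r3⟩ := mem_diracPullback.1 m2
  rw [mem_iEigenspace hJ₀, r1.unique hP (hA hw), r2.unique hP (hA hw'), map_neg, neg_inj] at r3
  exact r3

end Transport

/-! ### The bijection. -/

section Correspondence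
variable {V : Type*} [NormedAddCommGroup V] [NormedSpace ℝ V] [FiniteDimensional ℝ V] [CompleteSpace V]
  {W : Type*} [NormedAddCommGroup W] [NormedSpace ℝ W] [FiniteDimensional ℝ W] [CompleteSpace W]
  {G : Type*} [Group G] [TopologicalSpace G] [ChartedSpace V G] [LieGroup 𝓘(ℝ, V) ∞ G]
  {M : Type*} [TopologicalSpace M] [ChartedSpace W M] [IsManifold 𝓘(ℝ, W) ∞ M] [MulAction G M]
  {π : G → M} {K : Subgroup G}

/-- `E` is the image of the vector projection, and covectors over `x` restrict on `E` to `ε(x, ·)`.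
Since the type of `ε` depends on `E`, the conclusion is heterogeneous. -/
lemma diracSpace_injective {E E' : Submodule ℂ (ℂ ⊗[ℝ] V)} {ε : E [⋀^Fin 2]→ₗ[ℂ] ℂ}
    {ε' : E' [⋀^Fin 2]→ₗ[ℂ] ℂ} (h : diracSpace E ε = diracSpace E' ε') : E = E' ∧ HEq ε ε' := by
  have hE : E = E' := by
    refine le_antisymm (fun x hx => ?_) (fun x hx => ?_)
    · obtain ⟨w, hw, hwx⟩ := exists_mem_diracSpace (ε := ε) ⟨x, hx⟩
      rw [h] at hw
      obtain ⟨h1, -⟩ := hw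
      rwa [hwx] at h1
    · obtain ⟨w, hw, hwx⟩ := exists_mem_diracSpace (ε := ε') ⟨x, hx⟩
      rw [← h] at hw
      obtain ⟨h1, -⟩ := hw
      rwa [hwx] at h1
  subst hE
  refine ⟨rfl, heq_of_eq (AlternatingMap.ext fun v => ?_)⟩
  have hv : v = ![v 0, v 1] := by
    funext i
    fin_cases i <;> rfl
  obtain ⟨w, hw, hwx⟩ := exists_mem_diracSpace (ε := ε) (v 0)
  have hw' := hw
  rw [h] at hw'
  obtain ⟨h1, h2⟩ := hw
  obtain ⟨h3, h4⟩ := hw'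
  rw [hv, ← alt_congr_left ε (x := ⟨_, h1⟩) hwx, ← alt_congr_left ε' (x := ⟨_, h3⟩) hwx, ← h2, ← h4]

lemma mem_subgroupLieAlgebraC_iff (hp : HomogProj V W π) (hK : ∀ k, k ∈ K ↔ π k = π 1)
    (z : ℂ ⊗[ℝ] V) : z ∈ subgroupLieAlgebraC V K ↔
      ∃ a b, z = cpx a b ∧ dproj V W π a = 0 ∧ dproj V W π b = 0 := by
  have hk := hp.mem_subgroupLieAlgebra_iff hK
  have hone : ∀ a : V, dproj V W π a = 0 → cpx a 0 ∈ subgroupLieAlgebraC V K := by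
    intro a ha
    rw [← one_tmul_eq_cpx]
    exact Submodule.subset_span ⟨a, (hk a).2 ha, rfl⟩
  constructor
  · intro h
    let S : Submodule ℂ (ℂ ⊗[ℝ] V) :=
      { carrier := {z | ∃ a b, z = cpx a b ∧ dproj V W π a = 0 ∧ dproj V W π b = 0}
        add_mem' := by
          rintro _ _ ⟨a, b, rfl, ha, hb⟩ ⟨c, d, rfl, hc, hd⟩
          exact ⟨_, _, cpx_add _ _ _ _, by rw [map_add, ha, hc, add_zero],
            by rw [map_add, hb, hd, add_zero]⟩
        zero_mem' := ⟨0, 0, cpx_zero_zero.symm, map_zero _, map_zero _⟩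
        smul_mem' := by
          rintro c _ ⟨a, b, rfl, ha, hb⟩
          refine ⟨_, _, smul_cpx c a b, ?_, ?_⟩ <;> simp [ha, hb] }
    have hle : subgroupLieAlgebraC V K ≤ S := by
      refine Submodule.span_le.2 ?_
      rintro _ ⟨X, hX, rfl⟩
      exact ⟨X, 0, one_tmul_eq_cpx (U := V) X, (hk X).1 hX, map_zero _⟩
    exact hle h
  · rintro ⟨a, b, rfl, ha, hb⟩
    have h1 := (subgroupLieAlgebraC V K).add_mem (hone a ha)
      ((subgroupLieAlgebraC V K).smul_mem Complex.I (hone b hb))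
    have h2 : cpx a b = cpx a 0 + Complex.I • cpx b 0 := by
      rw [I_smul_cpx, cpx_add]
      simp
    rw [h2]
    exact h1

lemma GCPair.lieGCPair (hp : HomogProj V W π) (hK : ∀ k, k ∈ K ↔ π k = π 1) (p : GCPair V K) :
    LieGCPair G (dproj V W π) (show Submodule ℂ (ℂ ⊗[ℝ] V) from p.E.toSubmodule) p.ε where
  ker_le X hX := p.le_E (Submodule.subset_span ⟨X, (hp.mem_subgroupLieAlgebra_iff hK X).2 hX, rfl⟩)
  sup_conj := p.sup_conj
  vanish X hX := p.vanish X ((hp.mem_subgroupLieAlgebra_iff hK X).2 hX)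
  nondegenerate X hX h := (mem_subgroupLieAlgebraC_iff hp hK X.1).1 (p.nondegenerate X hX h)
  lie_mem _ hx _ hy := p.E.lie_mem hx hy
  closed := p.closed

/-- A pair satisfying the conditions relative to the projection is a GC-pair. -/
def LieGCPair.gcPair (hp : HomogProj V W π) (hK : ∀ k, k ∈ K ↔ π k = π 1)
    {E : Submodule ℂ (ℂ ⊗[ℝ] V)} {ε : E [⋀^Fin 2]→ₗ[ℂ] ℂ} (h : LieGCPair G (dproj V W π) E ε) :
    GCPair V K where
  E := { toSubmodule := E, lie_mem' := fun hx hy => h.lie_mem _ hx _ hy }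
  ε := ε
  le_E z hz := by
    obtain ⟨a, b, rfl, ha, hb⟩ := (mem_subgroupLieAlgebraC_iff hp hK z).1 hz
    exact E.add_mem (h.ker_le a ha) (by
      have h1 := E.smul_mem Complex.I (h.ker_le b hb)
      rwa [TensorProduct.smul_tmul', smul_eq_mul, mul_one] at h1)
  sup_conj := h.sup_conj
  closed := h.closed
  vanish X hX := h.vanish X ((hp.mem_subgroupLieAlgebra_iff hK X).1 hX)
  nondegenerate X hX h' := (mem_subgroupLieAlgebraC_iff hp hK X.1).2 (h.nondegenerate X hX h')

/-- A lift of `d - iJd` also lies in the other pullback; by surjectivity of `P` its image is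
determined, and comparing imaginary parts gives `J d = J' d`. -/
lemma iEigenspace_unique {P : V →L[ℝ] W} (hP : Function.Surjective P)
    {J J' : W × (W →L[ℝ] ℝ) →ₗ[ℝ] W × (W →L[ℝ] ℝ)} (hJ : ∀ u, J (J u) = -u)
    (hJ' : ∀ u, J' (J' u) = -u)
    (h : diracPullback P (iEigenspace J) = diracPullback P (iEigenspace J')) : J = J' := by
  refine LinearMap.ext fun d => ?_
  obtain ⟨w, hw⟩ := exists_rel hP d
  obtain ⟨w', hw'⟩ := exists_rel hP (-J d)
  have h1 : cpx w w' ∈ diracPullback P (iEigenspace J) :=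
    mem_diracPullback.2 ⟨_, _, hw, hw', (mem_iEigenspace hJ _ _).2 rfl⟩
  rw [h] at h1
  obtain ⟨e, e', r1, r2, r3⟩ := mem_diracPullback.1 h1
  rw [mem_iEigenspace hJ', r1.unique hP hw, r2.unique hP hw', neg_inj] at r3
  exact r3

lemma IsTransport.unique (hp : HomogProj V W π)
    {J J' : ∀ x : M, GenTangent W x →ₗ[ℝ] GenTangent W x}
    {J₀ : W × (W →L[ℝ] ℝ) →ₗ[ℝ] W × (W →L[ℝ] ℝ)} (hJ : IsTransport π J J₀)
    (hJ' : IsTransport π J' J₀) : J = J' := by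
  funext x
  refine LinearMap.ext fun u => ?_
  change flatEnd J x (flat u) = flatEnd J' x (flat u)
  obtain ⟨g, d, rfl, h⟩ := hp.exists_push u
  rw [h, hJ, hJ']

/-- `𝒥` corresponds to the pair `p`. -/
def Corresponds (π : G → M) (𝒥 : GenComplexStructure W M) (p : GCPair V K) : Prop :=
  (diracPullback (dproj V W π) (iEigenspace (flatEnd 𝒥.J (π 1))) :
    Set (ℂ ⊗[ℝ] (V × (V →L[ℝ] ℝ)))) =
    diracSpace (show Submodule ℂ (ℂ ⊗[ℝ] V) from p.E.toSubmodule) p.ε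

lemma exists_gcPair (hp : HomogProj V W π) (hK : ∀ k, k ∈ K ↔ π k = π 1)
    {𝒥 : GenComplexStructure W M} (h : 𝒥.IsInvariant G) : ∃ p : GCPair V K, Corresponds π 𝒥 p := by
  have hP := hp.dproj_surjective
  have hJ₀ : ∀ u, flatEnd 𝒥.J (π 1) (flatEnd 𝒥.J (π 1) u) = -u := 𝒥.sq_eq_neg (π 1)
  have hJo : ∀ u v, pair (flatEnd 𝒥.J (π 1) u) (flatEnd 𝒥.J (π 1) v) = pair u v :=
    𝒥.orthogonal (π 1)
  obtain ⟨E, ε, hE⟩ :=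
    (isLagrangian_diracPullback hP (isLagrangian_iEigenspace hJ₀ hJo)).exists_eq_diracSpace
  have hi := 𝒥.algIntegrable hp (h.isTransport hp) hJ₀ hJo
  rw [SetLike.coe_injective (hE.trans coe_diracSubmodule.symm)] at hi
  exact ⟨(lieGCPair_iff.2 ⟨linearGCPair_of_iEigenspace hP hJ₀ hE, hi⟩).gcPair hp hK, hE⟩

/-- Connectedness of `K` enters in this direction: it gives the isotropy invariance needed to
transport the linear structure of the pair. -/
lemma exists_genComplexStructure (hp : HomogProj V W π) (hK : ∀ k, k ∈ K ↔ π k = π 1)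
    (hconn : IsPreconnected (K : Set G)) (p : GCPair V K) :
    ∃ 𝒥 : GenComplexStructure W M, 𝒥.IsInvariant G ∧ Corresponds π 𝒥 p := by
  have h := p.lieGCPair hp hK
  obtain ⟨J₀, hJ₀, hJo, hL⟩ := h.toLinearGCPair.exists_complexStructure hp.dproj_surjective
  have hK' : IsPreconnected {k : G | π k = π 1} := by
    have h1 : (K : Set G) = {k : G | π k = π 1} := Set.ext hK
    rwa [← h1]
  obtain ⟨J, hJ⟩ := hp.exists_isTransport fun k hk d => h.push_comm hp hK' hJ₀ hL hk d
  have hi := (lieGCPair_iff.1 h).2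
  rw [← hL] at hi
  refine ⟨hJ.genComplexStructure hp hJ₀ hJo hi, hJ.invariant hp, ?_⟩
  have h1 : flatEnd J (π 1) = J₀ := LinearMap.ext fun d => by
    have h2 := hJ 1 d
    rwa [hp.push_one, hp.push_one] at h2
  change (diracPullback (dproj V W π) (iEigenspace (flatEnd J (π 1))) :
    Set (ℂ ⊗[ℝ] (V × (V →L[ℝ] ℝ)))) = _
  rw [h1, hL]
  rfl

lemma Corresponds.unique_gcPair {𝒥 : GenComplexStructure W M} {p q : GCPair V K}
    (h1 : Corresponds π 𝒥 p) (h2 : Corresponds π 𝒥 q) : p = q := by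
  have h3 := diracSpace_injective (h1.symm.trans h2)
  obtain ⟨⟨E, _⟩, ε, _, _, _, _, _⟩ := p
  obtain ⟨⟨E', _⟩, ε', _, _, _, _, _⟩ := q
  obtain ⟨h4, h5⟩ := h3
  cases h4
  cases h5
  rfl

lemma Corresponds.unique_structure (hp : HomogProj V W π) {𝒥 𝒥' : GenComplexStructure W M}
    (hi : 𝒥.IsInvariant G) (hi' : 𝒥'.IsInvariant G) {p : GCPair V K}
    (h1 : Corresponds π 𝒥 p) (h2 : Corresponds π 𝒥' p) : 𝒥 = 𝒥' := by
  have h3 : flatEnd 𝒥.J (π 1) = flatEnd 𝒥'.J (π 1) :=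
    iEigenspace_unique hp.dproj_surjective (𝒥.sq_eq_neg (π 1)) (𝒥'.sq_eq_neg (π 1))
      (SetLike.coe_injective (h1.trans h2.symm))
  have t1 := hi.isTransport hp
  rw [h3] at t1
  have h4 := t1.unique hp (hi'.isTransport hp)
  cases 𝒥
  cases 𝒥'
  cases h4
  rfl

/-- Invariant generalized complex structures correspond to GC-pairs. -/
lemma exists_equiv (hp : HomogProj V W π) (hK : ∀ k, k ∈ K ↔ π k = π 1)
    (hconn : IsPreconnected (K : Set G)) :
    ∃ Φ : {𝒥 : GenComplexStructure W M // 𝒥.IsInvariant G} ≃ GCPair V K,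
      ∀ 𝒥, Corresponds π 𝒥.1 (Φ 𝒥) := by
  choose f hf using fun 𝒥 : {𝒥 : GenComplexStructure W M // 𝒥.IsInvariant G} =>
    exists_gcPair hp hK 𝒥.2
  choose r hr1 hr2 using fun p : GCPair V K => exists_genComplexStructure hp hK hconn p
  exact ⟨⟨f, fun p => ⟨r p, hr1 p⟩,
    fun 𝒥 => Subtype.ext ((hr2 _).unique_structure hp (hr1 _) 𝒥.2 (hf 𝒥)),
    fun p => (hf ⟨r p, hr1 p⟩).unique_gcPair (hr2 p)⟩, hf⟩

end Correspondence

end GenCplx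

end

/-- `G` is a real Lie group and `K` a closed connected subgroup. The quotient `G ⧸ K`, with the
quotient topology, carries its smooth structure as a homogeneous space, that is, the unique one for
which the projection `G → G ⧸ K` is a smooth submersion. The bijection is characterized by
`(π^⋆ D)_1 = L(E, ε)`, where `D` is the `i`-eigenbundle. -/
theorem proposition4p7
    {V : Type*} [NormedAddCommGroup V] [NormedSpace ℝ V] [FiniteDimensional ℝ V] [CompleteSpace V]
    {W : Type*} [NormedAddCommGroup W] [NormedSpace ℝ W] [FiniteDimensional ℝ W]
    {G : Type*} [Group G] [TopologicalSpace G] [ChartedSpace V G] [LieGroup 𝓘(ℝ, V) ∞ G]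
    (K : Subgroup G) (hK_closed : IsClosed (K : Set G)) (hK_conn : IsConnected (K : Set G))
    [ChartedSpace W (G ⧸ K)] [IsManifold 𝓘(ℝ, W) ∞ (G ⧸ K)]
    (hπ : Manifold.IsSubmersion 𝓘(ℝ, V) 𝓘(ℝ, W) ∞ (QuotientGroup.mk : G → G ⧸ K)) :
    ∃ Φ : {𝒥 : GenCplx.GenComplexStructure W (G ⧸ K) // 𝒥.IsInvariant G} ≃ GenCplx.GCPair V K,
      ∀ 𝒥 : {𝒥 : GenCplx.GenComplexStructure W (G ⧸ K) // 𝒥.IsInvariant G},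
        (GenCplx.diracPullback
            (mfderiv 𝓘(ℝ, V) 𝓘(ℝ, W) (QuotientGroup.mk : G → G ⧸ K) (1 : G))
            (GenCplx.iEigenspace (𝒥.1.J (QuotientGroup.mk (1 : G)))) :
          Set (ℂ ⊗[ℝ] GenCplx.GenTangent V (1 : G))) =
        GenCplx.diracSpace (Φ 𝒥).E.toSubmodule (Φ 𝒥).ε := by
  haveI : CompleteSpace W := FiniteDimensional.complete ℝ W
  -- `K` is the fibre of the projection over the base point, which is what remains to be checked.
  refine GenCplx.exists_equiv (GenCplx.homogProj_mk K hπ) (fun k => ?_) hK_conn.isPreconnected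
  rw [eq_comm, QuotientGroup.eq, inv_one, one_mul]
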